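/- Let $(M,g)$ be a spacetime: a smooth four-dimensional manifold with a smooth metric of signature $(-,+,+,+)$ and Levi-Civita connection $\nabla$. Suppose that it admits an $R$-frame, i.e. a frame built from the Riemann tensor and its covariant derivatives, and let $\{e_a\}_{a=0}^{3}$ be a smooth oriented orthonormal $R$-frame, with dual basis $\{\theta^a\}$, connection coefficients $\gamma^c_{ab}$ given by $\nabla e_a=\gamma^c_{ab}\,\theta^b\otimes e_c$, and connection tensor $H=\gamma^c_{ab}\,\theta^b\otimes\theta^a\otimes e_c$. Precisely: around every point there is a $p\ge 0$ such that any orthonormal frame at a point $z$ that is close enough to the given frame, and in which $R,\nabla R,\dots,\nabla^pR$ have at $z$ the components that they have in the frame $\{e_a\}$ at some nearby point, is the frame $\{e_a\}$ at $z$. Put $$C^{[1]}_{\alpha\mu\nu\sigma}=\nabla_\alpha H_{\mu\nu\sigma}+{H_{\alpha\mu}}^{\rho}H_{\rho\nu\sigma}+{H_{\alpha\nu}}^{\rho}H_{\mu\rho\sigma}+{H_{\alpha\sigma}}^{\rho}H_{\mu\nu\rho},$$ $$C^{[2]}_{\beta\alpha\mu\nu\sigma}=\nabla_\beta C^{[1]}_{\alpha\mu\nu\sigma}+{H_{\beta\alpha}}^{\rho}C^{[1]}_{\rho\mu\nu\sigma}+{H_{\beta\mu}}^{\rho}C^{[1]}_{\alpha\rho\nu\sigma}+{H_{\beta\nu}}^{\rho}C^{[1]}_{\alpha\mu\rho\sigma}+{H_{\beta\sigma}}^{\rho}C^{[1]}_{\alpha\mu\nu\rho},$$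 let $\eta$ be the metric volume element, with $\eta(e_0,e_1,e_2,e_3)=1$, and let $\eta(S,T)$ denote the tensor $\eta^{\alpha\beta\gamma\delta}S_{\alpha\cdots}T_{\beta\cdots}$. Assume that every point has a neighbourhood on which $C^{[1]}$ is either identically zero or nowhere zero. Then the spacetime admits a $G_3$ of isometries, i.e. around every point the Lie algebra of local Killing fields has dimension exactly three, if and only if $$C^{[1]}\neq 0 \text{ (at every point)},\qquad \eta(C^{[1]},C^{[1]})=0,\qquad \eta(C^{[1]},C^{[2]})=0 .$$ Moreover, these conditions hold if and only if, around every point, all the connection coefficients $\gamma^c_{ab}$ and all their first derivatives $e_d(\gamma^c_{ab})$ are smooth functions of a single smooth function, while the differentials $\mathrm{d}\gamma^c_{ab}$ do not all vanish at any point. -/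

import Mathlib

open scoped Manifold ContDiff Topology

noncomputable section

namespace Spacetime

/-! ### Tensor calculus in a coordinate patch

A coordinate patch is (an open part of) `ℝ⁴`. All tensor fields are represented by their covariant
components; indices are raised with the inverse metric where needed. -/

/-- The coordinate space `ℝ⁴`. -/
abbrev Coord : Type := EuclideanSpace ℝ (Fin 4)

/-- Components `T_{i₁ … i_k}` of a `k`-covariant tensor field. -/
abbrev TensorField (k : ℕ) : Type := Coord → (Fin k → Fin 4) → ℝ

/-- The components `g_{μν}` of a metric. -/
abbrev MetricField : Type := Coord → Matrix (Fin 4) (Fin 4) ℝ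

/-- The components `(e_a)^μ`, in row `a` and column `μ`, of a frame. -/
abbrev FrameField : Type := Coord → Matrix (Fin 4) (Fin 4) ℝ

/-- The `μ`-th coordinate vector. -/
def coordVec (μ : Fin 4) : Coord := EuclideanSpace.single μ (1 : ℝ)

/-- The partial derivative `∂_μ f`. -/
def pd (μ : Fin 4) (f : Coord → ℝ) (y : Coord) : ℝ := fderiv ℝ f y (coordVec μ)

/-- The signature symbol `diag(-1, 1, 1, 1)`. -/
def minkowski (a b : Fin 4) : ℝ := if a = b then (if a = 0 then -1 else 1) else 0

/-- The Christoffel symbol `Γ^ρ_{μν}` of the Levi-Civita connection. -/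
def christoffel (g : MetricField) (ρ μ ν : Fin 4) (y : Coord) : ℝ :=
  (1 / 2) * ∑ σ, (g y)⁻¹ ρ σ *
    (pd μ (fun z => g z σ ν) y + pd ν (fun z => g z σ μ) y - pd σ (fun z => g z μ ν) y)

/-- The covariant derivative `(∇T)_{α i₁ … i_k} = ∇_α T_{i₁ … i_k}`; the new index comes first. -/
def covD (g : MetricField) {k : ℕ} (T : TensorField k) : TensorField (k + 1) := fun y I =>
  pd (I 0) (fun z => T z (Fin.tail I)) y
    - ∑ j : Fin k, ∑ ρ, christoffel g ρ (I 0) (Fin.tail I j) y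
        * T y (Function.update (Fin.tail I) j ρ)

/-- The curvature `R^ρ_{σμν}`, i.e. `R(∂_μ, ∂_ν) ∂_σ = R^ρ_{σμν} ∂_ρ`. -/
def riemannUp (g : MetricField) (ρ σ μ ν : Fin 4) (y : Coord) : ℝ :=
  pd μ (christoffel g ρ ν σ) y - pd ν (christoffel g ρ μ σ) y
    + ∑ l, (christoffel g ρ μ l y * christoffel g l ν σ y
        - christoffel g ρ ν l y * christoffel g l μ σ y)

/-- The Riemann tensor `R_{ρσμν}`. -/
def riemann (g : MetricField) : TensorField 4 := fun y I =>
  ∑ κ, g y (I 0) κ * riemannUp g κ (I 1) (I 2) (I 3) y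

/-- The iterated covariant derivative `∇^p R` of the Riemann tensor. -/
def nablaRiemann (g : MetricField) : (p : ℕ) → TensorField (4 + p)
  | 0 => riemann g
  | p + 1 => covD g (nablaRiemann g p)

/-- The component `T(f_{a₁}, …, f_{a_k})` at `y` of a tensor field in a frame `f` at `y`. -/
def frameComp {k : ℕ} (T : TensorField k) (y : Coord) (f : Matrix (Fin 4) (Fin 4) ℝ)
    (a : Fin k → Fin 4) : ℝ :=
  ∑ J : Fin k → Fin 4, T y J * ∏ i, f (a i) (J i)

/-- The frame `f` at `y` is orthonormal, `g(f_a, f_b) = diag(-1, 1, 1, 1)`. -/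
def IsOrthonormalAt (g : MetricField) (y : Coord) (f : Matrix (Fin 4) (Fin 4) ℝ) : Prop :=
  ∀ a b, ∑ μ, ∑ ν, g y μ ν * f a μ * f b ν = minkowski a b

/-- Near `y₀` the frame field `e` is determined by the Riemann tensor and finitely many of its
covariant derivatives: if an orthonormal frame `f` at a point `z`, close to the given frame, gives
`R, ∇R, …, ∇^p R` at `z` the components that they have at some point `y` in the frame `e(y)`, then
`f` is the frame `e(z)`. (The restriction to frames close to the given one allows for the discrete
ambiguity, such as signs and order of principal directions, of a frame built from tensors.) -/
def IsRiemannFrameAt (g : MetricField) (e : FrameField) (y₀ : Coord) : Prop :=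
  ∃ p : ℕ, ∃ U ∈ 𝓝 y₀, ∃ V ∈ 𝓝 (e y₀), ∀ y ∈ U, ∀ z ∈ U, ∀ f ∈ V, IsOrthonormalAt g z f →
    (∀ k ≤ p, ∀ a, frameComp (nablaRiemann g k) z f a = frameComp (nablaRiemann g k) y (e y) a) →
    f = e z

/-- The component `∇_λ (e_a)^μ`. -/
def nablaFrame (g : MetricField) (e : FrameField) (a l μ : Fin 4) (y : Coord) : ℝ :=
  pd l (fun z => e z a μ) y + ∑ ν, christoffel g μ l ν y * e y a ν

/-- The component `(θ^a)_μ` of the algebraic dual basis of the frame. -/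
def dualFrame (e : FrameField) (a μ : Fin 4) (y : Coord) : ℝ := (e y)⁻¹ μ a

/-- The connection coefficient `γ^c_{ab}` of the frame, `∇ e_a = γ^c_{ab} θ^b ⊗ e_c`. -/
def connCoeff (g : MetricField) (e : FrameField) (c a b : Fin 4) (y : Coord) : ℝ :=
  ∑ l, ∑ μ, dualFrame e c μ y * e y b l * nablaFrame g e a l μ y

/-- The derivative `e_d(f)` of a function in the direction of the frame vector `e_d`. -/
def frameDeriv (e : FrameField) (d : Fin 4) (f : Coord → ℝ) (y : Coord) : ℝ :=
  ∑ μ, e y d μ * pd μ f y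

/-- The connection tensor `H = γ^c_{ab} θ^b ⊗ θ^a ⊗ e_c`, with components `H_{λν}^μ`. -/
def connTensorUp (g : MetricField) (e : FrameField) (l ν μ : Fin 4) (y : Coord) : ℝ :=
  ∑ a, ∑ b, ∑ c, connCoeff g e c a b y * dualFrame e b l y * dualFrame e a ν y * e y c μ

/-- The connection tensor with all indices down, `H_{λνμ}`. -/
def connTensor (g : MetricField) (e : FrameField) : TensorField 3 := fun y I =>
  ∑ ρ, connTensorUp g e (I 0) (I 1) ρ y * g y ρ (I 2)

/-- The tensor `∇_α T_{i₁ … i_k} + ∑_j H_{α i_j}^ρ T_{i₁ … ρ … i_k}`. -/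
def corrD (g : MetricField) (e : FrameField) {k : ℕ} (T : TensorField k) : TensorField (k + 1) :=
  fun y I => covD g T y I
    + ∑ j : Fin k, ∑ ρ, connTensorUp g e (I 0) (Fin.tail I j) ρ y
        * T y (Function.update (Fin.tail I) j ρ)

/-- The differential concomitants `C^{[q]}` of the connection tensor, with `C^{[0]} = H`. -/
def concomitant (g : MetricField) (e : FrameField) : (q : ℕ) → TensorField (3 + q)
  | 0 => connTensor g e
  | q + 1 => corrD g e (concomitant g e q)

/-- The permutation symbol `ε_{i₀ i₁ i₂ i₃}`. -/
def leviCivita (I : Fin 4 → Fin 4) : ℝ :=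
  Matrix.det (Matrix.of fun i j => if I i = j then (1 : ℝ) else 0)

/-- The metric volume element `η_{αβγδ}`, for the orientation with `η(e₀, e₁, e₂, e₃) = 1`. -/
def volDown (g : MetricField) (e : FrameField) (y : Coord) (I : Fin 4 → Fin 4) : ℝ :=
  Real.sign (e y).det * Real.sqrt |(g y).det| * leviCivita I

/-- The metric volume element with its indices raised, `η^{αβγδ}`. -/
def volUp (g : MetricField) (e : FrameField) (y : Coord) (I : Fin 4 → Fin 4) : ℝ :=
  ∑ J : Fin 4 → Fin 4, (∏ i, (g y)⁻¹ (I i) (J i)) * volDown g e y J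

/-- The components `η^{αβγδ} S_{α I} T_{β J}` of the tensor `η(S, T)`. -/
def volContract (g : MetricField) (e : FrameField) {k m : ℕ} (S : TensorField (k + 1))
    (T : TensorField (m + 1)) (y : Coord) (c d : Fin 4) (I : Fin k → Fin 4) (J : Fin m → Fin 4) :
    ℝ :=
  ∑ a, ∑ b, volUp g e y ![a, b, c, d] * S y (Fin.cons a I) * T y (Fin.cons b J)

/-- The Lie derivative `(L_X g)_{αβ}` of the metric. -/
def lieMetric (g : MetricField) (X : Coord → Coord) (y : Coord) (a b : Fin 4) : ℝ :=
  ∑ l, (X y l * pd l (fun z => g z a b) y + g y l b * pd a (fun z => X z l) y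
    + g y a l * pd b (fun z => X z l) y)

/-- `X` is a smooth Killing field near `y₀`. -/
def IsKillingNear (g : MetricField) (y₀ : Coord) (X : Coord → Coord) : Prop :=
  ∀ᶠ y in 𝓝 y₀, ContDiffAt ℝ ∞ X y ∧ ∀ a b, lieMetric g X y a b = 0

theorem differentiableAt_comp {X : Coord → Coord} {y : Coord} (h : ContDiffAt ℝ ∞ X y)
    (l : Fin 4) : DifferentiableAt ℝ (fun z => X z l) y :=
  differentiableAt_euclidean.1 (h.differentiableAt (by simp)) l

theorem IsKillingNear.add {g : MetricField} {y₀ : Coord} {X Y : Coord → Coord}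
    (hX : IsKillingNear g y₀ X) (hY : IsKillingNear g y₀ Y) : IsKillingNear g y₀ (X + Y) := by
  filter_upwards [hX, hY] with y h1 h2
  refine ⟨h1.1.add h2.1, fun a b => ?_⟩
  have key : ∀ m l, pd m (fun z => (X + Y) z l) y
      = pd m (fun z => X z l) y + pd m (fun z => Y z l) y := by
    intro m l
    have : (fun z => (X + Y) z l) = (fun z => X z l) + fun z => Y z l := by
      funext z; simp
    unfold pd
    rw [this, fderiv_add (differentiableAt_comp h1.1 l) (differentiableAt_comp h2.1 l)]
    rfl
  have e1 := h1.2 a b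
  have e2 := h2.2 a b
  unfold lieMetric at e1 e2 ⊢
  have := congrArg₂ (· + ·) e1 e2
  simp only [add_zero, ← Finset.sum_add_distrib] at this
  rw [← this]
  refine Finset.sum_congr rfl fun l _ => ?_
  rw [key, key]
  simp only [Pi.add_apply, PiLp.add_apply]
  ring

theorem IsKillingNear.smul {g : MetricField} {y₀ : Coord} {X : Coord → Coord} (c : ℝ)
    (hX : IsKillingNear g y₀ X) : IsKillingNear g y₀ (c • X) := by
  filter_upwards [hX] with y h1
  refine ⟨h1.1.const_smul c, fun a b => ?_⟩
  have key : ∀ m l, pd m (fun z => (c • X) z l) y = c * pd m (fun z => X z l) y := by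
    intro m l
    have : (fun z => (c • X) z l) = c • fun z => X z l := by
      funext z; simp
    unfold pd
    rw [this, fderiv_const_smul (differentiableAt_comp h1.1 l)]
    rfl
  have e1 := h1.2 a b
  unfold lieMetric at e1 ⊢
  have := congrArg (c * ·) e1
  simp only [mul_zero, Finset.mul_sum] at this
  rw [← this]
  refine Finset.sum_congr rfl fun l _ => ?_
  rw [key, key]
  simp only [Pi.smul_apply, PiLp.smul_apply, smul_eq_mul]
  ring

theorem IsKillingNear.zero (g : MetricField) (y₀ : Coord) :
    IsKillingNear g y₀ (0 : Coord → Coord) := by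
  refine Filter.Eventually.of_forall fun y => ⟨contDiffAt_const, fun a b => ?_⟩
  simp [lieMetric, pd]

/-- The vector space of germs at `y₀` of Killing fields: the Lie algebra of the (local) isometry
group at `y₀`. -/
def killingGerms (g : MetricField) (y₀ : Coord) : Submodule ℝ (Filter.Germ (𝓝 y₀) Coord) where
  carrier := {ξ | ∃ X : Coord → Coord, IsKillingNear g y₀ X ∧ (X : Filter.Germ (𝓝 y₀) Coord) = ξ}
  add_mem' := by
    rintro _ _ ⟨X, hX, rfl⟩ ⟨Y, hY, rfl⟩
    exact ⟨X + Y, hX.add hY, rfl⟩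
  zero_mem' := ⟨0, IsKillingNear.zero g y₀, rfl⟩
  smul_mem' := by
    rintro c _ ⟨X, hX, rfl⟩
    exact ⟨c • X, hX.smul c, rfl⟩

/-- Near `y₀`, the functions `F i` are functions of the single function `x`. -/
def DependOn {ι : Type*} (y₀ : Coord) (x : Coord → ℝ) (F : ι → Coord → ℝ) : Prop :=
  ∀ i, ∃ f : ℝ → ℝ, (∀ᶠ s in 𝓝 (x y₀), ContDiffAt ℝ ∞ f s) ∧ ∀ᶠ y in 𝓝 y₀, F i y = f (x y)

/-! ### Spacetimes -/

section Manifold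

variable (M : Type*) [TopologicalSpace M] [ChartedSpace Coord M]

/-- The (smoothly compatible) local coordinate systems of `M`. -/
abbrev charts : Set (OpenPartialHomeomorph M Coord) := IsManifold.maximalAtlas (𝓡 4) ∞ M

variable {M}

/-- The components in a chart of a field of bilinear forms on the tangent spaces. -/
def formInChart (B : ∀ p : M, TangentSpace (𝓡 4) p →L[ℝ] TangentSpace (𝓡 4) p →L[ℝ] ℝ)
    (φ : OpenPartialHomeomorph M Coord) : MetricField := fun y =>
  Matrix.of fun μ ν => B (φ.symm y)
    (mfderiv (𝓡 4) (𝓡 4) φ.symm y (coordVec μ)) (mfderiv (𝓡 4) (𝓡 4) φ.symm y (coordVec ν))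

/-- The components in a chart of four vector fields. -/
def vectorsInChart (v : Fin 4 → ∀ p : M, TangentSpace (𝓡 4) p)
    (φ : OpenPartialHomeomorph M Coord) : FrameField := fun y =>
  Matrix.of fun a μ =>
    (show Coord from mfderiv (𝓡 4) (𝓡 4) φ (φ.symm y) (v a (φ.symm y))) μ

variable (M) in
/-- A smooth metric of signature `(-, +, +, +)` on a four-dimensional manifold. -/
structure LorentzMetric where
  /-- The metric on each tangent space. -/
  form : ∀ p : M, TangentSpace (𝓡 4) p →L[ℝ] TangentSpace (𝓡 4) p →L[ℝ] ℝ
  symm : ∀ p v w, form p v w = form p w v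
  lorentzian : ∀ p, ∃ v : Fin 4 → TangentSpace (𝓡 4) p,
    ∀ a b, form p (v a) (v b) = minkowski a b
  smooth : ∀ φ ∈ charts M, ContDiffOn ℝ ∞ (fun y μ ν => formInChart form φ y μ ν) φ.target

/-- The components of the metric in a chart. -/
def LorentzMetric.inChart (g : LorentzMetric M) (φ : OpenPartialHomeomorph M Coord) :
    MetricField := formInChart g.form φ

/-- A smooth frame on `M`, orthonormal for `g`. -/
structure OrthonormalFrame (g : LorentzMetric M) where
  /-- The four vector fields of the frame. -/
  vec : Fin 4 → ∀ p : M, TangentSpace (𝓡 4) p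
  orthonormal : ∀ p a b, g.form p (vec a p) (vec b p) = minkowski a b
  smooth : ∀ φ ∈ charts M, ContDiffOn ℝ ∞ (fun y a μ => vectorsInChart vec φ y a μ) φ.target

/-- The components of the frame in a chart. -/
def OrthonormalFrame.inChart {g : LorentzMetric M} (e : OrthonormalFrame g)
    (φ : OpenPartialHomeomorph M Coord) : FrameField := vectorsInChart e.vec φ

/-- The frame is a Riemann-frame: it is built, around every point, from the Riemann tensor and its
covariant derivatives. -/
def OrthonormalFrame.IsRiemannFrame {g : LorentzMetric M} (e : OrthonormalFrame g) : Prop :=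
  ∀ φ ∈ charts M, ∀ y ∈ φ.target, IsRiemannFrameAt (g.inChart φ) (e.inChart φ) y

/-- The components in a chart of the concomitant `C^{[q]}` of the connection tensor of the frame. -/
def OrthonormalFrame.C {g : LorentzMetric M} (e : OrthonormalFrame g) (q : ℕ)
    (φ : OpenPartialHomeomorph M Coord) : TensorField (3 + q) :=
  concomitant (g.inChart φ) (e.inChart φ) q

/-- The spacetime admits a `G_r`: the group of local isometries has dimension `r`, that is, around
every point the vector space of Killing fields has dimension `r`. -/
def LorentzMetric.AdmitsG (g : LorentzMetric M) (r : ℕ) : Prop :=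
  ∀ φ ∈ charts M, ∀ y ∈ φ.target, Module.rank ℝ (killingGerms (g.inChart φ) y) = r

/-- `C^{[1]} ≠ 0`: the tensor field is nowhere zero. -/
def OrthonormalFrame.C1NeZero {g : LorentzMetric M} (e : OrthonormalFrame g) : Prop :=
  ∀ φ ∈ charts M, ∀ y ∈ φ.target, e.C 1 φ y ≠ 0

/-- Every point has a neighbourhood on which `C^{[1]}` is either identically zero or nowhere zero
(the second case is automatic around a point where it does not vanish). -/
def OrthonormalFrame.C1Regular {g : LorentzMetric M} (e : OrthonormalFrame g) : Prop :=
  ∀ φ ∈ charts M, ∀ y ∈ φ.target, e.C 1 φ y = 0 → ∀ᶠ z in 𝓝 y, e.C 1 φ z = 0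

/-- `η(C^{[p+1]}, C^{[q+1]}) = 0`. -/
def OrthonormalFrame.EtaZero {g : LorentzMetric M} (e : OrthonormalFrame g) (p q : ℕ) : Prop :=
  ∀ φ ∈ charts M, ∀ y ∈ φ.target, ∀ c d I J,
    volContract (g.inChart φ) (e.inChart φ) (k := 3 + p) (m := 3 + q)
      (e.C (p + 1) φ) (e.C (q + 1) φ) y c d I J = 0

/-- Around every point the connection coefficients `γ^c_{ab}`, whose differentials do not all
vanish there, and their first derivatives `e_d(γ^c_{ab})` are functions of a single smooth
function. -/
def OrthonormalFrame.SingleFunction {g : LorentzMetric M} (e : OrthonormalFrame g) : Prop :=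
  ∀ φ ∈ charts M, ∀ y₀ ∈ φ.target,
    (∃ c a b, fderiv ℝ (connCoeff (g.inChart φ) (e.inChart φ) c a b) y₀ ≠ 0) ∧
    ∃ x : Coord → ℝ, (∀ᶠ y in 𝓝 y₀, ContDiffAt ℝ ∞ x y) ∧
      DependOn y₀ x (fun i : Fin 4 × Fin 4 × Fin 4 =>
        connCoeff (g.inChart φ) (e.inChart φ) i.1 i.2.1 i.2.2) ∧
      DependOn y₀ x (fun i : Fin 4 × Fin 4 × Fin 4 × Fin 4 =>
        frameDeriv (e.inChart φ) i.1
          (connCoeff (g.inChart φ) (e.inChart φ) i.2.1 i.2.2.1 i.2.2.2))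

end Manifold

end Spacetime

end

/-! # Spacetimes with an `R`-frame and a three-dimensional group of isometries -/

open scoped Manifold ContDiff Topology

set_option maxSynthPendingDepth 3

noncomputable section

namespace Spacetime

/-! ### Parallel sections of a linear total differential equation -/

section Parallel

open Set Metric

variable {V E : Type*} [NormedAddCommGroup V] [NormedSpace ℝ V]
  [NormedAddCommGroup E] [NormedSpace ℝ E]

/-! The tensor operation that builds $C^{[q+1]}$ from $C^{[q]}$ is covariant differentiation for the
flat connection that makes the frame parallel: the Christoffel part of $H$ cancels that of $\nabla$
(`corrD_cons`). In the frame it therefore only differentiates components (`frameSum_corrD`), so up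
to signs the components of $C^{[1]}$ are $e_d(\gamma^c_{ab})$ and those of $C^{[2]}$ are
$e_f(e_d(\gamma^c_{ab}))$. Contraction with $\eta$ is an alternation of the two leading slots
followed by an injective duality, so the conditions on the concomitants say that some $d\gamma$ is
nonzero, that $d\gamma\wedge d\gamma'=0$ and that $d\gamma\wedge d(e_d\gamma')=0$
(`concomitant_conditions_iff`).

The Killing side rests on $[X,e_a]=0$. A Killing field preserves $R$ and every $\nabla^kR$; along
its flow a Lie-transported frame keeps the components of these tensors, and the $R$-frame property
forces it to remain the given frame (`sum_smul_pdMat_frame`). Conversely, a field commuting with an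
orthonormal frame is Killing (`lieMetric_eq_zero_of_commutesAt`). The equations $[X,e_a]=0$
prescribe $dX$ linearly in $X$, so Killing fields are the parallel sections of the connection
`frameConn`. They are determined by their value at one point (`killingValue_injective`), and their
values annihilate all $d\gamma$ and $d(e_d\gamma)$. The curvature of `frameConn` on $\xi$ vanishes
when the structure functions of the frame are stationary along $\xi$ (`frameConn_flat`).

If the values form a three-dimensional space, all these differentials are multiples of one covector.
They cannot all vanish: by the regularity assumption on $C^{[1]}$ the $\gamma$ would then be locally
constant and there would be four independent Killing fields (`wedge_of_rank`). Conversely, let $x$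
be a coefficient with $dx\neq0$. The wedge conditions make $\ker dx$ a parallel subbundle on which
the curvature vanishes, so each of its vectors extends to a Killing field (`exists_killing`,
`rank_of_wedge`).

The second equivalence is the local fact that $dx\wedge dF=0$ with $dx\neq0$ means $F=f(x)$
(`exists_eq_comp_of_wedge`), together with the chain rule. -/

theorem add_smul_mem_ball {y₀ v : V} {r t : ℝ} (hv : ‖v‖ < r) (ht : t ∈ Icc (0 : ℝ) 1) :
    y₀ + t • v ∈ ball y₀ r := by
  rw [mem_ball_iff_norm, add_sub_cancel_left, norm_smul, Real.norm_of_nonneg ht.1]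
  exact (mul_le_of_le_one_left (norm_nonneg v) ht.2).trans_lt hv

theorem hasDerivWithinAt_Ici_of_Icc {u : ℝ → E} {u' : E} {t : ℝ} (ht : t ∈ Ico (0 : ℝ) 1)
    (h : HasDerivWithinAt u u' (Icc 0 1) t) : HasDerivWithinAt u u' (Ici t) t :=
  h.mono_of_mem_nhdsWithin (Filter.mem_of_superset (Icc_mem_nhdsGE ht.2)
    (Icc_subset_Icc_left ht.1))

/-- Parallel transport along a ray. -/
theorem exists_radial_transport [CompleteSpace E] {A : V → V →L[ℝ] E →L[ℝ] E} {y₀ : V} {r : ℝ}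
    (hA : ContinuousOn A (ball y₀ r)) (hr : ∀ y ∈ ball y₀ r, ‖A y‖ * r ≤ 1 / 2) {v : V}
    (hv : ‖v‖ < r) (ξ : E) :
    ∃ u : ℝ → E, u 0 = ξ ∧
      ∀ t ∈ Icc (0 : ℝ) 1, HasDerivWithinAt u (A (y₀ + t • v) v (u t)) (Icc 0 1) t := by
  have bound : ∀ t ∈ Icc (0 : ℝ) 1, ∀ x, ‖A (y₀ + t • v) v x‖ ≤ 1 / 2 * ‖x‖ := by
    intro t ht x
    have h1 := hr _ (add_smul_mem_ball hv ht)
    calc ‖A (y₀ + t • v) v x‖ ≤ ‖A (y₀ + t • v)‖ * ‖v‖ * ‖x‖ :=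
          (A (y₀ + t • v)).le_opNorm₂ v x
      _ ≤ ‖A (y₀ + t • v)‖ * r * ‖x‖ := by gcongr
      _ ≤ 1 / 2 * ‖x‖ := by gcongr
  -- On the closed ball of radius $\|\xi\|$ about $\xi$ the field is at most
  -- $\tfrac12\cdot2\|\xi\|=\|\xi\|$, so a solution cannot leave that ball in unit time. This is why
  -- the smallness constant is $1/2$ and why one application covers all of $[0,1]$.
  have hpl : IsPicardLindelof (fun t x => A (y₀ + t • v) v x) (⟨0, by simp⟩ : Icc (0 : ℝ) 1) ξ
      ‖ξ‖₊ 0 ‖ξ‖₊ (1 / 2) := by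
    refine ⟨fun t ht => ?_, fun x _ => ?_, fun t ht x hx => ?_, by simp⟩
    · refine (LipschitzWith.of_dist_le_mul fun x z => ?_).lipschitzOnWith
      rw [dist_eq_norm, dist_eq_norm, ← map_sub]
      simpa using bound t ht (x - z)
    · have h1 : ContinuousOn (fun t : ℝ => A (y₀ + t • v)) (Icc 0 1) :=
        hA.comp (by fun_prop) fun t ht => add_smul_mem_ball hv ht
      exact (h1.clm_apply continuousOn_const).clm_apply continuousOn_const
    · have h1 := bound t ht x
      have h2 : ‖x‖ ≤ ‖ξ‖ + ‖ξ‖ := by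
        have h3 : ‖x - ξ‖ ≤ ‖ξ‖ := by simpa using mem_closedBall_iff_norm.1 hx
        calc ‖x‖ = ‖ξ + (x - ξ)‖ := by congr 1; abel
          _ ≤ ‖ξ‖ + ‖x - ξ‖ := norm_add_le _ _
          _ ≤ _ := by gcongr
      simp only [coe_nnnorm]
      linarith
  exact hpl.exists_eq_forall_mem_Icc_hasDerivWithinAt₀

/-- A radially parallel section is parallel in all directions where the curvature vanishes on it. -/
theorem hasFDerivAt_of_radial_transport {A : V → V →L[ℝ] E →L[ℝ] E}
    {A' : V → V →L[ℝ] V →L[ℝ] E →L[ℝ] E} {y₀ : V} {r M : ℝ}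
    (hA' : ∀ y ∈ ball y₀ r, HasFDerivAt A (A' y) y)
    (hM : ∀ y ∈ ball y₀ r, ‖A y‖ ≤ M) (hM' : ∀ y ∈ ball y₀ r, ‖A' y‖ ≤ M)
    (hL : ∀ y ∈ ball y₀ r, ∀ z ∈ ball y₀ r, ‖A' z - A' y‖ ≤ M * ‖z - y‖)
    {u : V → ℝ → E} {ξ : E} (hu0 : ∀ v, ‖v‖ < r → u v 0 = ξ)
    (hu : ∀ v, ‖v‖ < r → ∀ t ∈ Icc (0 : ℝ) 1,
      HasDerivWithinAt (u v) (A (y₀ + t • v) v (u v t)) (Icc 0 1) t)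
    {v : V} (hv : ‖v‖ < r)
    (hF : ∀ t ∈ Icc (0 : ℝ) 1, ∀ h,
      A' (y₀ + t • v) v h (u v t) + A (y₀ + t • v) h (A (y₀ + t • v) v (u v t))
        = A' (y₀ + t • v) h v (u v t) + A (y₀ + t • v) v (A (y₀ + t • v) h (u v t))) :
    HasFDerivAt (fun y => u (y - y₀) 1) ((A (y₀ + v)).flip (u v 1)) (y₀ + v) := by
  have hr : 0 < r := (norm_nonneg v).trans_lt hv
  have hM0 : 0 ≤ M := (norm_nonneg _).trans (hM y₀ (mem_ball_self hr))
  have hucont : ∀ v, ‖v‖ < r → ContinuousOn (u v) (Icc 0 1) := fun v hv t ht =>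
    (hu v hv t ht).continuousWithinAt
  obtain ⟨C, hC⟩ := isCompact_Icc.exists_bound_of_continuousOn (hucont v hv)
  have hC0 : 0 ≤ C := (norm_nonneg _).trans (hC 0 (by simp))
  -- The summands are the constants of the quadratic errors `b1`, `b2`, `b3` and `b5`, in this
  -- order.
  set D : ℝ := (M * M + M + M * r + (M + M) * r * M) * C with hD
  have hD0 : 0 ≤ D := by positivity
  have key : ∀ h, ‖h‖ ≤ 1 → ‖v + h‖ < r →
      ‖u (v + h) 1 - u v 1 - A (y₀ + v) h (u v 1)‖ ≤ gronwallBound 0 (M * r) D 1 * ‖h‖ ^ 2 := by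
    intro h h1 hvh
    -- First-order guess for `u (v + h)`: it corrects the transport along $v$ by the value that a
    -- section parallel in all directions would acquire from the displacement $th$. Grönwall's
    -- inequality will show that the guess is right up to $O(\|h\|^2)$.
    set w : ℝ → E := fun t => u v t + t • A (y₀ + t • v) h (u v t) with hw
    set w' : ℝ → E := fun t => A (y₀ + t • v) v (u v t) + (A (y₀ + t • v) h (u v t)
      + t • (A' (y₀ + t • v) v h (u v t) + A (y₀ + t • v) h (A (y₀ + t • v) v (u v t)))) with hw'
    have hwd : ∀ t ∈ Icc (0 : ℝ) 1, HasDerivWithinAt w (w' t) (Icc 0 1) t := by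
      intro t ht
      have hl : HasDerivWithinAt (fun t : ℝ => y₀ + t • v) v (Icc 0 1) t := by
        simpa using (((hasDerivAt_id t).smul_const v).const_add y₀).hasDerivWithinAt
      have hAt : HasDerivWithinAt (fun t : ℝ => A (y₀ + t • v)) (A' (y₀ + t • v) v) (Icc 0 1) t :=
        (hA' _ (add_smul_mem_ball hv ht)).comp_hasDerivWithinAt t hl
      have hAh := (hAt.clm_apply (hasDerivWithinAt_const t (Icc (0 : ℝ) 1) h)).clm_apply
        (hu v hv t ht)
      have := (hu v hv t ht).add ((hasDerivWithinAt_id t _).smul hAh)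
      refine this.congr_deriv ?_
      simp only [hw', id, map_zero, add_zero, one_smul, smul_add]
      abel
    -- First-order Taylor remainder of $A$ for the displacement $th$; it is quadratic in $h$ because
    -- $A'$ is Lipschitz.
    set R : ℝ → V →L[ℝ] E →L[ℝ] E := fun t =>
      A (y₀ + t • (v + h)) - A (y₀ + t • v) - t • A' (y₀ + t • v) h with hR
    have hRb : ∀ t ∈ Icc (0 : ℝ) 1, ‖R t‖ ≤ M * ‖h‖ ^ 2 := by
      intro t ht
      have hp := add_smul_mem_ball (y₀ := y₀) hv ht
      have hq := add_smul_mem_ball (y₀ := y₀) hvh ht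
      have hs : segment ℝ (y₀ + t • v) (y₀ + t • (v + h)) ⊆ ball y₀ r :=
        (convex_ball y₀ r).segment_subset hp hq
      have hth : ‖t • h‖ ≤ ‖h‖ := by
        rw [norm_smul, Real.norm_of_nonneg ht.1]
        exact mul_le_of_le_one_left (norm_nonneg h) ht.2
      have e1 : y₀ + t • (v + h) - (y₀ + t • v) = t • h := by rw [smul_add]; abel
      have := (convex_segment (𝕜 := ℝ) (y₀ + t • v) (y₀ + t • (v + h))).norm_image_sub_le_of_norm_hasFDerivWithin_le'
        (f := A) (f' := A') (φ := A' (y₀ + t • v)) (C := M * ‖h‖)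
        (fun z hz => (hA' z (hs hz)).hasFDerivWithinAt)
        (fun z hz => (hL _ hp _ (hs hz)).trans (by
          gcongr
          refine le_trans ?_ hth
          rw [← e1]
          exact norm_sub_le_of_mem_segment hz))
        (left_mem_segment ℝ _ _) (right_mem_segment ℝ _ _)
      rw [e1, map_smul] at this
      refine this.trans ?_
      calc M * ‖h‖ * ‖t • h‖ ≤ M * ‖h‖ * ‖h‖ := by gcongr
        _ = _ := by ring
    have hg := norm_le_gronwallBound_of_norm_deriv_right_le (f := fun t => u (v + h) t - w t)
      (f' := fun t => A (y₀ + t • (v + h)) (v + h) (u (v + h) t) - w' t) (δ := 0) (K := M * r)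
      (ε := D * ‖h‖ ^ 2) (a := 0) (b := 1)
      (fun t ht => ((hu _ hvh t ht).sub (hwd t ht)).continuousWithinAt)
      (fun t ht => hasDerivWithinAt_Ici_of_Icc ht
        ((hu _ hvh t (Ico_subset_Icc_self ht)).sub (hwd t (Ico_subset_Icc_self ht))))
      (by simp [hw, hu0 _ hv, hu0 _ hvh])
      (by
        intro t ht'
        have ht := Ico_subset_Icc_self ht'
        have hp := add_smul_mem_ball (y₀ := y₀) hv ht
        have hq := add_smul_mem_ball (y₀ := y₀) hvh ht
        have eA : A (y₀ + t • (v + h)) = A (y₀ + t • v) + t • A' (y₀ + t • v) h + R t := by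
          simp only [hR]; abel
        -- The vanishing of the curvature, `hF`, exchanges $v$ and $h$ in `w'`. After the exchange
        -- all terms of first order in $h$ cancel, and only the displayed quadratic ones remain.
        have e : A (y₀ + t • (v + h)) (v + h) (u (v + h) t) - w' t
            = A (y₀ + t • (v + h)) (v + h) (u (v + h) t - w t)
              + (t • A (y₀ + t • v) h (A (y₀ + t • v) h (u v t)) + t • A' (y₀ + t • v) h h (u v t)
                + R t (v + h) (u v t)
                + t • (t • A' (y₀ + t • v) h + R t) (v + h) (A (y₀ + t • v) h (u v t))) := by
          simp only [hw, hw', hF t ht h]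
          rw [map_sub, sub_add, sub_right_inj]
          rw [eA]
          simp only [_root_.add_apply, map_add, map_smul, smul_add,
            _root_.smul_apply]
          abel
        have hut := hC t ht
        have ht0 := ht.1
        have ht1 := ht.2
        have htn : ‖t‖ ≤ 1 := by rwa [Real.norm_of_nonneg ht0]
        have b0 : ‖A (y₀ + t • v) h (u v t)‖ ≤ M * ‖h‖ * C :=
          ((A (y₀ + t • v)).le_opNorm₂ _ _).trans (by gcongr; exact hM _ hp)
        have b1 : ‖t • A (y₀ + t • v) h (A (y₀ + t • v) h (u v t))‖ ≤ M * ‖h‖ * (M * ‖h‖ * C) := by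
          rw [norm_smul]
          refine (mul_le_of_le_one_left (norm_nonneg _) htn).trans ?_
          exact ((A (y₀ + t • v)).le_opNorm₂ _ _).trans (by gcongr; exact hM _ hp)
        have b2 : ‖t • A' (y₀ + t • v) h h (u v t)‖ ≤ M * ‖h‖ * ‖h‖ * C := by
          rw [norm_smul]
          refine (mul_le_of_le_one_left (norm_nonneg _) htn).trans ?_
          refine ((A' (y₀ + t • v) h).le_opNorm₂ _ _).trans ?_
          gcongr
          exact ((A' _).le_opNorm h).trans (by gcongr; exact hM' _ hp)
        have b3 : ‖R t (v + h) (u v t)‖ ≤ M * ‖h‖ ^ 2 * r * C :=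
          ((R t).le_opNorm₂ _ _).trans (by gcongr; exact hRb t ht)
        have b4 : ‖t • A' (y₀ + t • v) h + R t‖ ≤ (M + M) * ‖h‖ := by
          refine (norm_add_le _ _).trans ?_
          have c1 : ‖t • A' (y₀ + t • v) h‖ ≤ M * ‖h‖ := by
            rw [norm_smul]
            refine (mul_le_of_le_one_left (norm_nonneg _) htn).trans ?_
            exact ((A' _).le_opNorm h).trans (by gcongr; exact hM' _ hp)
          have c2 : M * ‖h‖ ^ 2 ≤ M * ‖h‖ := by
            gcongr
            rw [sq]
            exact mul_le_of_le_one_left (norm_nonneg _) h1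
          have := hRb t ht
          linarith
        have b5 : ‖t • (t • A' (y₀ + t • v) h + R t) (v + h) (A (y₀ + t • v) h (u v t))‖
            ≤ (M + M) * ‖h‖ * r * (M * ‖h‖ * C) := by
          rw [norm_smul]
          refine (mul_le_of_le_one_left (norm_nonneg _) htn).trans ?_
          exact ((t • A' (y₀ + t • v) h + R t).le_opNorm₂ _ _).trans (by gcongr)
        have b6 : ‖A (y₀ + t • (v + h)) (v + h) (u (v + h) t - w t)‖
            ≤ M * r * ‖u (v + h) t - w t‖ :=
          ((A (y₀ + t • (v + h))).le_opNorm₂ _ _).trans (by gcongr; exact hM _ hq)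
        rw [e]
        refine (norm_add_le _ _).trans (add_le_add b6 ?_)
        refine (norm_add_le _ _).trans ?_
        refine (add_le_add ((norm_add_le _ _).trans (add_le_add ((norm_add_le _ _).trans
          (add_le_add b1 b2)) b3)) b5).trans (le_of_eq ?_)
        rw [hD]
        ring)
      1 (by simp)
    -- For zero initial error the Grönwall bound is linear in the defect, so the factor $\|h\|^2$
    -- comes out.
    have e2 : gronwallBound 0 (M * r) (D * ‖h‖ ^ 2) (1 - 0)
        = gronwallBound 0 (M * r) D 1 * ‖h‖ ^ 2 := by
      unfold gronwallBound
      split_ifs <;> ring_nf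
    rw [e2] at hg
    refine le_trans (le_of_eq ?_) hg
    simp only [hw, one_smul]
    congr 1
    abel
  rw [hasFDerivAt_iff_isLittleO_nhds_zero]
  have hO : (fun h => u (y₀ + v + h - y₀) 1 - u (y₀ + v - y₀) 1
      - ((A (y₀ + v)).flip (u v 1)) h) =O[𝓝 0] fun h : V => ‖h‖ ^ 2 := by
    refine Asymptotics.IsBigO.of_bound (gronwallBound 0 (M * r) D 1) ?_
    have n1 : ∀ᶠ h : V in 𝓝 0, ‖h‖ < 1 := by
      filter_upwards [Metric.ball_mem_nhds (0 : V) one_pos] with h hh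
      simpa using hh
    have n2 : ∀ᶠ h : V in 𝓝 0, ‖v + h‖ < r := by
      have : Filter.Tendsto (fun h : V => ‖v + h‖) (𝓝 0) (𝓝 ‖v + 0‖) :=
        (by fun_prop : Continuous fun h : V => ‖v + h‖).tendsto 0
      rw [add_zero] at this
      exact this.eventually_lt_const hv
    filter_upwards [n1, n2] with h h1 h2
    have e1 : y₀ + v + h - y₀ = v + h := by abel
    have e2 : y₀ + v - y₀ = v := by abel
    rw [e1, e2, norm_pow, norm_norm, ContinuousLinearMap.flip_apply]
    exact key h h1.le h2
  exact hO.trans_isLittleO (by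
    simpa using (Asymptotics.isLittleO_norm_pow_id (E' := V) one_lt_two))

/-- Bootstrapping: the derivative of $X$ is a smooth bilinear expression in $A$ and $X$, so each
order of differentiability of $X$ yields the next. -/
theorem contDiffOn_of_parallel {A : V → V →L[ℝ] E →L[ℝ] E} {X : V → E} {s : Set V} (hs : IsOpen s)
    (hA : ContDiffOn ℝ ∞ A s) (hX : ∀ y ∈ s, HasFDerivAt X ((A y).flip (X y)) y) :
    ContDiffOn ℝ ∞ X s := by
  have hflip : ContDiffOn ℝ ∞ (fun y => (A y).flip) s :=
    (ContinuousLinearMap.flipₗᵢ ℝ V E E).toContinuousLinearEquiv.contDiff.comp_contDiffOn hA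
  rw [contDiffOn_infty]
  intro n
  induction n with
  | zero =>
    exact contDiffOn_zero.2 fun y hy => (hX y hy).continuousAt.continuousWithinAt
  | succ n ih =>
    have := (contDiffOn_succ_iff_fderiv_of_isOpen (𝕜 := ℝ) (f := X) (n := n) hs).2
      ⟨fun y hy => (hX y hy).differentiableAt.differentiableWithinAt, by simp, by
        refine ContDiffOn.congr ?_ fun y hy => (hX y hy).fderiv
        exact (hflip.of_le (by exact_mod_cast le_top)).clm_apply ih⟩
    exact_mod_cast this

/-- A parallel section that vanishes at a point vanishes around it. -/
theorem eventually_eq_zero_of_parallel {A : V → V →L[ℝ] E →L[ℝ] E} {X : V → E} {y₀ : V}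
    (hA : ContinuousAt A y₀) (hX : ∀ᶠ y in 𝓝 y₀, HasFDerivAt X ((A y).flip (X y)) y)
    (h0 : X y₀ = 0) : ∀ᶠ y in 𝓝 y₀, X y = 0 := by
  have hb : ∀ᶠ y in 𝓝 y₀, ‖A y‖ < ‖A y₀‖ + 1 := hA.norm.eventually_lt_const (by linarith)
  obtain ⟨r, hr, h⟩ := Metric.eventually_nhds_iff_ball.1 (hb.and hX)
  refine Metric.eventually_nhds_iff_ball.2 ⟨r, hr, fun y hy => ?_⟩
  have hv : ‖y - y₀‖ < r := by rwa [← mem_ball_iff_norm]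
  have hd : ∀ t ∈ Icc (0 : ℝ) 1, HasDerivAt (fun t : ℝ => X (y₀ + t • (y - y₀)))
      (A (y₀ + t • (y - y₀)) (y - y₀) (X (y₀ + t • (y - y₀)))) t := by
    intro t ht
    have hl : HasDerivAt (fun t : ℝ => y₀ + t • (y - y₀)) (y - y₀) t := by
      simpa using ((hasDerivAt_id t).smul_const (y - y₀)).const_add y₀
    have := (h _ (add_smul_mem_ball hv ht)).2.comp_hasDerivAt t hl
    exact this
  have := eq_zero_of_abs_deriv_le_mul_abs_self_of_eq_zero_right
    (K := (‖A y₀‖ + 1) * r)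
    (fun t ht => (hd t ht).continuousAt.continuousWithinAt)
    (fun t ht => (hd t (Ico_subset_Icc_self ht)).hasDerivWithinAt) (by simp [h0])
    (fun t ht => ((A _).le_opNorm₂ _ _).trans (by
      gcongr
      exact (h _ (add_smul_mem_ball hv (Ico_subset_Icc_self ht))).1.le)) 1 (by simp)
  simpa using this

/-- Existence of parallel sections with values in a parallel kernel on which the curvature
vanishes. -/
theorem exists_parallel_section [CompleteSpace E] {A : V → V →L[ℝ] E →L[ℝ] E} {κ : V → E →L[ℝ] ℝ}
    {μ : V → V →L[ℝ] ℝ} {y₀ : V} (hA : ∀ᶠ y in 𝓝 y₀, ContDiffAt ℝ ∞ A y)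
    (hκ : ∀ᶠ y in 𝓝 y₀, DifferentiableAt ℝ κ y) (hμ : ContinuousAt μ y₀)
    (hκA : ∀ᶠ y in 𝓝 y₀, ∀ h ξ, fderiv ℝ κ y h ξ + κ y (A y h ξ) = μ y h * κ y ξ)
    (hF : ∀ᶠ y in 𝓝 y₀, ∀ ξ, κ y ξ = 0 → ∀ v h,
      fderiv ℝ A y v h ξ + A y h (A y v ξ) = fderiv ℝ A y h v ξ + A y v (A y h ξ))
    {ξ : E} (hξ : κ y₀ ξ = 0) :
    ∃ X : V → E, X y₀ = ξ ∧ ∀ᶠ y in 𝓝 y₀,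
      ContDiffAt ℝ ∞ X y ∧ HasFDerivAt X ((A y).flip (X y)) y ∧ κ y (X y) = 0 := by
  have hA0 := hA.self_of_nhds
  have hA1 : ContDiffAt ℝ 1 (fderiv ℝ A) y₀ := hA0.fderiv_right (by norm_cast)
  obtain ⟨L, s, hs, hLs⟩ := hA1.exists_lipschitzOnWith
  have b1 : ∀ᶠ y in 𝓝 y₀, ‖A y‖ < ‖A y₀‖ + 1 :=
    hA0.continuousAt.norm.eventually_lt_const (by linarith)
  have b2 : ∀ᶠ y in 𝓝 y₀, ‖fderiv ℝ A y‖ < ‖fderiv ℝ A y₀‖ + 1 :=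
    hA1.continuousAt.norm.eventually_lt_const (by linarith)
  have b3 : ∀ᶠ y in 𝓝 y₀, ‖μ y‖ < ‖μ y₀‖ + 1 := hμ.norm.eventually_lt_const (by linarith)
  obtain ⟨r₀, hr₀, H⟩ := Metric.eventually_nhds_iff_ball.1
    (hA.and (hκ.and (hκA.and (hF.and (b1.and (b2.and (b3.and hs)))))))
  -- One constant dominates $\|A\|$, $\|A'\|$ and the Lipschitz constant of $A'$ near $y_0$; the
  -- radius is then cut down to have $Mr\le1/2$, as the radial transport needs.
  set M : ℝ := ‖A y₀‖ + 1 + (‖fderiv ℝ A y₀‖ + 1) + L with hMdef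
  have hMpos : 0 < M := by positivity
  set r : ℝ := min r₀ (1 / (2 * M)) with hrdef
  have hr : 0 < r := lt_min hr₀ (by positivity)
  have hsub : ball y₀ r ⊆ ball y₀ r₀ := ball_subset_ball (min_le_left _ _)
  have hrM : M * r ≤ 1 / 2 := by
    have : r ≤ 1 / (2 * M) := min_le_right _ _
    calc M * r ≤ M * (1 / (2 * M)) := by gcongr
      _ = 1 / 2 := by field_simp
  have c1 : ∀ y ∈ ball y₀ r, ‖A y‖ ≤ M := fun y hy => by
    have := (H y (hsub hy)).2.2.2.2.1
    have : 0 ≤ ‖fderiv ℝ A y₀‖ := norm_nonneg _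
    have : (0 : ℝ) ≤ L := L.2
    linarith
  have c2 : ∀ y ∈ ball y₀ r, ‖fderiv ℝ A y‖ ≤ M := fun y hy => by
    have := (H y (hsub hy)).2.2.2.2.2.1
    have : 0 ≤ ‖A y₀‖ := norm_nonneg _
    have : (0 : ℝ) ≤ L := L.2
    linarith
  have c3 : ∀ y ∈ ball y₀ r, ∀ z ∈ ball y₀ r,
      ‖fderiv ℝ A z - fderiv ℝ A y‖ ≤ M * ‖z - y‖ := fun y hy z hz => by
    have h1 := hLs.dist_le_mul z (H z (hsub hz)).2.2.2.2.2.2.2 y (H y (hsub hy)).2.2.2.2.2.2.2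
    rw [dist_eq_norm, dist_eq_norm] at h1
    refine h1.trans ?_
    gcongr
    have : 0 ≤ ‖A y₀‖ := norm_nonneg _
    have : 0 ≤ ‖fderiv ℝ A y₀‖ := norm_nonneg _
    linarith
  have hAd : ∀ y ∈ ball y₀ r, HasFDerivAt A (fderiv ℝ A y) y := fun y hy =>
    ((H y (hsub hy)).1.differentiableAt (by simp)).hasFDerivAt
  have hAc : ContinuousOn A (ball y₀ r) := fun y hy => (hAd y hy).continuousAt.continuousWithinAt
  have hex : ∀ v : V, ∃ u : ℝ → E, ‖v‖ < r → u 0 = ξ ∧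
      ∀ t ∈ Icc (0 : ℝ) 1, HasDerivWithinAt u (A (y₀ + t • v) v (u t)) (Icc 0 1) t := by
    intro v
    by_cases hv : ‖v‖ < r
    · obtain ⟨u, hu⟩ := exists_radial_transport hAc
        (fun y hy => (mul_le_mul_of_nonneg_right (c1 y hy) hr.le).trans hrM) hv ξ
      exact ⟨u, fun _ => hu⟩
    · exact ⟨0, fun h => absurd h hv⟩
  choose u hu using hex
  -- Along a ray the number $\kappa(u)$ solves a homogeneous linear scalar equation with factor
  -- $\mu(v)$ and starts at $0$, hence stays $0$. Thus the transport never leaves the kernel, where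
  -- the curvature is known to vanish.
  have hker : ∀ v, ‖v‖ < r → ∀ t ∈ Icc (0 : ℝ) 1, κ (y₀ + t • v) (u v t) = 0 := by
    intro v hv
    have hd : ∀ t ∈ Icc (0 : ℝ) 1, HasDerivWithinAt (fun t : ℝ => κ (y₀ + t • v) (u v t))
        (μ (y₀ + t • v) v * κ (y₀ + t • v) (u v t)) (Icc 0 1) t := by
      intro t ht
      have hp := hsub (add_smul_mem_ball (y₀ := y₀) hv ht)
      have hl : HasDerivWithinAt (fun t : ℝ => y₀ + t • v) v (Icc 0 1) t := by
        simpa using (((hasDerivAt_id t).smul_const v).const_add y₀).hasDerivWithinAt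
      have h1 := (H _ hp).2.1.hasFDerivAt.comp_hasDerivWithinAt t hl
      refine (h1.clm_apply ((hu v hv).2 t ht)).congr_deriv ?_
      exact (H _ hp).2.2.1 v _
    refine eq_zero_of_abs_deriv_le_mul_abs_self_of_eq_zero_right (K := (‖μ y₀‖ + 1) * r)
      (fun t ht => (hd t ht).continuousWithinAt)
      (fun t ht => hasDerivWithinAt_Ici_of_Icc ht (hd t (Ico_subset_Icc_self ht)))
      (by simp [(hu v hv).1, hξ]) (fun t ht => ?_)
    have hp := hsub (add_smul_mem_ball (y₀ := y₀) hv (Ico_subset_Icc_self ht))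
    rw [norm_mul]
    gcongr
    exact ((μ _).le_opNorm v).trans (by
      gcongr
      exact (H _ hp).2.2.2.2.2.2.1.le)
  have hX : ∀ y ∈ ball y₀ r, HasFDerivAt (fun y => u (y - y₀) 1)
      ((A y).flip (u (y - y₀) 1)) y := by
    intro y hy
    have hv : ‖y - y₀‖ < r := by rwa [← mem_ball_iff_norm]
    have := hasFDerivAt_of_radial_transport hAd c1 c2 c3 (fun v hv => (hu v hv).1)
      (fun v hv => (hu v hv).2) hv (fun t ht h =>
        (H _ (hsub (add_smul_mem_ball (y₀ := y₀) hv ht))).2.2.2.1 _ (hker _ hv t ht) _ _)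
    simpa using this
  refine ⟨fun y => u (y - y₀) 1, ?_, ?_⟩
  -- For $v=0$ the transport equation reads $u'=0$, so the value at time $1$ is still $\xi$.
  · have h0 : ‖(0 : V)‖ < r := by simpa using hr
    have := (convex_Icc (0 : ℝ) 1).is_const_of_fderivWithin_eq_zero (𝕜 := ℝ) (f := u 0)
      (fun t ht => ((hu 0 h0).2 t ht).differentiableWithinAt)
      (fun t ht => by
        have h1 := ((hu 0 h0).2 t ht).hasFDerivWithinAt.fderivWithin
          (uniqueDiffOn_Icc zero_lt_one t ht)
        rw [h1]
        ext
        simp)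
      (right_mem_Icc.2 zero_le_one) (left_mem_Icc.2 zero_le_one)
    simpa [(hu 0 h0).1] using this
  · have hsm := contDiffOn_of_parallel isOpen_ball
      (fun y hy => (H y (hsub hy)).1.contDiffWithinAt) hX
    refine Metric.eventually_nhds_iff_ball.2 ⟨r, hr, fun y hy => ⟨?_, hX y hy, ?_⟩⟩
    · exact hsm.contDiffAt (isOpen_ball.mem_nhds hy)
    · have hv : ‖y - y₀‖ < r := by rwa [← mem_ball_iff_norm]
      simpa using hker _ hv 1 (by simp)

end Parallel

/-! ### Linear algebra of covariant tensors -/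

section TensorAlgebra

variable {k : ℕ}

/-- The action of a matrix on covariant tensors as a derivation. -/
def act : Matrix (Fin 4) (Fin 4) ℝ →ₗ[ℝ] ((Fin k → Fin 4) → ℝ) →ₗ[ℝ] ((Fin k → Fin 4) → ℝ) :=
  LinearMap.mk₂ ℝ (fun M T I => ∑ j, ∑ l, M (I j) l * T (Function.update I j l))
    (fun M N T => by ext I; simp [add_mul, Finset.sum_add_distrib])
    (fun c M T => by ext I; simp [Finset.mul_sum, mul_assoc])
    (fun M S T => by ext I; simp [mul_add, Finset.sum_add_distrib])
    (fun c M T => by ext I; simp [Finset.mul_sum, mul_left_comm])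

theorem act_apply (M : Matrix (Fin 4) (Fin 4) ℝ) (T : (Fin k → Fin 4) → ℝ) (I : Fin k → Fin 4) :
    act M T I = ∑ j, ∑ l, M (I j) l * T (Function.update I j l) := rfl

theorem act_cons (M : Matrix (Fin 4) (Fin 4) ℝ) (T : (Fin (k + 1) → Fin 4) → ℝ) (a : Fin 4)
    (J : Fin k → Fin 4) :
    act M T (Fin.cons a J) = ∑ l, M a l * T (Fin.cons l J)
      + act M (fun J => T (Fin.cons a J)) J := by
  simp [act_apply, Fin.sum_univ_succ (n := k), Fin.cons_update]

theorem act_zero_rank (M : Matrix (Fin 4) (Fin 4) ℝ) (T : (Fin 0 → Fin 4) → ℝ) : act M T = 0 := by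
  ext I
  simp [act_apply]

/-- Matrices act on tensors as a representation of the Lie algebra of matrices. By induction on the
rank, splitting off the first slot: the terms in which the two matrices hit different slots cancel.
-/
theorem act_act_sub (M N : Matrix (Fin 4) (Fin 4) ℝ) (T : (Fin k → Fin 4) → ℝ) :
    act M (act N T) - act N (act M T) = act (M * N - N * M) T := by
  induction k with
  | zero => simp [act_zero_rank]
  | succ k ih =>
    ext I
    rw [← Fin.cons_self_tail I]
    generalize I 0 = a
    generalize Fin.tail I = J
    have e : ∀ M N : Matrix (Fin 4) (Fin 4) ℝ, (fun J => act N T (Fin.cons a J))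
        = ∑ l, N a l • (fun J => T (Fin.cons l J)) + act N fun J => T (Fin.cons a J) := by
      intro M N
      ext J
      simp [act_cons]
    have h := congrFun (ih fun J => T (Fin.cons a J)) J
    simp only [Pi.sub_apply] at h ⊢
    rw [act_cons, act_cons, act_cons, e M N, e N M]
    simp only [map_add, map_sum, map_smul, Pi.add_apply, Finset.sum_apply, Pi.smul_apply,
      smul_eq_mul, ← h, act_cons, Matrix.sub_apply, Matrix.mul_apply, sub_mul, mul_add,
      Finset.sum_add_distrib, Finset.sum_sub_distrib, Finset.mul_sum, Finset.sum_mul]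
    rw [Finset.sum_comm (f := fun x i => M a x * (N x i * T (Fin.cons i J))),
      Finset.sum_comm (f := fun x i => N a x * (M x i * T (Fin.cons i J)))]
    simp only [mul_assoc]
    ring

/-- The components of a covariant tensor with respect to the rows of a matrix. -/
def frameSum (T : (Fin k → Fin 4) → ℝ) (f : Matrix (Fin 4) (Fin 4) ℝ) (a : Fin k → Fin 4) : ℝ :=
  ∑ J : Fin k → Fin 4, T J * ∏ i, f (a i) (J i)

theorem frameSum_zero_rank (T : (Fin 0 → Fin 4) → ℝ) (f : Matrix (Fin 4) (Fin 4) ℝ)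
    (a : Fin 0 → Fin 4) : frameSum T f a = T a := by
  simp only [frameSum, Finset.univ_unique, Finset.sum_singleton, Finset.univ_eq_empty,
    Finset.prod_empty, mul_one]
  exact congrArg T (Subsingleton.elim _ _)

theorem frameSum_cons (T : (Fin (k + 1) → Fin 4) → ℝ) (f : Matrix (Fin 4) (Fin 4) ℝ) (b : Fin 4)
    (a : Fin k → Fin 4) :
    frameSum T f (Fin.cons b a) = ∑ α, f b α * frameSum (fun J => T (Fin.cons α J)) f a := by
  unfold frameSum
  rw [← (Fin.consEquiv fun _ => Fin 4).sum_comp, Fintype.sum_prod_type]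
  refine Finset.sum_congr rfl fun α _ => ?_
  rw [Finset.mul_sum]
  refine Finset.sum_congr rfl fun J _ => ?_
  simp [Fin.consEquiv, Fin.prod_univ_succ]
  ring

theorem frameSum_add (S T : (Fin k → Fin 4) → ℝ) (f : Matrix (Fin 4) (Fin 4) ℝ)
    (a : Fin k → Fin 4) : frameSum (S + T) f a = frameSum S f a + frameSum T f a := by
  simp [frameSum, add_mul, Finset.sum_add_distrib]

theorem frameSum_smul (c : ℝ) (T : (Fin k → Fin 4) → ℝ) (f : Matrix (Fin 4) (Fin 4) ℝ)
    (a : Fin k → Fin 4) : frameSum (c • T) f a = c * frameSum T f a := by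
  simp [frameSum, Finset.mul_sum, mul_assoc]

theorem frameSum_zero (f : Matrix (Fin 4) (Fin 4) ℝ) (a : Fin k → Fin 4) :
    frameSum 0 f a = 0 := by
  simp [frameSum]

theorem frameSum_sum {ι : Type*} (s : Finset ι) (T : ι → (Fin k → Fin 4) → ℝ)
    (f : Matrix (Fin 4) (Fin 4) ℝ) (a : Fin k → Fin 4) :
    frameSum (∑ i ∈ s, T i) f a = ∑ i ∈ s, frameSum (T i) f a := by
  simp only [frameSum, Finset.sum_apply, Finset.sum_mul]
  exact Finset.sum_comm

/-- With `frameSum_one` this makes the passage to frame components invertible: the inverse matrix of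
the frame leads back to coordinate components. -/
theorem frameSum_frameSum (T : (Fin k → Fin 4) → ℝ) (f h : Matrix (Fin 4) (Fin 4) ℝ)
    (a : Fin k → Fin 4) : frameSum (frameSum T f) h a = frameSum T (h * f) a := by
  induction k with
  | zero => simp [frameSum_zero_rank]
  | succ k ih =>
    rw [← Fin.cons_self_tail a]
    generalize a 0 = b
    generalize Fin.tail a = a
    rw [frameSum_cons, frameSum_cons]
    have : ∀ α, (fun J => frameSum T f (Fin.cons α J))
        = ∑ β, f α β • frameSum (fun J => T (Fin.cons β J)) f := by
      intro α
      ext J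
      simp [frameSum_cons]
    simp only [this, frameSum_sum, frameSum_smul, ih, Matrix.mul_apply, Finset.sum_mul,
      Finset.mul_sum, mul_assoc]
    exact Finset.sum_comm

theorem frameSum_one (T : (Fin k → Fin 4) → ℝ) (a : Fin k → Fin 4) : frameSum T 1 a = T a := by
  induction k with
  | zero => simp [frameSum_zero_rank]
  | succ k ih =>
    rw [← Fin.cons_self_tail a, frameSum_cons]
    simp [ih, Matrix.one_apply]

/-- Leibniz rule, with the motion $f'=fM$ of the frame transferred to the tensor as the derivation
`act M`. It serves twice: for Lie transport, where $M$ is the gradient of $X$, and for the corrected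
derivative, where $M$ is built from `frameGrad`. -/
theorem hasDerivAt_frameSum {T : ℝ → (Fin k → Fin 4) → ℝ} {T' : (Fin k → Fin 4) → ℝ}
    {f : ℝ → Matrix (Fin 4) (Fin 4) ℝ} {M : Matrix (Fin 4) (Fin 4) ℝ} {t : ℝ}
    (hT : ∀ J, HasDerivAt (fun s => T s J) (T' J) t)
    (hf : ∀ a μ, HasDerivAt (fun s => f s a μ) ((f t * M) a μ) t) (a : Fin k → Fin 4) :
    HasDerivAt (fun s => frameSum (T s) (f s) a) (frameSum (T' + act M (T t)) (f t) a) t := by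
  induction k with
  | zero =>
    simp only [frameSum_zero_rank, act_zero_rank, add_zero]
    exact hT a
  | succ k ih =>
    rw [← Fin.cons_self_tail a]
    generalize a 0 = b
    generalize Fin.tail a = a
    simp only [frameSum_cons]
    have h1 := HasDerivAt.fun_sum (u := Finset.univ) fun α (_ : α ∈ Finset.univ) =>
      (hf b α).mul (ih (T := fun s J => T s (Fin.cons α J)) (T' := fun J => T' (Fin.cons α J))
        (fun J => hT _) a)
    refine h1.congr_deriv ?_
    have : ∀ α, (fun J => (T' + act M (T t)) (Fin.cons α J))
        = ∑ l, M α l • (fun J => T t (Fin.cons l J))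
          + ((fun J => T' (Fin.cons α J)) + act M fun J => T t (Fin.cons α J)) := by
      intro α
      ext J
      simp [act_cons]
      ring
    simp only [this, frameSum_add, frameSum_sum, frameSum_smul, Finset.sum_add_distrib, mul_add,
      Matrix.mul_apply, Finset.sum_mul, Finset.mul_sum]
    rw [Finset.sum_comm]
    simp only [mul_assoc]

end TensorAlgebra

/-! ### Partial derivatives -/

section PartialDerivatives

variable {f h : Coord → ℝ} {y : Coord}

theorem pd_add (hf : ContDiffAt ℝ ∞ f y) (hh : ContDiffAt ℝ ∞ h y) (μ : Fin 4) :
    pd μ (fun z => f z + h z) y = pd μ f y + pd μ h y := by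
  unfold pd
  rw [fderiv_fun_add (hf.differentiableAt (by simp)) (hh.differentiableAt (by simp))]
  rfl

theorem pd_sub (hf : ContDiffAt ℝ ∞ f y) (hh : ContDiffAt ℝ ∞ h y) (μ : Fin 4) :
    pd μ (fun z => f z - h z) y = pd μ f y - pd μ h y := by
  unfold pd
  rw [fderiv_fun_sub (hf.differentiableAt (by simp)) (hh.differentiableAt (by simp))]
  rfl

theorem pd_mul (hf : ContDiffAt ℝ ∞ f y) (hh : ContDiffAt ℝ ∞ h y) (μ : Fin 4) :
    pd μ (fun z => f z * h z) y = pd μ f y * h y + f y * pd μ h y := by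
  unfold pd
  rw [fderiv_fun_mul (hf.differentiableAt (by simp)) (hh.differentiableAt (by simp))]
  simp only [_root_.add_apply, _root_.smul_apply, smul_eq_mul]
  ring

theorem pd_sum {ι : Type*} {s : Finset ι} {F : ι → Coord → ℝ}
    (hF : ∀ i ∈ s, ContDiffAt ℝ ∞ (F i) y) (μ : Fin 4) :
    pd μ (fun z => ∑ i ∈ s, F i z) y = ∑ i ∈ s, pd μ (F i) y := by
  unfold pd
  rw [fderiv_fun_sum fun i hi => (hF i hi).differentiableAt (by simp)]
  simp

theorem pd_const (c : ℝ) (μ : Fin 4) : pd μ (fun _ => c) y = 0 := by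
  simp [pd]

theorem pd_congr (hfh : f =ᶠ[𝓝 y] h) (μ : Fin 4) : pd μ f y = pd μ h y := by
  unfold pd
  rw [hfh.fderiv_eq]

theorem contDiffAt_pd (hf : ContDiffAt ℝ ∞ f y) (μ : Fin 4) : ContDiffAt ℝ ∞ (pd μ f) y :=
  (hf.fderiv_right (m := ∞) (by norm_cast)).clm_apply contDiffAt_const

theorem pd_comm (hf : ContDiffAt ℝ ∞ f y) (μ ν : Fin 4) :
    pd μ (pd ν f) y = pd ν (pd μ f) y := by
  have h1 : DifferentiableAt ℝ (fderiv ℝ f) y :=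
    (hf.fderiv_right (m := ∞) (by norm_cast)).differentiableAt (by simp)
  have key : ∀ μ ν, pd μ (pd ν f) y = fderiv ℝ (fderiv ℝ f) y (coordVec μ) (coordVec ν) := by
    intro μ ν
    change fderiv ℝ (fun z => fderiv ℝ f z (coordVec ν)) y (coordVec μ) = _
    rw [fderiv_clm_apply h1 (differentiableAt_const _)]
    simp
  rw [key, key]
  exact (hf.isSymmSndFDerivAt (by simp; decide)).eq _ _

theorem sum_smul_coordVec (v : Coord) : ∑ μ, v μ • coordVec μ = v := by
  ext i
  simp [coordVec, Pi.single_apply]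

theorem fderiv_eq_sum_pd (f : Coord → ℝ) (y v : Coord) :
    fderiv ℝ f y v = ∑ μ, v μ * pd μ f y := by
  conv_lhs => rw [← sum_smul_coordVec v]
  simp [pd]

/-- The entrywise partial derivative of a family of functions. -/
def pdFam {ι : Type*} (μ : Fin 4) (T : Coord → ι → ℝ) (y : Coord) : ι → ℝ :=
  fun i => pd μ (fun z => T z i) y

/-- The entrywise partial derivative of a matrix of functions. -/
def pdMat (μ : Fin 4) (M : Coord → Matrix (Fin 4) (Fin 4) ℝ) (y : Coord) :
    Matrix (Fin 4) (Fin 4) ℝ :=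
  Matrix.of fun i j => pd μ (fun z => M z i j) y

/-- Smoothness of all components. -/
def SmoothFam {ι : Type*} (T : Coord → ι → ℝ) (y : Coord) : Prop :=
  ∀ i, ContDiffAt ℝ ∞ (fun z => T z i) y

/-- Smoothness of all entries. -/
def SmoothMat (M : Coord → Matrix (Fin 4) (Fin 4) ℝ) (y : Coord) : Prop :=
  ∀ i j, ContDiffAt ℝ ∞ (fun z => M z i j) y

theorem SmoothFam.pdFam {ι : Type*} {T : Coord → ι → ℝ} (hT : SmoothFam T y) (μ : Fin 4) :
    SmoothFam (pdFam μ T) y := fun i => contDiffAt_pd (hT i) μ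

theorem SmoothMat.pdMat {M : Coord → Matrix (Fin 4) (Fin 4) ℝ} (hM : SmoothMat M y) (μ : Fin 4) :
    SmoothMat (pdMat μ M) y := fun i j => contDiffAt_pd (hM i j) μ

theorem SmoothMat.mul {M N : Coord → Matrix (Fin 4) (Fin 4) ℝ} (hM : SmoothMat M y)
    (hN : SmoothMat N y) : SmoothMat (fun z => M z * N z) y := fun i j => by
  simp only [Matrix.mul_apply]
  exact ContDiffAt.sum fun l _ => (hM i l).mul (hN l j)

theorem SmoothMat.add {M N : Coord → Matrix (Fin 4) (Fin 4) ℝ} (hM : SmoothMat M y)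
    (hN : SmoothMat N y) : SmoothMat (fun z => M z + N z) y := fun i j => (hM i j).add (hN i j)

theorem SmoothMat.sub {M N : Coord → Matrix (Fin 4) (Fin 4) ℝ} (hM : SmoothMat M y)
    (hN : SmoothMat N y) : SmoothMat (fun z => M z - N z) y := fun i j => (hM i j).sub (hN i j)

theorem SmoothMat.smul {M : Coord → Matrix (Fin 4) (Fin 4) ℝ} (hf : ContDiffAt ℝ ∞ f y)
    (hM : SmoothMat M y) : SmoothMat (fun z => f z • M z) y := fun i j => hf.mul (hM i j)

theorem SmoothMat.sum {ι : Type*} {s : Finset ι} {M : ι → Coord → Matrix (Fin 4) (Fin 4) ℝ}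
    (hM : ∀ i ∈ s, SmoothMat (M i) y) : SmoothMat (fun z => ∑ i ∈ s, M i z) y := fun i j => by
  simp only [Matrix.sum_apply]
  exact ContDiffAt.sum fun l hl => hM l hl i j

theorem SmoothMat.transpose {M : Coord → Matrix (Fin 4) (Fin 4) ℝ} (hM : SmoothMat M y) :
    SmoothMat (fun z => (M z).transpose) y := fun i j => hM j i

theorem pdMat_add {M N : Coord → Matrix (Fin 4) (Fin 4) ℝ} (hM : SmoothMat M y)
    (hN : SmoothMat N y) (μ : Fin 4) :
    pdMat μ (fun z => M z + N z) y = pdMat μ M y + pdMat μ N y := by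
  ext i j
  exact pd_add (hM i j) (hN i j) μ

theorem pdMat_sub {M N : Coord → Matrix (Fin 4) (Fin 4) ℝ} (hM : SmoothMat M y)
    (hN : SmoothMat N y) (μ : Fin 4) :
    pdMat μ (fun z => M z - N z) y = pdMat μ M y - pdMat μ N y := by
  ext i j
  exact pd_sub (hM i j) (hN i j) μ

theorem pdMat_mul {M N : Coord → Matrix (Fin 4) (Fin 4) ℝ} (hM : SmoothMat M y)
    (hN : SmoothMat N y) (μ : Fin 4) :
    pdMat μ (fun z => M z * N z) y = pdMat μ M y * N y + M y * pdMat μ N y := by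
  ext i j
  simp only [pdMat, Matrix.of_apply, Matrix.mul_apply, Matrix.add_apply]
  rw [pd_sum fun l _ => (hM i l).mul (hN l j), ← Finset.sum_add_distrib]
  exact Finset.sum_congr rfl fun l _ => pd_mul (hM i l) (hN l j) μ

theorem pdMat_smul {M : Coord → Matrix (Fin 4) (Fin 4) ℝ} (hf : ContDiffAt ℝ ∞ f y)
    (hM : SmoothMat M y) (μ : Fin 4) :
    pdMat μ (fun z => f z • M z) y = pd μ f y • M y + f y • pdMat μ M y := by
  ext i j
  exact pd_mul hf (hM i j) μ

theorem pdMat_sum {ι : Type*} {s : Finset ι} {M : ι → Coord → Matrix (Fin 4) (Fin 4) ℝ}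
    (hM : ∀ i ∈ s, SmoothMat (M i) y) (μ : Fin 4) :
    pdMat μ (fun z => ∑ i ∈ s, M i z) y = ∑ i ∈ s, pdMat μ (M i) y := by
  ext i j
  simp only [pdMat, Matrix.of_apply, Matrix.sum_apply]
  exact pd_sum (fun l hl => hM l hl i j) μ

theorem pdMat_congr {M N : Coord → Matrix (Fin 4) (Fin 4) ℝ} (h : M =ᶠ[𝓝 y] N) (μ : Fin 4) :
    pdMat μ M y = pdMat μ N y := by
  ext i j
  exact pd_congr (h.fun_comp fun m => m i j) μ

theorem pdMat_comm {M : Coord → Matrix (Fin 4) (Fin 4) ℝ} (hM : SmoothMat M y) (μ ν : Fin 4) :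
    pdMat μ (pdMat ν M) y = pdMat ν (pdMat μ M) y := by
  ext i j
  exact pd_comm (hM i j) μ ν

theorem SmoothMat.act {k : ℕ} {M : Coord → Matrix (Fin 4) (Fin 4) ℝ} {T : TensorField k}
    (hM : SmoothMat M y) (hT : SmoothFam T y) : SmoothFam (fun z => act (M z) (T z)) y := fun I => by
  simp only [act_apply]
  exact ContDiffAt.sum fun j _ => ContDiffAt.sum fun l _ => (hM _ _).mul (hT _)

theorem pd_act {k : ℕ} {M : Coord → Matrix (Fin 4) (Fin 4) ℝ} {T : TensorField k}
    (hM : SmoothMat M y) (hT : SmoothFam T y) (μ : Fin 4) :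
    pdFam μ (fun z => act (M z) (T z)) y = act (pdMat μ M y) (T y) + act (M y) (pdFam μ T y) := by
  ext I
  simp only [pdFam, act_apply, Pi.add_apply]
  rw [pd_sum fun j _ => ContDiffAt.sum fun l _ => (hM _ _).mul (hT _), ← Finset.sum_add_distrib]
  refine Finset.sum_congr rfl fun j _ => ?_
  rw [pd_sum fun l _ => (hM _ _).mul (hT _), ← Finset.sum_add_distrib]
  exact Finset.sum_congr rfl fun l _ => pd_mul (hM _ _) (hT _) μ

end PartialDerivatives

/-! ### The Lie derivative -/

section LieDerivative

/-- The matrix `∂_σ X^l`. -/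
def gradX (X : Coord → Coord) (y : Coord) : Matrix (Fin 4) (Fin 4) ℝ :=
  Matrix.of fun σ l => pd σ (fun z => X z l) y

/-- The Lie derivative of a covariant tensor field. -/
def lieD {k : ℕ} (X : Coord → Coord) (T : TensorField k) : TensorField k := fun y =>
  ∑ l, X y l • pdFam l T y + act (gradX X y) (T y)

/-- The Christoffel symbols `Γ^ρ_{ασ}` as a matrix with row `σ` and column `ρ`. -/
def chrMat (g : MetricField) (α : Fin 4) (y : Coord) : Matrix (Fin 4) (Fin 4) ℝ :=
  Matrix.of fun σ ρ => christoffel g ρ α σ y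

/-- The Lie derivative of the connection. -/
def lieChr (g : MetricField) (X : Coord → Coord) (α : Fin 4) (y : Coord) :
    Matrix (Fin 4) (Fin 4) ℝ :=
  ∑ l, X y l • pdMat l (chrMat g α) y + ∑ l, gradX X y α l • chrMat g l y
    + (gradX X y * chrMat g α y - chrMat g α y * gradX X y) + pdMat α (gradX X) y

theorem covD_cons (g : MetricField) {k : ℕ} (T : TensorField k) (y : Coord) (α : Fin 4) :
    (fun J => covD g T y (Fin.cons α J)) = pdFam α T y - act (chrMat g α y) (T y) := by
  ext J
  rfl

theorem smoothMat_gradX {X : Coord → Coord} {y : Coord} (hX : SmoothFam (fun z l => X z l) y) :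
    SmoothMat (gradX X) y := fun σ l => contDiffAt_pd (hX l) σ

/-- This is the commutation formula $\mathcal L_X\nabla T-\nabla\mathcal L_XT=-(\mathcal
L_X\Gamma)\cdot T$, whose second term drops out because $\mathcal L_XT$ vanishes near the point. -/
theorem lieD_covD {g : MetricField} {X : Coord → Coord} {k : ℕ} {T : TensorField k} {y : Coord}
    (hX : SmoothFam (fun z l => X z l) y) (hΓ : ∀ α, SmoothMat (chrMat g α) y)
    (hT : SmoothFam T y) (h0 : ∀ᶠ z in 𝓝 y, lieD X T z = 0) (α : Fin 4) (J : Fin k → Fin 4) :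
    lieD X (covD g T) y (Fin.cons α J) = -act (lieChr g X α y) (T y) J := by
  have e1 : (fun J => lieD X (covD g T) y (Fin.cons α J))
      = ∑ l, X y l • pdFam l (fun z => pdFam α T z - act (chrMat g α z) (T z)) y
        + ∑ l, gradX X y α l • (pdFam l T y - act (chrMat g l y) (T y))
        + act (gradX X y) (pdFam α T y - act (chrMat g α y) (T y)) := by
    ext J
    simp only [lieD, Pi.add_apply, act_cons, covD_cons, Finset.sum_apply, Pi.smul_apply, smul_eq_mul,
      add_assoc]
    rfl
  have e2 : ∀ l, pdFam l (fun z => pdFam α T z - act (chrMat g α z) (T z)) y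
      = pdFam α (pdFam l T) y - (act (pdMat l (chrMat g α) y) (T y)
        + act (chrMat g α y) (pdFam l T y)) := by
    intro l
    rw [← pd_act (hΓ α) hT]
    ext J
    simp only [Pi.sub_apply]
    rw [show pdFam α (pdFam l T) y J = pdFam l (pdFam α T) y J from pd_comm (hT J) α l]
    exact pd_sub (hT.pdFam α J) ((hΓ α).act hT J) l
  -- The partial derivative $\partial_\alpha$ of $\mathcal L_XT=0$, expanded; it eliminates the
  -- second derivatives of $T$.
  have e3 : ∑ l, (gradX X y α l • pdFam l T y + X y l • pdFam α (pdFam l T) y)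
      + (act (pdMat α (gradX X) y) (T y) + act (gradX X y) (pdFam α T y)) = 0 := by
    rw [← pd_act (smoothMat_gradX hX) hT]
    have : pdFam α (lieD X T) y = 0 := by
      ext J
      have : (fun z => lieD X T z J) =ᶠ[𝓝 y] fun _ => 0 := by
        filter_upwards [h0] with z hz
        rw [hz]
        rfl
      exact (pd_congr this α).trans (pd_const 0 α)
    rw [← this]
    ext J
    simp only [Pi.add_apply, Finset.sum_apply, Pi.smul_apply, smul_eq_mul]
    have hs : ∀ l ∈ Finset.univ, ContDiffAt ℝ ∞ (fun z => X z l * pdFam l T z J) y := fun l _ =>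
      (hX l).mul (hT.pdFam l J)
    have : pdFam α (lieD X T) y J = pd α (fun z => ∑ l, X z l * pdFam l T z J
        + act (gradX X z) (T z) J) y := by
      simp only [pdFam, lieD, Pi.add_apply, Finset.sum_apply, Pi.smul_apply, smul_eq_mul]
    rw [this, pd_add (ContDiffAt.sum hs) ((smoothMat_gradX hX).act hT J), pd_sum hs]
    congr 1
    refine Finset.sum_congr rfl fun l _ => ?_
    rw [pd_mul (hX l) (hT.pdFam l J)]
    rfl
  have e4 : ∑ l, X y l • pdFam l T y = -act (gradX X y) (T y) :=
    eq_neg_of_add_eq_zero_left h0.self_of_nhds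
  have e5 := act_act_sub (gradX X y) (chrMat g α y) (T y)
  have e6 : ∑ l, X y l • pdFam α (pdFam l T) y = -(∑ l, gradX X y α l • pdFam l T y
      + (act (pdMat α (gradX X) y) (T y) + act (gradX X y) (pdFam α T y))) := by
    rw [Finset.sum_add_distrib] at e3
    rw [eq_neg_iff_add_eq_zero, ← e3]
    abel
  have e7 : ∑ l, X y l • act (chrMat g α y) (pdFam l T y)
      = -act (chrMat g α y) (act (gradX X y) (T y)) := by
    rw [← map_neg, ← e4]
    simp
  refine (congrFun e1 J).trans ?_
  rw [← Pi.neg_apply]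
  refine congrFun ?_ J
  simp only [e2, lieChr, smul_sub, smul_add, Finset.sum_sub_distrib, Finset.sum_add_distrib, e6, e7,
    map_add, map_sum, map_smul, map_sub, LinearMap.add_apply, LinearMap.sum_apply,
    LinearMap.smul_apply, LinearMap.sub_apply]
  simp only [map_sub, LinearMap.sub_apply] at e5
  rw [← e5]
  abel

end LieDerivative

/-! ### Orthonormal frames on an open set of the coordinate space -/

/-- A smooth metric with a smooth orthonormal frame on an open set. -/
structure LocalFrame (Ω : Set Coord) (g : MetricField) (e : FrameField) : Prop where
  isOpen : IsOpen Ω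
  smooth_g : ∀ y ∈ Ω, SmoothMat g y
  symm : ∀ y ∈ Ω, ∀ μ ν, g y μ ν = g y ν μ
  smooth_e : ∀ y ∈ Ω, SmoothMat e y
  orthonormal : ∀ y ∈ Ω, IsOrthonormalAt g y (e y)

/-- The Minkowski metric as a matrix. -/
def minkMat : Matrix (Fin 4) (Fin 4) ℝ := Matrix.of minkowski

theorem minkMat_mul_self : minkMat * minkMat = 1 := by
  ext i j
  fin_cases i <;> fin_cases j <;> simp [minkMat, minkowski, Matrix.mul_apply]

theorem isOrthonormalAt_iff {g : MetricField} {y : Coord} {f : Matrix (Fin 4) (Fin 4) ℝ} :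
    IsOrthonormalAt g y f ↔ f * g y * f.transpose = minkMat := by
  constructor
  · intro h
    ext a b
    refine Eq.trans ?_ (h a b)
    simp only [Matrix.mul_apply, Matrix.transpose_apply, Finset.sum_mul]
    rw [Finset.sum_comm]
    exact Finset.sum_congr rfl fun _ _ => Finset.sum_congr rfl fun _ _ => by ring
  · intro h a b
    refine Eq.trans ?_ (congrFun (congrFun h a) b)
    simp only [Matrix.mul_apply, Matrix.transpose_apply, Finset.sum_mul]
    rw [Finset.sum_comm]
    exact Finset.sum_congr rfl fun _ _ => Finset.sum_congr rfl fun _ _ => by ring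

theorem SmoothMat.congr {M N : Coord → Matrix (Fin 4) (Fin 4) ℝ} {y : Coord} (hM : SmoothMat M y)
    (h : N =ᶠ[𝓝 y] M) : SmoothMat N y := fun i j =>
  (hM i j).congr_of_eventuallyEq (h.fun_comp fun m => m i j)

theorem smoothMat_const (M : Matrix (Fin 4) (Fin 4) ℝ) (y : Coord) : SmoothMat (fun _ => M) y :=
  fun _ _ => contDiffAt_const

namespace LocalFrame

variable {Ω : Set Coord} {g : MetricField} {e : FrameField} {y : Coord}

theorem mem_nhds (lf : LocalFrame Ω g e) (hy : y ∈ Ω) : Ω ∈ 𝓝 y := lf.isOpen.mem_nhds hy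

theorem mono (lf : LocalFrame Ω g e) {U : Set Coord} (hU : IsOpen U) (h : U ⊆ Ω) :
    LocalFrame U g e :=
  ⟨hU, fun y hy => lf.smooth_g y (h hy), fun y hy => lf.symm y (h hy),
    fun y hy => lf.smooth_e y (h hy), fun y hy => lf.orthonormal y (h hy)⟩

/-- Since $e\,g\,e^{T}$ is the Minkowski matrix, whose square is $1$, the inverses of both $e$ and
$g$ are polynomials in the entries of $e$ and $g$. Invertibility and smoothness of the inverses come
from these formulas. -/
theorem mul_coframe (lf : LocalFrame Ω g e) (hy : y ∈ Ω) :
    e y * (g y * (e y).transpose * minkMat) = 1 := by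
  rw [← Matrix.mul_assoc, ← Matrix.mul_assoc, isOrthonormalAt_iff.1 (lf.orthonormal y hy),
    minkMat_mul_self]

theorem inv_frame (lf : LocalFrame Ω g e) (hy : y ∈ Ω) :
    (e y)⁻¹ = g y * (e y).transpose * minkMat :=
  Matrix.inv_eq_right_inv (lf.mul_coframe hy)

theorem frame_mul_inv (lf : LocalFrame Ω g e) (hy : y ∈ Ω) : e y * (e y)⁻¹ = 1 := by
  rw [lf.inv_frame hy, lf.mul_coframe hy]

theorem inv_mul_frame (lf : LocalFrame Ω g e) (hy : y ∈ Ω) : (e y)⁻¹ * e y = 1 :=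
  mul_eq_one_comm.1 (lf.frame_mul_inv hy)

theorem det_frame_ne_zero (lf : LocalFrame Ω g e) (hy : y ∈ Ω) : (e y).det ≠ 0 := by
  intro h
  have := congrArg Matrix.det (lf.frame_mul_inv hy)
  rw [Matrix.det_mul, h, zero_mul, Matrix.det_one] at this
  exact zero_ne_one this

theorem metric_mul (lf : LocalFrame Ω g e) (hy : y ∈ Ω) :
    g y * ((e y).transpose * minkMat * e y) = 1 := by
  have := mul_eq_one_comm.1 (lf.mul_coframe hy)
  simpa only [Matrix.mul_assoc] using this

theorem inv_metric (lf : LocalFrame Ω g e) (hy : y ∈ Ω) :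
    (g y)⁻¹ = (e y).transpose * minkMat * e y :=
  Matrix.inv_eq_right_inv (lf.metric_mul hy)

theorem metric_mul_inv (lf : LocalFrame Ω g e) (hy : y ∈ Ω) : g y * (g y)⁻¹ = 1 := by
  rw [lf.inv_metric hy, lf.metric_mul hy]

theorem det_metric_ne_zero (lf : LocalFrame Ω g e) (hy : y ∈ Ω) : (g y).det ≠ 0 := by
  intro h
  have := congrArg Matrix.det (lf.metric_mul_inv hy)
  rw [Matrix.det_mul, h, zero_mul, Matrix.det_one] at this
  exact zero_ne_one this

theorem smooth_inv_frame (lf : LocalFrame Ω g e) (hy : y ∈ Ω) :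
    SmoothMat (fun z => (e z)⁻¹) y := by
  refine (((lf.smooth_g y hy).mul (lf.smooth_e y hy).transpose).mul
    (smoothMat_const minkMat y)).congr ?_
  filter_upwards [lf.mem_nhds hy] with z hz using lf.inv_frame hz

theorem smooth_inv_metric (lf : LocalFrame Ω g e) (hy : y ∈ Ω) :
    SmoothMat (fun z => (g z)⁻¹) y := by
  refine (((lf.smooth_e y hy).transpose.mul (smoothMat_const minkMat y)).mul
    (lf.smooth_e y hy)).congr ?_
  filter_upwards [lf.mem_nhds hy] with z hz using lf.inv_metric hz

theorem smooth_chrMat (lf : LocalFrame Ω g e) (hy : y ∈ Ω) (α : Fin 4) :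
    SmoothMat (chrMat g α) y := fun σ ρ => by
  have hg := lf.smooth_g y hy
  exact contDiffAt_const.mul (ContDiffAt.sum fun τ _ => (lf.smooth_inv_metric hy ρ τ).mul
    (((contDiffAt_pd (hg _ _) _).add (contDiffAt_pd (hg _ _) _)).sub (contDiffAt_pd (hg _ _) _)))

theorem pd_symm (lf : LocalFrame Ω g e) (hy : y ∈ Ω) (α μ ν : Fin 4) :
    pd α (fun z => g z μ ν) y = pd α (fun z => g z ν μ) y := by
  refine pd_congr ?_ α
  filter_upwards [lf.mem_nhds hy] with z hz using lf.symm z hz μ ν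

theorem christoffel_symm (lf : LocalFrame Ω g e) (hy : y ∈ Ω) (ρ μ ν : Fin 4) :
    christoffel g ρ μ ν y = christoffel g ρ ν μ y := by
  unfold christoffel
  congr 1
  refine Finset.sum_congr rfl fun σ _ => ?_
  rw [lf.pd_symm hy σ μ ν]
  ring

/-- Christoffel symbols of the first kind. Adding two of them with exchanged indices leaves
$\partial_\alpha g_{\mu\nu}$, which is the compatibility of $\nabla$ with $g$. -/
theorem chrMat_mul_metric (lf : LocalFrame Ω g e) (hy : y ∈ Ω) (α μ ν : Fin 4) :
    (chrMat g α y * g y) μ ν = (1 / 2) * (pd α (fun z => g z μ ν) y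
      + pd μ (fun z => g z α ν) y - pd ν (fun z => g z α μ) y) := by
  have h := lf.metric_mul_inv hy
  simp only [Matrix.mul_apply, chrMat, Matrix.of_apply, christoffel, Finset.sum_mul, Finset.mul_sum]
  rw [Finset.sum_comm]
  have e1 : ∀ σ, ∑ l, g y ν l * (g y)⁻¹ l σ = (1 : Matrix (Fin 4) (Fin 4) ℝ) ν σ := fun σ => by
    rw [← h, Matrix.mul_apply]
  have e2 : ∀ σ, ∑ l, 1 / 2 * ((g y)⁻¹ l σ * (pd α (fun z => g z σ μ) y
      + pd μ (fun z => g z σ α) y - pd σ (fun z => g z α μ) y)) * g y l ν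
      = (1 : Matrix (Fin 4) (Fin 4) ℝ) ν σ * (1 / 2 * (pd α (fun z => g z σ μ) y
      + pd μ (fun z => g z σ α) y - pd σ (fun z => g z α μ) y)) := by
    intro σ
    rw [← e1, Finset.sum_mul]
    refine Finset.sum_congr rfl fun l _ => ?_
    rw [lf.symm y hy l ν]
    ring
  simp only [e2, Matrix.one_apply, ite_mul, one_mul, zero_mul, Finset.sum_ite_eq,
    Finset.mem_univ, if_true]
  rw [lf.pd_symm hy α ν μ, lf.pd_symm hy μ ν α]

end LocalFrame

/-- The metric as a tensor field. -/
def metricTensor (g : MetricField) : TensorField 2 := fun y I => g y (I 0) (I 1)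

theorem act_metricTensor (g : MetricField) (y : Coord) (M : Matrix (Fin 4) (Fin 4) ℝ)
    (I : Fin 2 → Fin 4) :
    act M (metricTensor g y) I = (M * g y) (I 0) (I 1) + (g y * M.transpose) (I 0) (I 1) := by
  simp only [act_apply, metricTensor, Fin.sum_univ_two, Matrix.mul_apply, Matrix.transpose_apply]
  congr 1
  exact Finset.sum_congr rfl fun l _ => by simp [mul_comm]

theorem lieD_metricTensor (g : MetricField) (X : Coord → Coord) (y : Coord) (I : Fin 2 → Fin 4) :
    lieD X (metricTensor g) y I = lieMetric g X y (I 0) (I 1) := by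
  simp only [lieD, Pi.add_apply, act_metricTensor, lieMetric, Finset.sum_add_distrib,
    Finset.sum_apply, Pi.smul_apply, smul_eq_mul, Matrix.mul_apply, Matrix.transpose_apply, gradX,
    Matrix.of_apply, ← add_assoc]
  congr 2
  exact Finset.sum_congr rfl fun l _ => mul_comm _ _

namespace LocalFrame

variable {Ω : Set Coord} {g : MetricField} {e : FrameField} {y : Coord}

theorem covD_metricTensor (lf : LocalFrame Ω g e) (hy : y ∈ Ω) :
    covD g (metricTensor g) y = 0 := by
  ext I
  rw [← Fin.cons_self_tail I]
  refine (congrFun (covD_cons g (metricTensor g) y (I 0)) (Fin.tail I)).trans ?_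
  generalize Fin.tail I = J
  generalize I 0 = α
  have e1 : (g y * (chrMat g α y).transpose) (J 0) (J 1) = (chrMat g α y * g y) (J 1) (J 0) := by
    simp only [Matrix.mul_apply, Matrix.transpose_apply]
    exact Finset.sum_congr rfl fun l _ => by rw [lf.symm y hy (J 0) l, mul_comm]
  rw [Pi.sub_apply, act_metricTensor, e1, lf.chrMat_mul_metric hy, lf.chrMat_mul_metric hy,
    lf.pd_symm hy α (J 1) (J 0)]
  simp only [pdFam, metricTensor, Pi.zero_apply]
  ring

end LocalFrame

/-- A smooth Killing field on an open set. -/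
def KillingOn (Ω : Set Coord) (g : MetricField) (X : Coord → Coord) : Prop :=
  ∀ y ∈ Ω, ContDiffAt ℝ ∞ X y ∧ ∀ a b, lieMetric g X y a b = 0

theorem smoothFam_of_contDiffAt {X : Coord → Coord} {y : Coord} (h : ContDiffAt ℝ ∞ X y) :
    SmoothFam (fun z l => X z l) y := fun l => contDiffAt_euclidean.1 h l

theorem lieD_congr_zero {k : ℕ} {X : Coord → Coord} {T : TensorField k} {y : Coord}
    (h : ∀ᶠ z in 𝓝 y, T z = 0) : lieD X T y = 0 := by
  ext J
  have : ∀ l, pdFam l T y = 0 := fun l => by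
    ext J
    have : (fun z => T z J) =ᶠ[𝓝 y] fun _ => 0 := by
      filter_upwards [h] with z hz
      rw [hz]
      rfl
    exact (pd_congr this l).trans (pd_const 0 l)
  simp [lieD, this, h.self_of_nhds]

namespace LocalFrame

variable {Ω : Set Coord} {g : MetricField} {e : FrameField} {y : Coord} {X : Coord → Coord}

theorem lieD_metricTensor_eq_zero (hX : KillingOn Ω g X) (hy : y ∈ Ω) :
    lieD X (metricTensor g) y = 0 := by
  ext I
  rw [lieD_metricTensor, (hX y hy).2]
  rfl

/-- The Lie derivative inherits the symmetry of $\Gamma^\rho_{\alpha\sigma}$ in its lower indices;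
the inhomogeneous term is symmetric because partial derivatives of $X$ commute. -/
theorem lieChr_symm (lf : LocalFrame Ω g e) (hX : KillingOn Ω g X) (hy : y ∈ Ω) (α σ ρ : Fin 4) :
    lieChr g X α y σ ρ = lieChr g X σ y α ρ := by
  have hs := smoothFam_of_contDiffAt (hX y hy).1
  have e1 : ∀ l, pdMat l (chrMat g α) y σ ρ = pdMat l (chrMat g σ) y α ρ := fun l => by
    refine pd_congr ?_ l
    filter_upwards [lf.mem_nhds hy] with z hz using lf.christoffel_symm hz ρ α σ
  have e2 : pdMat α (gradX X) y σ ρ = pdMat σ (gradX X) y α ρ := pd_comm (hs ρ) α σ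
  have e3 : ∀ l, chrMat g l y σ ρ = chrMat g σ y l ρ := fun l => lf.christoffel_symm hy ρ l σ
  have e4 : ∀ l, chrMat g l y α ρ = chrMat g α y l ρ := fun l => lf.christoffel_symm hy ρ l α
  have e5 : ∀ l, chrMat g α y σ l = chrMat g σ y α l := fun l => lf.christoffel_symm hy l α σ
  simp only [lieChr, Matrix.add_apply, Matrix.sub_apply, Matrix.sum_apply, Matrix.smul_apply,
    smul_eq_mul, Matrix.mul_apply, e1, e2, e3, e4, e5]
  ring

/-- A Killing field preserves the Levi-Civita connection. -/
theorem lieChr_eq_zero (lf : LocalFrame Ω g e) (hX : KillingOn Ω g X) (hy : y ∈ Ω) (α : Fin 4) :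
    lieChr g X α y = 0 := by
  have hs := smoothFam_of_contDiffAt (hX y hy).1
  have hev : ∀ᶠ z in 𝓝 y, lieD X (metricTensor g) z = 0 := by
    filter_upwards [lf.mem_nhds hy] with z hz using lieD_metricTensor_eq_zero hX hz
  have hcov : lieD X (covD g (metricTensor g)) y = 0 := by
    refine lieD_congr_zero ?_
    filter_upwards [lf.mem_nhds hy] with z hz using lf.covD_metricTensor hz
  have hT : SmoothFam (metricTensor g) y := fun I => lf.smooth_g y hy _ _
  -- The commutation formula applied to $g$, where both $\mathcal L_Xg$ and $\nabla g$ vanish.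
  have key : ∀ α μ ν, (lieChr g X α y * g y) μ ν + (lieChr g X α y * g y) ν μ = 0 := by
    intro α μ ν
    have h1 := lieD_covD hs (lf.smooth_chrMat hy) hT hev α ![μ, ν]
    rw [hcov, act_metricTensor, Pi.zero_apply, zero_eq_neg] at h1
    have e1 : (g y * (lieChr g X α y).transpose) μ ν = (lieChr g X α y * g y) ν μ := by
      simp only [Matrix.mul_apply, Matrix.transpose_apply]
      exact Finset.sum_congr rfl fun l _ => by rw [lf.symm y hy μ l, mul_comm]
    rw [← e1]
    exact h1
  have sym : ∀ α μ ν, (lieChr g X α y * g y) μ ν = (lieChr g X μ y * g y) α ν := by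
    intro α μ ν
    simp only [Matrix.mul_apply]
    exact Finset.sum_congr rfl fun l _ => by rw [lf.lieChr_symm hX hy]
  -- With its upper index lowered, $\mathcal L_X\Gamma$ is symmetric in the first two indices and
  -- antisymmetric in the last two, and such an array is zero: the argument behind the uniqueness of
  -- the Levi-Civita connection.
  have hz : ∀ α, lieChr g X α y * g y = 0 := by
    intro α
    ext μ ν
    have h1 := key α μ ν
    have h2 := key μ ν α
    have h3 := key ν α μ
    have s1 := sym α μ ν
    have s2 := sym μ ν α
    have s3 := sym ν α μ
    rw [Matrix.zero_apply]
    linarith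
  calc lieChr g X α y = lieChr g X α y * g y * (g y)⁻¹ := by
        rw [Matrix.mul_assoc, lf.metric_mul_inv hy, Matrix.mul_one]
    _ = 0 := by rw [hz, Matrix.zero_mul]

end LocalFrame

/-! ### Killing fields preserve the curvature -/

/-- The curvature `R^ρ_{σμν}` as a matrix with row `σ` and column `ρ`. -/
def riemMat (g : MetricField) (μ ν : Fin 4) (y : Coord) : Matrix (Fin 4) (Fin 4) ℝ :=
  pdMat μ (chrMat g ν) y - pdMat ν (chrMat g μ) y
    + (chrMat g ν y * chrMat g μ y - chrMat g μ y * chrMat g ν y)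

theorem riemMat_apply (g : MetricField) (μ ν σ ρ : Fin 4) (y : Coord) :
    riemMat g μ ν y σ ρ = riemannUp g ρ σ μ ν y := by
  have h : ∀ μ ν, (chrMat g ν y * chrMat g μ y) σ ρ
      = ∑ l, christoffel g ρ μ l y * christoffel g l ν σ y := fun μ ν => by
    rw [Matrix.mul_apply]
    exact Finset.sum_congr rfl fun l _ => mul_comm _ _
  rw [riemMat, Matrix.add_apply, Matrix.sub_apply, Matrix.sub_apply, h, h, riemannUp,
    Finset.sum_sub_distrib]
  rfl

namespace LocalFrame

variable {Ω : Set Coord} {g : MetricField} {e : FrameField} {y : Coord} {X : Coord → Coord}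

theorem smooth_riemMat (lf : LocalFrame Ω g e) (hy : y ∈ Ω) (μ ν : Fin 4) :
    SmoothMat (riemMat g μ ν) y := by
  have h := lf.smooth_chrMat hy
  exact (((h ν).pdMat μ).sub ((h μ).pdMat ν)).add (((h ν).mul (h μ)).sub ((h μ).mul (h ν)))

/-- This is $\mathcal L_XR^\rho{}_{\sigma\mu\nu}=0$, solved for the transport term. It follows by
differentiating $\mathcal L_X\Gamma_\nu=0$ along $\partial_\mu$ and antisymmetrising in $\mu,\nu$.
-/
theorem sum_smul_pdMat_riemMat (lf : LocalFrame Ω g e) (hX : KillingOn Ω g X) (hy : y ∈ Ω)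
    (μ ν : Fin 4) :
    ∑ l, X y l • pdMat l (riemMat g μ ν) y
      = -(∑ l, gradX X y μ l • riemMat g l ν y + ∑ l, gradX X y ν l • riemMat g μ l y
        + (gradX X y * riemMat g μ ν y - riemMat g μ ν y * gradX X y)) := by
  have hΓ := lf.smooth_chrMat hy
  have hs := smoothFam_of_contDiffAt (hX y hy).1
  have hP := smoothMat_gradX hs
  have hPe : ∀ α l, ContDiffAt ℝ ∞ (fun z => gradX X z α l) y := fun α l => hP α l
  have hXl : ∀ l, ContDiffAt ℝ ∞ (fun z => X z l) y := fun l => hs l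
  -- the Lie derivative of the connection, as an equation near `y`
  have first : ∀ ν, ∑ l, X y l • pdMat l (chrMat g ν) y
      = -(∑ l, gradX X y ν l • chrMat g l y
        + (gradX X y * chrMat g ν y - chrMat g ν y * gradX X y) + pdMat ν (gradX X) y) := by
    intro ν
    have := lf.lieChr_eq_zero hX hy ν
    rw [eq_neg_iff_add_eq_zero, ← this, lieChr]
    abel
  have second : ∀ μ ν, ∑ l, X y l • pdMat l (pdMat μ (chrMat g ν)) y
      = -(∑ l, gradX X y μ l • pdMat l (chrMat g ν) y
        + (∑ l, pdMat μ (gradX X) y ν l • chrMat g l y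
        + ∑ l, gradX X y ν l • pdMat μ (chrMat g l) y
        + (pdMat μ (gradX X) y * chrMat g ν y + gradX X y * pdMat μ (chrMat g ν) y
          - (pdMat μ (chrMat g ν) y * gradX X y + chrMat g ν y * pdMat μ (gradX X) y))
        + pdMat μ (pdMat ν (gradX X)) y)) := by
    intro μ ν
    have h0 : pdMat μ (lieChr g X ν) y = 0 := by
      have : lieChr g X ν =ᶠ[𝓝 y] fun _ => 0 := by
        filter_upwards [lf.mem_nhds hy] with z hz using lf.lieChr_eq_zero hX hz ν
      rw [pdMat_congr this]
      ext i j
      exact pd_const 0 μ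
    have s1 : ∀ l ∈ Finset.univ, SmoothMat (fun z => X z l • pdMat l (chrMat g ν) z) y :=
      fun l _ => SmoothMat.smul (hXl l) ((hΓ ν).pdMat l)
    have s2 : ∀ l ∈ Finset.univ, SmoothMat (fun z => gradX X z ν l • chrMat g l z) y :=
      fun l _ => SmoothMat.smul (hPe ν l) (hΓ l)
    have s3 := (hP.mul (hΓ ν)).sub ((hΓ ν).mul hP)
    have h1 : pdMat μ (lieChr g X ν) y
        = ∑ l, (pd μ (fun z => X z l) y • pdMat l (chrMat g ν) y
            + X y l • pdMat μ (pdMat l (chrMat g ν)) y)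
          + ∑ l, (pd μ (fun z => gradX X z ν l) y • chrMat g l y
            + gradX X y ν l • pdMat μ (chrMat g l) y)
          + (pdMat μ (gradX X) y * chrMat g ν y + gradX X y * pdMat μ (chrMat g ν) y
            - (pdMat μ (chrMat g ν) y * gradX X y + chrMat g ν y * pdMat μ (gradX X) y))
          + pdMat μ (pdMat ν (gradX X)) y := by
      unfold lieChr
      rw [pdMat_add (((SmoothMat.sum s1).add (SmoothMat.sum s2)).add s3) (hP.pdMat ν),
        pdMat_add ((SmoothMat.sum s1).add (SmoothMat.sum s2)) s3,
        pdMat_add (SmoothMat.sum s1) (SmoothMat.sum s2),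
        pdMat_sub (hP.mul (hΓ ν)) ((hΓ ν).mul hP), pdMat_mul hP (hΓ ν), pdMat_mul (hΓ ν) hP,
        pdMat_sum s1, pdMat_sum s2]
      congr 2
      exact congrArg₂ (· + ·)
        (Finset.sum_congr rfl fun l _ => pdMat_smul (hXl l) ((hΓ ν).pdMat l) μ)
        (Finset.sum_congr rfl fun l _ => pdMat_smul (hPe ν l) (hΓ l) μ)
    rw [h0, Finset.sum_add_distrib, Finset.sum_add_distrib] at h1
    have h2 : ∑ l, X y l • pdMat l (pdMat μ (chrMat g ν)) y
        = ∑ l, X y l • pdMat μ (pdMat l (chrMat g ν)) y :=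
      Finset.sum_congr rfl fun l _ => by rw [pdMat_comm (hΓ ν)]
    rw [h2, eq_neg_iff_add_eq_zero, h1]
    simp only [gradX, pdMat, Matrix.of_apply]
    abel
  have hderiv : ∀ l, pdMat l (riemMat g μ ν) y
      = pdMat l (pdMat μ (chrMat g ν)) y - pdMat l (pdMat ν (chrMat g μ)) y
        + (pdMat l (chrMat g ν) y * chrMat g μ y + chrMat g ν y * pdMat l (chrMat g μ) y
          - (pdMat l (chrMat g μ) y * chrMat g ν y + chrMat g μ y * pdMat l (chrMat g ν) y)) := by
    intro l
    unfold riemMat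
    rw [pdMat_add (((hΓ ν).pdMat μ).sub ((hΓ μ).pdMat ν))
        (((hΓ ν).mul (hΓ μ)).sub ((hΓ μ).mul (hΓ ν))),
      pdMat_sub ((hΓ ν).pdMat μ) ((hΓ μ).pdMat ν),
      pdMat_sub ((hΓ ν).mul (hΓ μ)) ((hΓ μ).mul (hΓ ν)), pdMat_mul (hΓ ν) (hΓ μ),
      pdMat_mul (hΓ μ) (hΓ ν)]
  have lmul : ∀ ν μ, ∑ l, X y l • (pdMat l (chrMat g ν) y * chrMat g μ y)
      = (∑ l, X y l • pdMat l (chrMat g ν) y) * chrMat g μ y := fun ν μ => by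
    simp [Finset.sum_mul]
  have rmul : ∀ ν μ, ∑ l, X y l • (chrMat g ν y * pdMat l (chrMat g μ) y)
      = chrMat g ν y * ∑ l, X y l • pdMat l (chrMat g μ) y := fun ν μ => by
    simp [Finset.mul_sum]
  -- Both arrays of higher derivatives of $X$ are symmetric in $\mu,\nu$, so the antisymmetrisation
  -- removes them.
  have sp : ∀ l, pdMat μ (gradX X) y ν l = pdMat ν (gradX X) y μ l := fun l => pd_comm (hs l) μ ν
  have spp : pdMat μ (pdMat ν (gradX X)) y = pdMat ν (pdMat μ (gradX X)) y := pdMat_comm hP μ ν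
  simp only [hderiv, smul_add, smul_sub, Finset.sum_add_distrib, Finset.sum_sub_distrib, lmul, rmul,
    first, second, riemMat, sp, spp]
  simp only [mul_add, add_mul, mul_sub, sub_mul, mul_neg, neg_mul, Finset.sum_mul, Finset.mul_sum,
    smul_mul_assoc, mul_smul_comm, mul_assoc]
  abel

theorem riemann_eq (lf : LocalFrame Ω g e) (hy : y ∈ Ω) (I : Fin 4 → Fin 4) :
    riemann g y I = (riemMat g (I 2) (I 3) y * g y) (I 1) (I 0) := by
  simp only [riemann, Matrix.mul_apply, riemMat_apply]
  exact Finset.sum_congr rfl fun l _ => by rw [lf.symm y hy (I 0) l, mul_comm]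

theorem sum_smul_pdMat_metric (hX : KillingOn Ω g X) (hy : y ∈ Ω) :
    ∑ l, X y l • pdMat l g y = -(gradX X y * g y + g y * (gradX X y).transpose) := by
  rw [eq_neg_iff_add_eq_zero]
  ext a b
  rw [Matrix.zero_apply, ← (hX y hy).2 a b]
  simp only [lieMetric, Finset.sum_add_distrib, Matrix.add_apply, Matrix.sum_apply,
    Matrix.smul_apply, smul_eq_mul, Matrix.mul_apply, Matrix.transpose_apply, gradX, pdMat,
    Matrix.of_apply, ← add_assoc]
  congr 2
  exact Finset.sum_congr rfl fun l _ => mul_comm _ _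

theorem smooth_riemann (lf : LocalFrame Ω g e) (hy : y ∈ Ω) : SmoothFam (riemann g) y := fun I => by
  refine (((lf.smooth_riemMat hy (I 2) (I 3)).mul (lf.smooth_g y hy)) (I 1)
    (I 0)).congr_of_eventuallyEq ?_
  filter_upwards [lf.mem_nhds hy] with z hz using lf.riemann_eq hz I

/-- Lowering an index multiplies the curvature matrices by $g$, and the Lie derivatives of both
factors vanish. -/
theorem lieD_riemann (lf : LocalFrame Ω g e) (hX : KillingOn Ω g X) (hy : y ∈ Ω) :
    lieD X (riemann g) y = 0 := by
  ext I
  have hR := lf.smooth_riemMat hy (I 2) (I 3)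
  have hg := lf.smooth_g y hy
  have e1 : ∀ l, pdFam l (riemann g) y I
      = (pdMat l (riemMat g (I 2) (I 3)) y * g y + riemMat g (I 2) (I 3) y * pdMat l g y)
        (I 1) (I 0) := by
    intro l
    rw [← pdMat_mul hR hg]
    refine pd_congr ?_ l
    filter_upwards [lf.mem_nhds hy] with z hz using lf.riemann_eq hz I
  have e2 : ∑ l, X y l * pdFam l (riemann g) y I
      = ((∑ l, X y l • pdMat l (riemMat g (I 2) (I 3)) y) * g y
        + riemMat g (I 2) (I 3) y * ∑ l, X y l • pdMat l g y) (I 1) (I 0) := by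
    simp only [e1, Finset.sum_mul, Finset.mul_sum, smul_mul_assoc, mul_smul_comm,
      ← Finset.sum_add_distrib, Matrix.sum_apply, Matrix.add_apply, Matrix.smul_apply, smul_eq_mul,
      mul_add]
  rw [lf.sum_smul_pdMat_riemMat hX hy, sum_smul_pdMat_metric hX hy] at e2
  have e3 : act (gradX X y) (riemann g y) I
      = (riemMat g (I 2) (I 3) y * g y * (gradX X y).transpose
        + gradX X y * (riemMat g (I 2) (I 3) y * g y)
        + (∑ l, gradX X y (I 2) l • riemMat g l (I 3) y) * g y
        + (∑ l, gradX X y (I 3) l • riemMat g (I 2) l y) * g y) (I 1) (I 0) := by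
    simp only [Finset.sum_mul, smul_mul_assoc, Matrix.add_apply, Matrix.sum_apply,
      Matrix.smul_apply, smul_eq_mul]
    rw [Matrix.mul_apply, Matrix.mul_apply, act_apply, Fin.sum_univ_four]
    simp only [lf.riemann_eq hy, Matrix.transpose_apply]
    congr 3
    exact Finset.sum_congr rfl fun l _ => by simp [mul_comm]
  simp only [lieD, Pi.add_apply, Finset.sum_apply, Pi.smul_apply, smul_eq_mul, Pi.zero_apply]
  rw [e2, e3, ← Matrix.add_apply]
  refine (congrFun (congrFun ?_ (I 1)) (I 0)).trans (Matrix.zero_apply _ _)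
  simp only [add_mul, sub_mul, neg_mul, mul_add, mul_neg, mul_assoc, neg_add]
  abel

theorem smooth_covD (lf : LocalFrame Ω g e) (hy : y ∈ Ω) {k : ℕ} {T : TensorField k}
    (hT : SmoothFam T y) : SmoothFam (covD g T) y := fun I => by
  have : (fun z => covD g T z I) = fun z => pdFam (I 0) T z (Fin.tail I)
      - act (chrMat g (I 0) z) (T z) (Fin.tail I) := rfl
  rw [this]
  exact (hT.pdFam _ _).sub ((lf.smooth_chrMat hy _).act hT _)

theorem smooth_nablaRiemann (lf : LocalFrame Ω g e) (hy : y ∈ Ω) (k : ℕ) :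
    SmoothFam (nablaRiemann g k) y := by
  induction k with
  | zero => exact lf.smooth_riemann hy
  | succ k ih => exact lf.smooth_covD hy ih

/-- A Killing field preserves the covariant derivatives of the curvature. -/
theorem lieD_nablaRiemann (lf : LocalFrame Ω g e) (hX : KillingOn Ω g X) (k : ℕ) :
    ∀ y ∈ Ω, lieD X (nablaRiemann g k) y = 0 := by
  induction k with
  | zero => exact fun y hy => lf.lieD_riemann hX hy
  | succ k ih =>
    intro y hy
    ext I
    rw [← Fin.cons_self_tail I]
    refine (lieD_covD (smoothFam_of_contDiffAt (hX y hy).1) (lf.smooth_chrMat hy)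
      (lf.smooth_nablaRiemann hy k) ?_ (I 0) (Fin.tail I)).trans ?_
    · filter_upwards [lf.mem_nhds hy] with z hz using ih z hz
    · simp [lf.lieChr_eq_zero hX hy]

end LocalFrame

/-! ### Killing fields commute with a Riemann-frame -/

theorem hasDerivAt_comp_curve {f : Coord → ℝ} {c : ℝ → Coord} {c' : Coord} {t : ℝ}
    (hf : DifferentiableAt ℝ f (c t)) (hc : HasDerivAt c c' t) :
    HasDerivAt (fun s => f (c s)) (∑ l, c' l * pd l f (c t)) t := by
  rw [← fderiv_eq_sum_pd]
  exact hf.hasFDerivAt.comp_hasDerivAt t hc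

theorem frameSum_metricTensor (g : MetricField) (y : Coord) (f : Matrix (Fin 4) (Fin 4) ℝ)
    (a b : Fin 4) :
    frameSum (metricTensor g y) f ![a, b] = ∑ μ, ∑ ν, g y μ ν * f a μ * f b ν := by
  have : (![a, b] : Fin 2 → Fin 4) = Fin.cons a (Fin.cons b default) := by
    ext i
    fin_cases i <;> rfl
  rw [this, frameSum_cons]
  refine Finset.sum_congr rfl fun μ _ => ?_
  rw [frameSum_cons, Finset.mul_sum]
  refine Finset.sum_congr rfl fun ν _ => ?_
  rw [frameSum_zero_rank]
  simp only [metricTensor, Fin.cons_zero, Fin.cons_one]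
  ring

/-- The components of an invariant tensor field in a Lie-transported frame are constant. -/
theorem frameSum_const_of_lieD_eq_zero {k : ℕ} {X : Coord → Coord} {T : TensorField k}
    {c : ℝ → Coord} {f : ℝ → Matrix (Fin 4) (Fin 4) ℝ} {δ : ℝ}
    (hT : ∀ t ∈ Set.Ioo (-δ) δ, SmoothFam T (c t))
    (h0 : ∀ t ∈ Set.Ioo (-δ) δ, lieD X T (c t) = 0)
    (hc : ∀ t ∈ Set.Ioo (-δ) δ, HasDerivAt c (X (c t)) t)
    (hf : ∀ t ∈ Set.Ioo (-δ) δ, ∀ a μ,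
      HasDerivAt (fun s => f s a μ) ((f t * gradX X (c t)) a μ) t)
    (a : Fin k → Fin 4) {t : ℝ} (ht : t ∈ Set.Ioo (-δ) δ) :
    frameSum (T (c t)) (f t) a = frameSum (T (c 0)) (f 0) a := by
  have hd : ∀ t ∈ Set.Ioo (-δ) δ, HasDerivAt (fun s => frameSum (T (c s)) (f s) a) 0 t := by
    intro t ht
    have h1 := hasDerivAt_frameSum (T := fun s => T (c s)) (f := f)
      (fun J => hasDerivAt_comp_curve ((hT t ht J).differentiableAt (by simp)) (hc t ht))
      (hf t ht) a
    refine h1.congr_deriv ?_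
    have h2 : (fun J => ∑ l, X (c t) l * pd l (fun z => T z J) (c t))
        + act (gradX X (c t)) (T (c t)) = lieD X T (c t) := by
      ext J
      simp [lieD, pdFam]
    rw [h2, h0 t ht, frameSum_zero]
  have h0' : (0 : ℝ) ∈ Set.Ioo (-δ) δ := by
    constructor <;> linarith [ht.1, ht.2]
  exact isOpen_Ioo.is_const_of_deriv_eq_zero (convex_Ioo _ _).isPreconnected
    (fun t ht => (hd t ht).differentiableAt.differentiableWithinAt)
    (fun t ht => (hd t ht).deriv) ht h0'

namespace LocalFrame

variable {Ω : Set Coord} {g : MetricField} {e : FrameField} {y : Coord} {X : Coord → Coord}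

/-- Killing fields commute with a Riemann-frame, in components. -/
theorem sum_smul_pdMat_frame (lf : LocalFrame Ω g e) (hX : KillingOn Ω g X) (hy : y ∈ Ω)
    (hR : IsRiemannFrameAt g e y) : ∑ l, X y l • pdMat l e y = e y * gradX X y := by
  obtain ⟨p, U, hU, V, hV, H⟩ := hR
  -- A vector field on the space of frames: its integral curve from $(y,e(y))$ is the flow line of
  -- $X$ together with the frame Lie-transported along it.
  let F : Coord × (Fin 4 → Fin 4 → ℝ) → Coord × (Fin 4 → Fin 4 → ℝ) := fun s =>
    (X s.1, fun a μ => ∑ ν, s.2 a ν * gradX X s.1 ν μ)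
  have hXs := smoothFam_of_contDiffAt (hX y hy).1
  let e₀ : Fin 4 → Fin 4 → ℝ := fun a μ => e y a μ
  have hF : ContDiffAt ℝ 1 F (y, e₀) := by
    have h1 : ContDiffAt ℝ ∞ F (y, e₀) := by
      refine ContDiffAt.prodMk ((hX y hy).1.comp (y, e₀) contDiffAt_fst) ?_
      refine contDiffAt_pi.2 fun a => contDiffAt_pi.2 fun μ => ContDiffAt.sum fun ν _ => ?_
      refine ContDiffAt.mul ?_ ?_
      · exact contDiffAt_pi.1 (contDiffAt_pi.1 contDiffAt_snd a) ν
      · exact ContDiffAt.comp (y, e₀) (g := fun z => gradX X z ν μ)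
          (smoothMat_gradX hXs ν μ) contDiffAt_fst
    exact h1.of_le (by exact_mod_cast le_top)
  obtain ⟨α, hα0, ε, hε, hα⟩ :=
    hF.exists_forall_mem_closedBall_exists_eq_forall_mem_Ioo_hasDerivAt₀ 0
  rw [zero_sub, zero_add] at hα
  have hcont : ContinuousAt α 0 := (hα 0 ⟨by linarith, hε⟩).continuousAt
  have hc0 : (α 0).1 = y := by rw [hα0]
  let f : ℝ → Matrix (Fin 4) (Fin 4) ℝ := fun t => Matrix.of (α t).2
  have hf0 : f 0 = e y := by
    simp only [f, hα0]
    rfl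
  have ev1 : ∀ᶠ t in 𝓝 (0 : ℝ), (α t).1 ∈ Ω ∩ U :=
    hcont.fst.eventually_mem (by rw [hc0]; exact Filter.inter_mem (lf.mem_nhds hy) hU)
  have ev2 : ∀ᶠ t in 𝓝 (0 : ℝ), f t ∈ V :=
    ContinuousAt.eventually_mem (f := f) hcont.snd (by rw [hf0]; exact hV)
  have ev3 : ∀ᶠ t in 𝓝 (0 : ℝ), t ∈ Set.Ioo (-ε) ε := Ioo_mem_nhds (by linarith) hε
  obtain ⟨δ, hδ, Hδ⟩ := Metric.eventually_nhds_iff_ball.1 (ev1.and (ev2.and ev3))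
  rw [Real.ball_eq_Ioo, zero_sub, zero_add] at Hδ
  have hc : ∀ t ∈ Set.Ioo (-δ) δ, HasDerivAt (fun t => (α t).1) (X (α t).1) t := fun t ht =>
    (hα t (Hδ t ht).2.2).fst
  have hf : ∀ t ∈ Set.Ioo (-δ) δ, ∀ a μ, HasDerivAt (fun s => f s a μ)
      ((f t * gradX X (α t).1) a μ) t := fun t ht a μ => by
    have := hasDerivAt_pi.1 (hasDerivAt_pi.1 (hα t (Hδ t ht).2.2).snd a) μ
    exact this
  have hyU : y ∈ U := mem_of_mem_nhds hU
  -- The transported frame stays orthonormal and keeps the components of $R,\dots,\nabla^pR$ that it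
  -- had at $y$. By continuity it also stays close to $e(y)$, so the $R$-frame property identifies
  -- it with the given frame.
  have hfe : ∀ t ∈ Set.Ioo (-δ) δ, f t = e (α t).1 := by
    intro t ht
    refine H y hyU _ (Hδ t ht).1.2 _ (Hδ t ht).2.1 (fun a b => ?_) fun k _ a => ?_
    · rw [← frameSum_metricTensor]
      refine (frameSum_const_of_lieD_eq_zero (X := X) (T := metricTensor g)
        (f := f) (fun t ht I => lf.smooth_g _ (Hδ t ht).1.1 _ _)
        (fun t ht => lieD_metricTensor_eq_zero hX (Hδ t ht).1.1) hc hf ![a, b] ht).trans ?_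
      rw [frameSum_metricTensor, hc0, hf0]
      exact lf.orthonormal y hy a b
    · refine (frameSum_const_of_lieD_eq_zero (X := X) (T := nablaRiemann g k)
        (f := f) (fun t ht => lf.smooth_nablaRiemann (Hδ t ht).1.1 k)
        (fun t ht => lf.lieD_nablaRiemann hX k _ (Hδ t ht).1.1) hc hf a ht).trans ?_
      rw [hc0, hf0]
      rfl
  have h0 : (0 : ℝ) ∈ Set.Ioo (-δ) δ := ⟨by linarith, hδ⟩
  -- The two descriptions of the same moving frame are differentiated at time $0$: one gives
  -- $e\,\partial X$, the other $X(e)$.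
  ext a μ
  have d1 := hf 0 h0 a μ
  have d2 : HasDerivAt (fun s => e (α s).1 a μ) _ 0 :=
    hasDerivAt_comp_curve (f := fun z => e z a μ) (c := fun s => (α s).1)
      (by rw [hc0]; exact (lf.smooth_e y hy a μ).differentiableAt (by simp)) (hc 0 h0)
  have d3 : (fun s => f s a μ) =ᶠ[𝓝 0] fun s => e (α s).1 a μ := by
    filter_upwards [Ioo_mem_nhds h0.1 h0.2] with s hs
    exact congrFun (congrFun (hfe s hs) a) μ
  have := (d1.congr_of_eventuallyEq d3.symm).unique d2
  rw [hc0, hf0] at this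
  rw [this]
  simp only [Matrix.sum_apply, Matrix.smul_apply, smul_eq_mul]
  rfl

end LocalFrame

/-- The vector fields of a frame. -/
def frameVec (e : FrameField) (a : Fin 4) : Coord → Coord := fun y => WithLp.toLp 2 (e y a)

theorem frameVec_apply (e : FrameField) (a μ : Fin 4) (y : Coord) : frameVec e a y μ = e y a μ := rfl

theorem frameDeriv_eq (e : FrameField) (d : Fin 4) (f : Coord → ℝ) (y : Coord) :
    frameDeriv e d f y = fderiv ℝ f y (frameVec e d y) := by
  rw [fderiv_eq_sum_pd]
  rfl

theorem fderiv_coord_apply {F : Coord → Coord} {y : Coord} (hF : DifferentiableAt ℝ F y)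
    (v : Coord) (μ : Fin 4) : fderiv ℝ F y v μ = ∑ l, v l * pd l (fun z => F z μ) y := by
  rw [← fderiv_eq_sum_pd]
  have := ((EuclideanSpace.proj μ : Coord →L[ℝ] ℝ).hasFDerivAt.comp y
    hF.hasFDerivAt).fderiv
  exact (DFunLike.congr_fun this v).symm

namespace LocalFrame

variable {Ω : Set Coord} {g : MetricField} {e : FrameField} {y : Coord} {X : Coord → Coord}

theorem contDiffAt_frameVec (lf : LocalFrame Ω g e) (hy : y ∈ Ω) (a : Fin 4) :
    ContDiffAt ℝ ∞ (frameVec e a) y :=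
  contDiffAt_euclidean.2 fun μ => lf.smooth_e y hy a μ

/-- A vector field commutes with the frame at a point. -/
def _root_.Spacetime.CommutesAt (e : FrameField) (X : Coord → Coord) (y : Coord) : Prop :=
  ∀ a, fderiv ℝ (frameVec e a) y (X y) = fderiv ℝ X y (frameVec e a y)

theorem commutesAt_iff (lf : LocalFrame Ω g e) (hX : ContDiffAt ℝ ∞ X y) (hy : y ∈ Ω) :
    CommutesAt e X y ↔ ∑ l, X y l • pdMat l e y = e y * gradX X y := by
  have h1 : ∀ a μ, fderiv ℝ (frameVec e a) y (X y) μ = (∑ l, X y l • pdMat l e y) a μ := by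
    intro a μ
    rw [fderiv_coord_apply ((lf.contDiffAt_frameVec hy a).differentiableAt (by simp))]
    simp only [Matrix.sum_apply, Matrix.smul_apply, smul_eq_mul]
    rfl
  have h2 : ∀ a μ, fderiv ℝ X y (frameVec e a y) μ = (e y * gradX X y) a μ := by
    intro a μ
    rw [fderiv_coord_apply (hX.differentiableAt (by simp)), Matrix.mul_apply]
    rfl
  constructor
  · intro h
    ext a μ
    rw [← h1, ← h2, h a]
  · intro h a
    ext μ
    rw [h1, h2, h]

theorem commutesAt_of_killingOn (lf : LocalFrame Ω g e) (hX : KillingOn Ω g X) (hy : y ∈ Ω)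
    (hR : IsRiemannFrameAt g e y) : CommutesAt e X y :=
  (lf.commutesAt_iff (hX y hy).1 hy).2 (lf.sum_smul_pdMat_frame hX hy hR)

/-- A vector field that commutes with an orthonormal frame is a Killing field. -/
theorem lieMetric_eq_zero_of_commutesAt (lf : LocalFrame Ω g e) (hX : ContDiffAt ℝ ∞ X y)
    (hy : y ∈ Ω) (h : CommutesAt e X y) (a b : Fin 4) : lieMetric g X y a b = 0 := by
  rw [lf.commutesAt_iff hX hy] at h
  have hg := lf.smooth_g y hy
  have he := lf.smooth_e y hy
  have h1 : ∀ l, pdMat l (fun z => e z * g z * (e z).transpose) y = 0 := by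
    intro l
    have : (fun z => e z * g z * (e z).transpose) =ᶠ[𝓝 y] fun _ => minkMat := by
      filter_upwards [lf.mem_nhds hy] with z hz using isOrthonormalAt_iff.1 (lf.orthonormal z hz)
    rw [pdMat_congr this]
    ext i j
    exact pd_const _ l
  have h2 : ∀ l, pdMat l (fun z => e z * g z * (e z).transpose) y
      = (pdMat l e y * g y + e y * pdMat l g y) * (e y).transpose
        + e y * g y * (pdMat l e y).transpose := by
    intro l
    rw [pdMat_mul (he.mul hg) he.transpose, pdMat_mul he hg]
    rfl
  have h3 : ∑ l, X y l • ((pdMat l e y * g y + e y * pdMat l g y) * (e y).transpose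
        + e y * g y * (pdMat l e y).transpose) = 0 := by
    simp only [← h2, h1, smul_zero, Finset.sum_const_zero]
  have h4 : ∑ l, X y l • ((pdMat l e y * g y + e y * pdMat l g y) * (e y).transpose
        + e y * g y * (pdMat l e y).transpose)
      = ((∑ l, X y l • pdMat l e y) * g y + e y * ∑ l, X y l • pdMat l g y) * (e y).transpose
        + e y * g y * (∑ l, X y l • pdMat l e y).transpose := by
    simp only [Finset.sum_mul, Finset.mul_sum, smul_add, Finset.sum_add_distrib, add_mul,
      smul_mul_assoc, mul_smul_comm, Matrix.transpose_sum, Matrix.transpose_smul]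
  rw [h4, h, Matrix.transpose_mul] at h3
  -- The orthonormality relation is differentiated along $X$. Replacing $X(e)$ by $e\,\partial X$
  -- turns it into $e\,(\mathcal L_Xg)\,e^{T}=0$, and the outer factors are invertible.
  have h5 : e y * (gradX X y * g y + ∑ l, X y l • pdMat l g y
      + g y * (gradX X y).transpose) * (e y).transpose = 0 := by
    rw [← h3]
    simp only [mul_add, add_mul, Matrix.mul_assoc]
  have h6 : gradX X y * g y + ∑ l, X y l • pdMat l g y + g y * (gradX X y).transpose = 0 := by
    have hinv := lf.inv_mul_frame hy
    have hinv' : (e y).transpose * ((e y)⁻¹).transpose = 1 := by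
      rw [← Matrix.transpose_mul, hinv, Matrix.transpose_one]
    have := congrArg (fun m => (e y)⁻¹ * m * ((e y)⁻¹).transpose) h5
    simp only [Matrix.mul_zero, Matrix.zero_mul] at this
    rw [← this, Matrix.mul_assoc, Matrix.mul_assoc (e y * _), hinv', Matrix.mul_one,
      ← Matrix.mul_assoc, hinv, Matrix.one_mul]
  have h7 := congrFun (congrFun h6 a) b
  rw [Matrix.zero_apply] at h7
  rw [← h7]
  simp only [lieMetric, Finset.sum_add_distrib, Matrix.add_apply, Matrix.sum_apply,
    Matrix.smul_apply, smul_eq_mul, Matrix.mul_apply, Matrix.transpose_apply, gradX, pdMat,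
    Matrix.of_apply]
  rw [add_comm (∑ l, X y l * _)]
  congr 2
  exact Finset.sum_congr rfl fun l _ => mul_comm _ _

end LocalFrame

/-! ### The connection coefficients of an orthonormal frame -/

/-- The matrix `∇_l (e_a)^μ` with row `a` and column `μ`. -/
def nablaMat (g : MetricField) (e : FrameField) (l : Fin 4) (y : Coord) :
    Matrix (Fin 4) (Fin 4) ℝ :=
  pdMat l e y + e y * chrMat g l y

theorem nablaMat_apply (g : MetricField) (e : FrameField) (l a μ : Fin 4) (y : Coord) :
    nablaMat g e l y a μ = nablaFrame g e a l μ y := by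
  rw [nablaMat, Matrix.add_apply, Matrix.mul_apply, nablaFrame]
  congr 1
  exact Finset.sum_congr rfl fun ν _ => mul_comm _ _

/-- The connection coefficients `γ^c_{ab}` as a matrix with row `a` and column `c`. -/
def connMat (g : MetricField) (e : FrameField) (b : Fin 4) (y : Coord) :
    Matrix (Fin 4) (Fin 4) ℝ :=
  Matrix.of fun a c => connCoeff g e c a b y

theorem connMat_eq (g : MetricField) (e : FrameField) (b : Fin 4) (y : Coord) :
    connMat g e b y = ∑ l, e y b l • (nablaMat g e l y * (e y)⁻¹) := by
  ext a c
  simp only [connMat, Matrix.of_apply, connCoeff, Matrix.sum_apply, Matrix.smul_apply, smul_eq_mul,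
    Matrix.mul_apply, Finset.mul_sum, nablaMat_apply, dualFrame]
  exact Finset.sum_congr rfl fun l _ => Finset.sum_congr rfl fun μ _ => by ring

/-- The deformation of the frame: the matrix `θ^a_ν ∂_l (e_a)^μ`. -/
def frameGrad (e : FrameField) (l : Fin 4) (y : Coord) : Matrix (Fin 4) (Fin 4) ℝ :=
  (e y)⁻¹ * pdMat l e y

namespace LocalFrame

variable {Ω : Set Coord} {g : MetricField} {e : FrameField} {y : Coord}

theorem connMat_mul (lf : LocalFrame Ω g e) (hy : y ∈ Ω) (b : Fin 4) :
    connMat g e b y * e y = ∑ l, e y b l • nablaMat g e l y := by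
  rw [connMat_eq, Finset.sum_mul]
  refine Finset.sum_congr rfl fun l _ => ?_
  rw [smul_mul_assoc, Matrix.mul_assoc, lf.inv_mul_frame hy, Matrix.mul_one]

theorem smooth_nablaMat (lf : LocalFrame Ω g e) (hy : y ∈ Ω) (l : Fin 4) :
    SmoothMat (nablaMat g e l) y :=
  ((lf.smooth_e y hy).pdMat l).add ((lf.smooth_e y hy).mul (lf.smooth_chrMat hy l))

theorem smooth_connMat (lf : LocalFrame Ω g e) (hy : y ∈ Ω) (b : Fin 4) :
    SmoothMat (connMat g e b) y := by
  have : connMat g e b = fun z => ∑ l, e z b l • (nablaMat g e l z * (e z)⁻¹) := by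
    funext z
    exact connMat_eq g e b z
  rw [this]
  exact SmoothMat.sum fun l _ => SmoothMat.smul (lf.smooth_e y hy b l)
    ((lf.smooth_nablaMat hy l).mul (lf.smooth_inv_frame hy))

theorem smooth_connCoeff (lf : LocalFrame Ω g e) (hy : y ∈ Ω) (c a b : Fin 4) :
    ContDiffAt ℝ ∞ (connCoeff g e c a b) y := lf.smooth_connMat hy b a c

/-- The connection is torsion-free. -/
theorem lie_frameVec (lf : LocalFrame Ω g e) (hy : y ∈ Ω) (a b : Fin 4) :
    fderiv ℝ (frameVec e a) y (frameVec e b y) - fderiv ℝ (frameVec e b) y (frameVec e a y)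
      = ∑ c, (connCoeff g e c a b y - connCoeff g e c b a y) • frameVec e c y := by
  have h : ∀ a b μ, ∑ c, connCoeff g e c a b y * e y c μ
      = fderiv ℝ (frameVec e a) y (frameVec e b y) μ
        + ∑ l, ∑ ν, e y b l * e y a ν * christoffel g μ l ν y := by
    intro a b μ
    have h1 := congrFun (congrFun (lf.connMat_mul hy b) a) μ
    simp only [Matrix.mul_apply, Matrix.sum_apply, Matrix.smul_apply, smul_eq_mul,
      nablaMat, Matrix.add_apply, mul_add, Finset.sum_add_distrib, Finset.mul_sum] at h1
    refine h1.trans ?_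
    rw [fderiv_coord_apply ((lf.contDiffAt_frameVec hy a).differentiableAt (by simp))]
    congr 1
    exact Finset.sum_congr rfl fun l _ => Finset.sum_congr rfl fun ν _ => (mul_assoc _ _ _).symm
  ext μ
  have h3 : ∑ l, ∑ ν, e y a l * e y b ν * christoffel g μ l ν y
      = ∑ l, ∑ ν, e y b l * e y a ν * christoffel g μ l ν y := by
    rw [Finset.sum_comm]
    refine Finset.sum_congr rfl fun l _ => Finset.sum_congr rfl fun ν _ => ?_
    rw [lf.christoffel_symm hy μ ν l]
    ring
  simp only [PiLp.sub_apply, WithLp.ofLp_sum, Finset.sum_apply, PiLp.smul_apply, smul_eq_mul,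
    sub_mul, Finset.sum_sub_distrib, frameVec_apply]
  rw [h a b, h b a, h3]
  ring

theorem pdMat_metric (lf : LocalFrame Ω g e) (hy : y ∈ Ω) (l : Fin 4) :
    pdMat l g y = chrMat g l y * g y + g y * (chrMat g l y).transpose := by
  ext μ ν
  have e1 : (g y * (chrMat g l y).transpose) μ ν = (chrMat g l y * g y) ν μ := by
    simp only [Matrix.mul_apply, Matrix.transpose_apply]
    exact Finset.sum_congr rfl fun k _ => by rw [lf.symm y hy μ k, mul_comm]
  rw [Matrix.add_apply, e1, lf.chrMat_mul_metric hy, lf.chrMat_mul_metric hy,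
    lf.pd_symm hy l ν μ]
  simp only [pdMat, Matrix.of_apply]
  ring

/-- The derivative of the constants $g(e_a,e_b)$, combined with $\nabla g=0$. -/
theorem nablaMat_antisymm (lf : LocalFrame Ω g e) (hy : y ∈ Ω) (l : Fin 4) :
    nablaMat g e l y * g y * (e y).transpose
      + e y * g y * (nablaMat g e l y).transpose = 0 := by
  have hg := lf.smooth_g y hy
  have he := lf.smooth_e y hy
  have h1 : pdMat l (fun z => e z * g z * (e z).transpose) y = 0 := by
    have : (fun z => e z * g z * (e z).transpose) =ᶠ[𝓝 y] fun _ => minkMat := by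
      filter_upwards [lf.mem_nhds hy] with z hz using isOrthonormalAt_iff.1 (lf.orthonormal z hz)
    rw [pdMat_congr this]
    ext i j
    exact pd_const _ l
  rw [pdMat_mul (he.mul hg) he.transpose, pdMat_mul he hg, lf.pdMat_metric hy] at h1
  rw [← h1, show pdMat l (fun z => (e z).transpose) y = (pdMat l e y).transpose from rfl]
  simp only [nablaMat, Matrix.transpose_add, Matrix.transpose_mul, Matrix.mul_add, Matrix.add_mul,
    Matrix.mul_assoc]
  abel

/-- The connection is metric. -/
theorem connMat_antisymm (lf : LocalFrame Ω g e) (hy : y ∈ Ω) (b : Fin 4) :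
    connMat g e b y * minkMat + minkMat * (connMat g e b y).transpose = 0 := by
  rw [← isOrthonormalAt_iff.1 (lf.orthonormal y hy)]
  have h1 : connMat g e b y * (e y * g y * (e y).transpose)
      = (connMat g e b y * e y) * (g y * (e y).transpose) := by
    simp only [Matrix.mul_assoc]
  have h2 : e y * g y * (e y).transpose * (connMat g e b y).transpose
      = (e y * g y) * (connMat g e b y * e y).transpose := by
    simp only [Matrix.mul_assoc, Matrix.transpose_mul]
  rw [h1, h2, lf.connMat_mul hy, Finset.sum_mul, Matrix.transpose_sum, Finset.mul_sum,
    ← Finset.sum_add_distrib]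
  refine Finset.sum_eq_zero fun l _ => ?_
  rw [Matrix.transpose_smul, smul_mul_assoc, mul_smul_comm, ← smul_add, ← Matrix.mul_assoc,
    lf.nablaMat_antisymm hy, smul_zero]

/-- In coordinates $H_l=e^{-1}\nabla_le$: the contractions of frame with coframe collapse. Written
out this is $e^{-1}\partial_le+\Gamma_l$, and the term $\Gamma_l$ is what `corrD_cons` cancels. -/
theorem connTensorUp_eq (lf : LocalFrame Ω g e) (hy : y ∈ Ω) (l ν μ : Fin 4) :
    connTensorUp g e l ν μ y = ((e y)⁻¹ * nablaMat g e l y) ν μ := by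
  have h1 : ∀ a, ∑ b, ∑ c, connCoeff g e c a b y * dualFrame e b l y * dualFrame e a ν y * e y c μ
      = (e y)⁻¹ ν a * nablaMat g e l y a μ := by
    intro a
    have h2 : ∀ b, ∑ c, connCoeff g e c a b y * dualFrame e b l y * dualFrame e a ν y * e y c μ
        = (e y)⁻¹ ν a * ((e y)⁻¹ l b * (connMat g e b y * e y) a μ) := by
      intro b
      simp only [Matrix.mul_apply, Finset.mul_sum, dualFrame, connMat, Matrix.of_apply]
      exact Finset.sum_congr rfl fun c _ => by ring
    simp only [h2, ← Finset.mul_sum]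
    congr 1
    have h3 : ∀ m, ∑ b, (e y)⁻¹ l b * e y b m = (1 : Matrix (Fin 4) (Fin 4) ℝ) l m := fun m => by
      rw [← lf.inv_mul_frame hy, Matrix.mul_apply]
    simp only [lf.connMat_mul hy, Matrix.sum_apply, Matrix.smul_apply, smul_eq_mul, Finset.mul_sum,
      ← mul_assoc]
    rw [Finset.sum_comm]
    simp only [← Finset.sum_mul, h3, Matrix.one_apply, ite_mul, one_mul, zero_mul,
      Finset.sum_ite_eq, Finset.mem_univ, if_true]
  simp only [connTensorUp, h1, Matrix.mul_apply]

/-- The Christoffel symbols of $\nabla$ and those inside $H$ cancel. What remains is the derivative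
for the flat connection in which the frame vectors are parallel. -/
theorem corrD_cons (lf : LocalFrame Ω g e) (hy : y ∈ Ω) {k : ℕ} (T : TensorField k) (α : Fin 4) :
    (fun J => corrD g e T y (Fin.cons α J)) = pdFam α T y + act (frameGrad e α y) (T y) := by
  have h1 : (fun J => corrD g e T y (Fin.cons α J))
      = (fun J => covD g T y (Fin.cons α J)) + act ((e y)⁻¹ * nablaMat g e α y) (T y) := by
    ext J
    simp only [corrD, Pi.add_apply, act_apply, Fin.tail_cons, Fin.cons_zero,
      lf.connTensorUp_eq hy]
  rw [h1, covD_cons, nablaMat, Matrix.mul_add, ← Matrix.mul_assoc, lf.inv_mul_frame hy,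
    Matrix.one_mul, map_add, LinearMap.add_apply, frameGrad]
  abel

theorem smooth_corrD (lf : LocalFrame Ω g e) (hy : y ∈ Ω) {k : ℕ} {T : TensorField k}
    (hT : SmoothFam T y) : SmoothFam (corrD g e T) y := fun I => by
  have h : (fun z => corrD g e T z I) =ᶠ[𝓝 y] fun z => pdFam (I 0) T z (Fin.tail I)
      + act (frameGrad e (I 0) z) (T z) (Fin.tail I) := by
    filter_upwards [lf.mem_nhds hy] with z hz
    rw [← Pi.add_apply, ← lf.corrD_cons hz]
    exact congrArg _ (Fin.cons_self_tail I).symm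
  refine ContDiffAt.congr_of_eventuallyEq ?_ h
  exact (hT.pdFam _ _).add
    (((lf.smooth_inv_frame hy).mul ((lf.smooth_e y hy).pdMat _)).act hT _)

theorem smooth_connTensor (lf : LocalFrame Ω g e) (hy : y ∈ Ω) : SmoothFam (connTensor g e) y := by
  intro I
  have h : (fun z => connTensor g e z I) =ᶠ[𝓝 y] fun z =>
      ∑ ρ, ((e z)⁻¹ * nablaMat g e (I 0) z) (I 1) ρ * g z ρ (I 2) := by
    filter_upwards [lf.mem_nhds hy] with z hz
    simp only [connTensor, lf.connTensorUp_eq hz]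
  refine ContDiffAt.congr_of_eventuallyEq ?_ h
  exact ContDiffAt.sum fun ρ _ => (((lf.smooth_inv_frame hy).mul (lf.smooth_nablaMat hy _)) _ _).mul
    (lf.smooth_g y hy _ _)

theorem smooth_concomitant (lf : LocalFrame Ω g e) (hy : y ∈ Ω) (q : ℕ) :
    SmoothFam (concomitant g e q) y := by
  induction q with
  | zero => exact lf.smooth_connTensor hy
  | succ q ih => exact lf.smooth_corrD hy ih

theorem smooth_frameSum (lf : LocalFrame Ω g e) (hy : y ∈ Ω) {k : ℕ} {T : TensorField k}
    (hT : SmoothFam T y) (a : Fin k → Fin 4) :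
    ContDiffAt ℝ ∞ (fun z => frameSum (T z) (e z) a) y := by
  unfold frameSum
  exact ContDiffAt.sum fun J _ => (hT J).mul
    (contDiffAt_prod fun i _ => lf.smooth_e y hy (a i) (J i))

/-- In the frame, the corrected covariant derivative differentiates the components. -/
theorem frameSum_corrD (lf : LocalFrame Ω g e) (hy : y ∈ Ω) {k : ℕ} {T : TensorField k}
    (hT : SmoothFam T y) (d : Fin 4) (a : Fin k → Fin 4) :
    frameSum (corrD g e T y) (e y) (Fin.cons d a)
      = frameDeriv e d (fun z => frameSum (T z) (e z) a) y := by
  -- The components are differentiated along the straight line through $y$ in the direction $e_d$,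
  -- in two ways: by the chain rule and by `hasDerivAt_frameSum`.
  set v := frameVec e d y with hv
  have hc : HasDerivAt (fun t : ℝ => y + t • v) v 0 := by
    simpa using ((hasDerivAt_id (0 : ℝ)).smul_const v).const_add y
  have hy0 : y + (0 : ℝ) • v = y := by simp
  have h1 := hasDerivAt_frameSum (T := fun t => T (y + t • v)) (f := fun t => e (y + t • v))
    (T' := fun J => ∑ l, v l * pd l (fun z => T z J) y) (M := ∑ l, v l • frameGrad e l y) (t := 0)
    (fun J => by
      have := hasDerivAt_comp_curve (f := fun z => T z J) (c := fun t : ℝ => y + t • v)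
        (by rw [hy0]; exact (hT J).differentiableAt (by simp)) hc
      rwa [hy0] at this)
    (fun b μ => by
      have := hasDerivAt_comp_curve (f := fun z => e z b μ) (c := fun t : ℝ => y + t • v)
        (by rw [hy0]; exact (lf.smooth_e y hy b μ).differentiableAt (by simp)) hc
      rw [hy0] at this
      refine this.congr_deriv ?_
      rw [hy0]
      simp only [Finset.mul_sum, mul_smul_comm, frameGrad, ← Matrix.mul_assoc, lf.frame_mul_inv hy,
        Matrix.one_mul, Matrix.sum_apply, Matrix.smul_apply, smul_eq_mul]
      rfl) a
  have h2 := hasDerivAt_comp_curve (f := fun z => frameSum (T z) (e z) a)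
    (c := fun t : ℝ => y + t • v)
    (by rw [hy0]; exact (lf.smooth_frameSum hy hT a).differentiableAt (by simp)) hc
  rw [hy0] at h2
  have h3 := h2.unique h1
  refine Eq.trans ?_ h3.symm
  rw [hy0, frameSum_cons]
  have h4 : (fun J => ∑ l, v l * pd l (fun z => T z J) y) + act (∑ l, v l • frameGrad e l y) (T y)
      = ∑ l, v l • (pdFam l T y + act (frameGrad e l y) (T y)) := by
    ext J
    simp [Finset.sum_add_distrib, pdFam]
  simp only [h4, frameSum_sum, frameSum_smul, lf.corrD_cons hy]
  rfl

/-- The only difference between $H_{bac}$ and $\gamma^c_{ab}$ in an orthonormal frame is the sign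
produced by lowering $c$. -/
theorem frameSum_connTensor (lf : LocalFrame Ω g e) (hy : y ∈ Ω) (I : Fin 3 → Fin 4) :
    frameSum (connTensor g e y) (e y) I
      = connCoeff g e (I 2) (I 1) (I 0) y * minkowski (I 2) (I 2) := by
  have h1 : frameSum (connTensor g e y) (e y) I = (connMat g e (I 0) y * minkMat) (I 1) (I 2) := by
    have h2 : connMat g e (I 0) y * minkMat
        = ∑ l, e y (I 0) l • (e y * ((e y)⁻¹ * nablaMat g e l y) * g y * (e y).transpose) := by
      rw [← isOrthonormalAt_iff.1 (lf.orthonormal y hy), ← Matrix.mul_assoc, ← Matrix.mul_assoc,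
        lf.connMat_mul hy, Finset.sum_mul, Finset.sum_mul]
      refine Finset.sum_congr rfl fun l _ => ?_
      rw [smul_mul_assoc, smul_mul_assoc, ← Matrix.mul_assoc (e y) (e y)⁻¹, lf.frame_mul_inv hy,
        Matrix.one_mul]
    have h3 : I = Fin.cons (I 0) (Fin.cons (I 1) (Fin.cons (I 2) default)) := by
      ext i
      fin_cases i <;> rfl
    rw [h2, h3]
    simp only [frameSum_cons, frameSum_zero_rank, Matrix.sum_apply, Matrix.smul_apply, smul_eq_mul]
    refine Finset.sum_congr rfl fun l _ => ?_
    congr 1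
    rw [Matrix.mul_assoc, Matrix.mul_assoc, Matrix.mul_apply]
    refine Finset.sum_congr rfl fun ν _ => ?_
    congr 1
    rw [← Matrix.mul_assoc, Matrix.mul_apply]
    refine Finset.sum_congr rfl fun μ _ => ?_
    rw [mul_comm, Matrix.transpose_apply]
    congr 1
    rw [Matrix.mul_apply]
    exact Finset.sum_congr rfl fun ρ _ => by rw [lf.connTensorUp_eq hy]; rfl
  rw [h1, Matrix.mul_apply]
  simp [minkMat, minkowski, connMat]

end LocalFrame

/-! ### Vector fields commuting with the frame -/

/-- The coframe `θ^a` as a linear form. -/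
def coframe (e : FrameField) (a : Fin 4) (y : Coord) : Coord →L[ℝ] ℝ :=
  ∑ μ, (e y)⁻¹ μ a • (EuclideanSpace.proj μ : Coord →L[ℝ] ℝ)

theorem coframe_apply (e : FrameField) (a : Fin 4) (y v : Coord) :
    coframe e a y v = ∑ μ, v μ * (e y)⁻¹ μ a := by
  simp [coframe, mul_comm]

/-- The connection whose parallel sections are the vector fields commuting with the frame. -/
def frameConn (e : FrameField) (y : Coord) : Coord →L[ℝ] Coord →L[ℝ] Coord :=
  ∑ a, (coframe e a y).smulRight (fderiv ℝ (frameVec e a) y)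

theorem frameConn_apply (e : FrameField) (y v : Coord) :
    frameConn e y v = ∑ a, coframe e a y v • fderiv ℝ (frameVec e a) y := by
  simp [frameConn]

/-- The derivative of a contraction `L(u)`. -/
theorem fderiv_clm_apply_apply {F G : Type*} [NormedAddCommGroup F] [NormedSpace ℝ F]
    [NormedAddCommGroup G] [NormedSpace ℝ G] {L : Coord → F →L[ℝ] G} {u : Coord → F} {y : Coord}
    (hL : DifferentiableAt ℝ L y) (hu : DifferentiableAt ℝ u y) (v : Coord) :
    fderiv ℝ (fun z => L z (u z)) y v = fderiv ℝ L y v (u y) + L y (fderiv ℝ u y v) := by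
  rw [fderiv_clm_apply hL hu]
  simp [add_comm]

theorem differentiableAt_fderiv {F : Type*} [NormedAddCommGroup F] [NormedSpace ℝ F]
    {f : Coord → F} {y : Coord} (hf : ContDiffAt ℝ ∞ f y) : DifferentiableAt ℝ (fderiv ℝ f) y :=
  (hf.fderiv_right (m := ∞) (by norm_cast)).differentiableAt (by simp)

theorem fderiv_fderiv_comm {F : Type*} [NormedAddCommGroup F] [NormedSpace ℝ F]
    {f : Coord → F} {y : Coord} (hf : ContDiffAt ℝ ∞ f y) (u v : Coord) :
    fderiv ℝ (fderiv ℝ f) y u v = fderiv ℝ (fderiv ℝ f) y v u :=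
  (hf.isSymmSndFDerivAt (by simp; decide)).eq u v

namespace LocalFrame

variable {Ω : Set Coord} {g : MetricField} {e : FrameField} {y : Coord} {X : Coord → Coord}

theorem coframe_frameVec (lf : LocalFrame Ω g e) (hy : y ∈ Ω) (a b : Fin 4) :
    coframe e a y (frameVec e b y) = (1 : Matrix (Fin 4) (Fin 4) ℝ) b a := by
  rw [coframe_apply, ← lf.frame_mul_inv hy, Matrix.mul_apply]
  rfl

theorem sum_coframe_smul (lf : LocalFrame Ω g e) (hy : y ∈ Ω) (v : Coord) :
    ∑ a, coframe e a y v • frameVec e a y = v := by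
  ext ν
  simp only [WithLp.ofLp_sum, Finset.sum_apply, PiLp.smul_apply, smul_eq_mul, coframe_apply,
    Finset.sum_mul, frameVec_apply]
  rw [Finset.sum_comm]
  have : ∀ μ, ∑ a, v μ * (e y)⁻¹ μ a * e y a ν = v μ * (1 : Matrix (Fin 4) (Fin 4) ℝ) μ ν := by
    intro μ
    rw [← lf.inv_mul_frame hy, Matrix.mul_apply, Finset.mul_sum]
    simp only [mul_assoc]
  simp [this, Matrix.one_apply]

theorem ext_frameVec {F : Type*} [NormedAddCommGroup F] [NormedSpace ℝ F]
    (lf : LocalFrame Ω g e) (hy : y ∈ Ω) {L L' : Coord →L[ℝ] F}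
    (h : ∀ a, L (frameVec e a y) = L' (frameVec e a y)) : L = L' := by
  ext v
  rw [← lf.sum_coframe_smul hy v]
  simp [h]

theorem linearIndependent_frameVec (lf : LocalFrame Ω g e) (hy : y ∈ Ω) {c : Fin 4 → ℝ}
    (h : ∑ a, c a • frameVec e a y = 0) (b : Fin 4) : c b = 0 := by
  have := congrArg (coframe e b y) h
  simpa [lf.coframe_frameVec hy, Matrix.one_apply] using this

theorem frameConn_frameVec (lf : LocalFrame Ω g e) (hy : y ∈ Ω) (a : Fin 4) :
    frameConn e y (frameVec e a y) = fderiv ℝ (frameVec e a) y := by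
  simp [frameConn_apply, lf.coframe_frameVec hy, Matrix.one_apply]

theorem contDiffAt_frameConn (lf : LocalFrame Ω g e) (hy : y ∈ Ω) :
    ContDiffAt ℝ ∞ (frameConn e) y := by
  unfold frameConn
  refine ContDiffAt.sum fun a _ => ?_
  have h1 : ContDiffAt ℝ ∞ (coframe e a) y := by
    unfold coframe
    exact ContDiffAt.sum fun μ _ => (lf.smooth_inv_frame hy μ a).smul contDiffAt_const
  have h2 : ContDiffAt ℝ ∞ (fderiv ℝ (frameVec e a)) y :=
    (lf.contDiffAt_frameVec hy a).fderiv_right (m := ∞) (by norm_cast)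
  exact h1.smulRight h2

/-- The frame vectors span, so the four relations $[X,e_a]=0$ prescribe the whole differential of
$X$ linearly in $X$: a closed first-order linear system. -/
theorem commutesAt_iff_fderiv (lf : LocalFrame Ω g e) (hy : y ∈ Ω) :
    CommutesAt e X y ↔ fderiv ℝ X y = (frameConn e y).flip (X y) := by
  constructor
  · intro h
    refine lf.ext_frameVec hy fun a => ?_
    rw [ContinuousLinearMap.flip_apply, lf.frameConn_frameVec hy, h a]
  · intro h a
    rw [h, ContinuousLinearMap.flip_apply, lf.frameConn_frameVec hy]

/-- Invariant functions have invariant frame derivatives. -/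
theorem fderiv_frameDeriv_eq_zero (lf : LocalFrame Ω g e) (hy : y ∈ Ω) {f : Coord → ℝ}
    (hf : ContDiffAt ℝ ∞ f y) (hX : ContDiffAt ℝ ∞ X y) (hc : CommutesAt e X y)
    (h0 : ∀ᶠ z in 𝓝 y, fderiv ℝ f z (X z) = 0) (d : Fin 4) :
    fderiv ℝ (frameDeriv e d f) y (X y) = 0 := by
  have h1 : frameDeriv e d f = fun z => fderiv ℝ f z (frameVec e d z) := by
    funext z
    exact frameDeriv_eq e d f z
  have h2 : fderiv ℝ (fun z => fderiv ℝ f z (X z)) y (frameVec e d y) = 0 := by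
    have : (fun z => fderiv ℝ f z (X z)) =ᶠ[𝓝 y] fun _ => 0 := h0
    rw [this.fderiv_eq]
    simp
  rw [fderiv_clm_apply_apply (differentiableAt_fderiv hf) (hX.differentiableAt (by simp))] at h2
  rw [h1, fderiv_clm_apply_apply (differentiableAt_fderiv hf)
    ((lf.contDiffAt_frameVec hy d).differentiableAt (by simp)), fderiv_fderiv_comm hf, hc d, h2]

/-- The structure functions `γ^c_{ab} - γ^c_{ba}` of the frame. -/
def _root_.Spacetime.structureFun (g : MetricField) (e : FrameField) (c a b : Fin 4) (y : Coord) :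
    ℝ :=
  connCoeff g e c a b y - connCoeff g e c b a y

theorem smooth_structureFun (lf : LocalFrame Ω g e) (hy : y ∈ Ω) (c a b : Fin 4) :
    ContDiffAt ℝ ∞ (structureFun g e c a b) y :=
  (lf.smooth_connCoeff hy c a b).sub (lf.smooth_connCoeff hy c b a)

theorem fderiv_structureFun (lf : LocalFrame Ω g e) (hy : y ∈ Ω) (c a b : Fin 4) (v : Coord) :
    fderiv ℝ (structureFun g e c a b) y v
      = fderiv ℝ (connCoeff g e c a b) y v - fderiv ℝ (connCoeff g e c b a) y v := by
  unfold structureFun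
  rw [fderiv_fun_sub ((lf.smooth_connCoeff hy c a b).differentiableAt (by simp))
    ((lf.smooth_connCoeff hy c b a).differentiableAt (by simp))]
  rfl

theorem lie_frameVec_eventually (lf : LocalFrame Ω g e) (hy : y ∈ Ω) (a b : Fin 4) :
    (fun z => fderiv ℝ (frameVec e a) z (frameVec e b z)
      - fderiv ℝ (frameVec e b) z (frameVec e a z))
      =ᶠ[𝓝 y] fun z => ∑ c, structureFun g e c a b z • frameVec e c z := by
  filter_upwards [lf.mem_nhds hy] with z hz using lf.lie_frameVec hz a b

/-- The bracket relations of the frame, differentiated once. With $v=X$ this gives the invariance of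
the structure functions, and with $v=\xi$ the vanishing of the curvature of `frameConn`. -/
theorem fderiv_lie_frameVec (lf : LocalFrame Ω g e) (hy : y ∈ Ω) (a b : Fin 4) (v : Coord) :
    (fderiv ℝ (fderiv ℝ (frameVec e a)) y v (frameVec e b y)
        + fderiv ℝ (frameVec e a) y (fderiv ℝ (frameVec e b) y v))
      - (fderiv ℝ (fderiv ℝ (frameVec e b)) y v (frameVec e a y)
        + fderiv ℝ (frameVec e b) y (fderiv ℝ (frameVec e a) y v))
      = ∑ c, (structureFun g e c a b y • fderiv ℝ (frameVec e c) y v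
        + fderiv ℝ (structureFun g e c a b) y v • frameVec e c y) := by
  have hv := lf.contDiffAt_frameVec hy
  have hd : ∀ a, DifferentiableAt ℝ (frameVec e a) y := fun a => (hv a).differentiableAt (by simp)
  have hdd : ∀ a, DifferentiableAt ℝ (fderiv ℝ (frameVec e a)) y := fun a =>
    differentiableAt_fderiv (hv a)
  have hs : ∀ c, DifferentiableAt ℝ (structureFun g e c a b) y := fun c =>
    (lf.smooth_structureFun hy c a b).differentiableAt (by simp)
  have h1 := DFunLike.congr_fun ((lf.lie_frameVec_eventually hy a b).fderiv_eq (𝕜 := ℝ)) v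
  rw [fderiv_fun_sub ((hdd a).clm_apply (hd b)) ((hdd b).clm_apply (hd a)),
    fderiv_fun_sum fun c _ => (hs c).fun_smul (hd c)] at h1
  simp only [_root_.sub_apply, fderiv_clm_apply_apply (hdd _) (hd _),
    _root_.sum_apply, fderiv_fun_smul (hs _) (hd _), _root_.add_apply,
    _root_.smul_apply, ContinuousLinearMap.smulRight_apply] at h1
  exact h1

/-- A field that commutes with $e_a$ and $e_b$ commutes with their bracket. Since it also commutes
with each $e_c$ in the expansion of the bracket, the Leibniz rule leaves only the derivatives of the
coefficients, and the $e_c$ are independent. -/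
theorem fderiv_structureFun_eq_zero (lf : LocalFrame Ω g e) (hy : y ∈ Ω)
    (hX : ContDiffAt ℝ ∞ X y) (hc : ∀ᶠ z in 𝓝 y, CommutesAt e X z) (c a b : Fin 4) :
    fderiv ℝ (structureFun g e c a b) y (X y) = 0 := by
  have hv := lf.contDiffAt_frameVec hy
  have hd : ∀ a, DifferentiableAt ℝ (frameVec e a) y := fun a => (hv a).differentiableAt (by simp)
  have hdd : ∀ a, DifferentiableAt ℝ (fderiv ℝ (frameVec e a)) y := fun a =>
    differentiableAt_fderiv (hv a)
  have hXd : DifferentiableAt ℝ X y := hX.differentiableAt (by simp)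
  -- The relation $[X,e_a]=0$ differentiated along $e_b$, with $e_b$ itself again commuting with
  -- $X$.
  have h1 : ∀ a b, fderiv ℝ (fderiv ℝ (frameVec e a)) y (frameVec e b y) (X y)
      + fderiv ℝ (frameVec e a) y (fderiv ℝ (frameVec e b) y (X y))
      = fderiv ℝ (fderiv ℝ X) y (frameVec e b y) (frameVec e a y)
        + fderiv ℝ X y (fderiv ℝ (frameVec e a) y (frameVec e b y)) := by
    intro a b
    have h2 : (fun z => fderiv ℝ (frameVec e a) z (X z))
        =ᶠ[𝓝 y] fun z => fderiv ℝ X z (frameVec e a z) := by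
      filter_upwards [hc] with z hz using hz a
    have h3 := DFunLike.congr_fun (h2.fderiv_eq (𝕜 := ℝ)) (frameVec e b y)
    simp only [fderiv_clm_apply_apply (hdd a) hXd,
      fderiv_clm_apply_apply (differentiableAt_fderiv hX) (hd a)] at h3
    rw [hc.self_of_nhds b, h3]
  have h4 := lf.fderiv_lie_frameVec hy a b (X y)
  rw [fderiv_fderiv_comm (hv a), fderiv_fderiv_comm (hv b), h1, h1, fderiv_fderiv_comm hX,
    add_sub_add_left_eq_sub, ← map_sub, lf.lie_frameVec hy a b, map_sum,
    Finset.sum_add_distrib] at h4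
  simp only [map_smul] at h4
  have h5 : ∑ c, fderiv ℝ (structureFun g e c a b) y (X y) • frameVec e c y = 0 := by
    have h6 : ∑ c, structureFun g e c a b y • fderiv ℝ (frameVec e c) y (X y)
        = ∑ c, (connCoeff g e c a b y - connCoeff g e c b a y)
          • fderiv ℝ X y (frameVec e c y) :=
      Finset.sum_congr rfl fun c _ => by rw [hc.self_of_nhds c]; rfl
    rw [h6] at h4
    exact left_eq_add.1 h4
  exact lf.linearIndependent_frameVec hy h5 c

/-- The connection coefficients are constant linear combinations of the structure functions. -/
theorem fderiv_connCoeff_eq_zero_of_structureFun (lf : LocalFrame Ω g e) (hy : y ∈ Ω) {v : Coord}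
    (h : ∀ c a b, fderiv ℝ (structureFun g e c a b) y v = 0) (c a b : Fin 4) :
    fderiv ℝ (connCoeff g e c a b) y v = 0 := by
  set G : Fin 4 → Fin 4 → Fin 4 → ℝ := fun c a b =>
    fderiv ℝ (connCoeff g e c a b) y v * minkowski c c with hG
  have anti : ∀ c a b, G c a b + G a c b = 0 := by
    intro c a b
    have h1 : (fun z => connCoeff g e c a b z * minkowski c c
        + connCoeff g e a c b z * minkowski a a) =ᶠ[𝓝 y] fun _ => 0 := by
      filter_upwards [lf.mem_nhds hy] with z hz
      have := congrFun (congrFun (lf.connMat_antisymm hz b) a) c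
      simpa [Matrix.mul_apply, minkMat, minkowski, connMat, mul_comm] using this
    have h2 := DFunLike.congr_fun (h1.fderiv_eq (𝕜 := ℝ)) v
    have hd : ∀ c a b, DifferentiableAt ℝ (connCoeff g e c a b) y := fun c a b =>
      (lf.smooth_connCoeff hy c a b).differentiableAt (by simp)
    rw [fderiv_fun_add ((hd _ _ _).mul_const _) ((hd _ _ _).mul_const _),
      fderiv_mul_const (hd _ _ _), fderiv_mul_const (hd _ _ _)] at h2
    simpa [hG, mul_comm] using h2
  have sym : ∀ c a b, G c a b = G c b a := by
    intro c a b
    have := h c a b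
    rw [lf.fderiv_structureFun hy, sub_eq_zero] at this
    simp only [hG, this]
  -- With $c$ lowered, the differentials are antisymmetric in $c,a$ by metricity and, the structure
  -- functions being stationary, symmetric in $a,b$; such an array vanishes.
  have h0 : G c a b = 0 := by
    have := anti c a b
    have := anti a b c
    have := anti b c a
    have := sym c a b
    have := sym a b c
    have := sym b c a
    linarith
  have hm : minkowski c c ≠ 0 := by
    rw [minkowski, if_pos rfl]
    split_ifs <;> simp
  exact (mul_eq_zero.1 h0).resolve_right hm

theorem fderiv_connCoeff_eq_zero (lf : LocalFrame Ω g e) (hy : y ∈ Ω)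
    (hX : ContDiffAt ℝ ∞ X y) (hc : ∀ᶠ z in 𝓝 y, CommutesAt e X z) (c a b : Fin 4) :
    fderiv ℝ (connCoeff g e c a b) y (X y) = 0 :=
  lf.fderiv_connCoeff_eq_zero_of_structureFun hy
    (fun c a b => lf.fderiv_structureFun_eq_zero hy hX hc c a b) c a b

/-- The curvature of `frameConn` vanishes on the vectors that annihilate the structure functions. -/
theorem frameConn_flat (lf : LocalFrame Ω g e) (hy : y ∈ Ω) {ξ : Coord}
    (h : ∀ c a b, fderiv ℝ (structureFun g e c a b) y ξ = 0) (v w : Coord) :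
    fderiv ℝ (frameConn e) y v w ξ + frameConn e y w (frameConn e y v ξ)
      = fderiv ℝ (frameConn e) y w v ξ + frameConn e y v (frameConn e y w ξ) := by
  have hv := lf.contDiffAt_frameVec hy
  have hd : ∀ a, DifferentiableAt ℝ (frameVec e a) y := fun a => (hv a).differentiableAt (by simp)
  have hA : DifferentiableAt ℝ (frameConn e) y :=
    (lf.contDiffAt_frameConn hy).differentiableAt (by simp)
  -- Obtained by differentiating the defining property $A(e_a)=de_a$ of the connection.
  have h1 : ∀ a v, fderiv ℝ (frameConn e) y v (frameVec e a y)
      = fderiv ℝ (fderiv ℝ (frameVec e a)) y v - frameConn e y (fderiv ℝ (frameVec e a) y v) := by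
    intro a v
    have h2 : (fun z => frameConn e z (frameVec e a z)) =ᶠ[𝓝 y] fderiv ℝ (frameVec e a) := by
      filter_upwards [lf.mem_nhds hy] with z hz using lf.frameConn_frameVec hz a
    have h3 := DFunLike.congr_fun (h2.fderiv_eq (𝕜 := ℝ)) v
    simp only [fderiv_clm_apply_apply hA (hd a)] at h3
    exact eq_sub_of_add_eq h3
  have key : ∀ a b, fderiv ℝ (frameConn e) y (frameVec e b y) (frameVec e a y) ξ
        + frameConn e y (frameVec e a y) (frameConn e y (frameVec e b y) ξ)
      = fderiv ℝ (frameConn e) y (frameVec e a y) (frameVec e b y) ξ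
        + frameConn e y (frameVec e b y) (frameConn e y (frameVec e a y) ξ) := by
    intro a b
    -- The derivatives of the structure functions along $\xi$ are the sole obstruction to the
    -- symmetry, and `h` removes them. The general case then follows by expanding both arguments in
    -- the frame.
    have h4 := lf.fderiv_lie_frameVec hy a b ξ
    simp only [h, zero_smul, add_zero] at h4
    have h5 : ∑ c, structureFun g e c a b y • fderiv ℝ (frameVec e c) y ξ
        = frameConn e y (fderiv ℝ (frameVec e a) y (frameVec e b y)) ξ
          - frameConn e y (fderiv ℝ (frameVec e b) y (frameVec e a y)) ξ := by
      rw [← _root_.sub_apply, ← map_sub, lf.lie_frameVec hy, map_sum]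
      simp only [map_smul, _root_.sum_apply, _root_.smul_apply,
        lf.frameConn_frameVec hy]
      rfl
    rw [h5, fderiv_fderiv_comm (hv a) ξ, fderiv_fderiv_comm (hv b) ξ] at h4
    rw [h1, h1, lf.frameConn_frameVec hy, lf.frameConn_frameVec hy, _root_.sub_apply,
      _root_.sub_apply]
    rw [sub_eq_sub_iff_add_eq_add] at h4
    rw [sub_add_eq_add_sub, sub_add_eq_add_sub, sub_eq_sub_iff_add_eq_add, h4, add_comm]
  have half : ∀ a v, fderiv ℝ (frameConn e) y v (frameVec e a y) ξ
        + frameConn e y (frameVec e a y) (frameConn e y v ξ)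
      = fderiv ℝ (frameConn e) y (frameVec e a y) v ξ
        + frameConn e y v (frameConn e y (frameVec e a y) ξ) := by
    intro a v
    rw [← lf.sum_coframe_smul hy v]
    simp only [map_sum, map_smul, _root_.sum_apply, _root_.smul_apply, ← Finset.sum_add_distrib,
      ← smul_add, key]
  rw [← lf.sum_coframe_smul hy w]
  simp only [map_sum, map_smul, _root_.sum_apply, _root_.smul_apply, ← Finset.sum_add_distrib,
    ← smul_add, half]

end LocalFrame

/-! ### The space of Killing germs -/

/-- The differentials of two functions are linearly dependent. -/
def Wedge (f h : Coord → ℝ) (y : Coord) : Prop :=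
  ∀ v w, fderiv ℝ f y v * fderiv ℝ h y w = fderiv ℝ f y w * fderiv ℝ h y v

namespace LocalFrame

variable {Ω : Set Coord} {g : MetricField} {e : FrameField} {y : Coord}

/-- If the derivatives of `x` along the frame and the structure functions depend on `x` only, then
every vector tangent to the level set of `x` extends to a Killing field. -/
theorem exists_killing (lf : LocalFrame Ω g e) {y₀ : Coord} (hy₀ : y₀ ∈ Ω) {x : Coord → ℝ}
    {μ : Fin 4 → Coord → ℝ} (hx : ∀ᶠ y in 𝓝 y₀, ContDiffAt ℝ ∞ x y)
    (hμ : ∀ b, ContinuousAt (μ b) y₀)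
    (hD : ∀ᶠ y in 𝓝 y₀, ∀ b ξ, fderiv ℝ (frameDeriv e b x) y ξ = μ b y * fderiv ℝ x y ξ)
    (hs : ∀ᶠ y in 𝓝 y₀, ∀ ξ, fderiv ℝ x y ξ = 0 →
      ∀ c a b, fderiv ℝ (structureFun g e c a b) y ξ = 0)
    {ξ : Coord} (hξ : fderiv ℝ x y₀ ξ = 0) :
    ∃ X : Coord → Coord, X y₀ = ξ ∧ IsKillingNear g y₀ X := by
  have hΩ := lf.mem_nhds hy₀
  -- Here $\kappa=dx$. By the Leibniz rule $d(e_bx)$ is the derivative of $\kappa$ along $e_b$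
  -- relative to `frameConn`, so `hD` says that $\ker dx$ is parallel, while `hs` makes the
  -- curvature vanish on it.
  obtain ⟨X, hX0, hX⟩ := exists_parallel_section (A := frameConn e) (κ := fderiv ℝ x)
    (μ := fun y => ∑ b, μ b y • coframe e b y) (y₀ := y₀)
    (by filter_upwards [hΩ] with y hy using lf.contDiffAt_frameConn hy)
    (by filter_upwards [hx] with y hy using differentiableAt_fderiv hy)
    (by
      refine tendsto_finsetSum _ fun b _ => (hμ b).smul ?_
      exact tendsto_finsetSum _ fun ν _ =>
        ((lf.smooth_inv_frame hy₀ ν b).continuousAt).smul continuousAt_const)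
    (by
      filter_upwards [hΩ, hx, hD] with y hy hxy hDy h ξ
      have hb : ∀ b, fderiv ℝ (fderiv ℝ x) y (frameVec e b y) ξ
          + fderiv ℝ x y (fderiv ℝ (frameVec e b) y ξ) = μ b y * fderiv ℝ x y ξ := by
        intro b
        rw [← hDy b ξ, fderiv_fderiv_comm hxy]
        have h1 : frameDeriv e b x = fun z => fderiv ℝ x z (frameVec e b z) := by
          funext z
          exact frameDeriv_eq e b x z
        rw [h1, fderiv_clm_apply_apply (differentiableAt_fderiv hxy)
          ((lf.contDiffAt_frameVec hy b).differentiableAt (by simp))]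
      have h2 : fderiv ℝ (fderiv ℝ x) y h ξ
          = ∑ b, coframe e b y h * fderiv ℝ (fderiv ℝ x) y (frameVec e b y) ξ := by
        conv_lhs => rw [← lf.sum_coframe_smul hy h]
        simp only [map_sum, map_smul, _root_.sum_apply, _root_.smul_apply, smul_eq_mul]
      rw [h2, frameConn_apply]
      simp only [map_sum, map_smul, _root_.sum_apply, _root_.smul_apply, smul_eq_mul,
        ← Finset.sum_add_distrib, ← mul_add, hb, Finset.sum_mul]
      exact Finset.sum_congr rfl fun b _ => by ring)
    (by
      filter_upwards [hΩ, hs] with y hy hsy ξ hξ v h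
      exact lf.frameConn_flat hy (hsy ξ hξ) v h)
    hξ
  refine ⟨X, hX0, ?_⟩
  filter_upwards [hX, hΩ] with y hXy hy
  exact ⟨hXy.1, lf.lieMetric_eq_zero_of_commutesAt hXy.1 hy
    ((lf.commutesAt_iff_fderiv hy).2 hXy.2.1.fderiv)⟩

theorem commutesAt_of_isKillingNear (lf : LocalFrame Ω g e)
    (hR : ∀ y ∈ Ω, IsRiemannFrameAt g e y) {y₀ : Coord} (hy₀ : y₀ ∈ Ω) {X : Coord → Coord}
    (hX : IsKillingNear g y₀ X) : ∀ᶠ y in 𝓝 y₀, CommutesAt e X y := by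
  obtain ⟨U, hU, hUo, hyU⟩ := eventually_nhds_iff.1 (hX.and (lf.mem_nhds hy₀))
  have lfU := lf.mono hUo fun y hy => (hU y hy).2
  filter_upwards [hUo.mem_nhds hyU] with y hy
  exact lfU.commutesAt_of_killingOn (fun z hz => (hU z hz).1) hy (hR y (hU y hy).2)

/-- There is no isotropy: a Killing field is a parallel section of `frameConn`, hence is determined
near a point by its value there. -/
theorem isKillingNear_eq_zero (lf : LocalFrame Ω g e)
    (hR : ∀ y ∈ Ω, IsRiemannFrameAt g e y) {y₀ : Coord} (hy₀ : y₀ ∈ Ω) {X : Coord → Coord}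
    (hX : IsKillingNear g y₀ X) (h0 : X y₀ = 0) : ∀ᶠ y in 𝓝 y₀, X y = 0 := by
  refine eventually_eq_zero_of_parallel (lf.contDiffAt_frameConn hy₀).continuousAt ?_ h0
  filter_upwards [hX, lf.commutesAt_of_isKillingNear hR hy₀ hX, lf.mem_nhds hy₀] with y h1 h2 hy
  rw [← (lf.commutesAt_iff_fderiv hy).1 h2]
  exact (h1.1.differentiableAt (by simp)).hasFDerivAt

theorem fderiv_connCoeff_killing (lf : LocalFrame Ω g e)
    (hR : ∀ y ∈ Ω, IsRiemannFrameAt g e y) {y₀ : Coord} (hy₀ : y₀ ∈ Ω) {X : Coord → Coord}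
    (hX : IsKillingNear g y₀ X) (c a b : Fin 4) :
    fderiv ℝ (connCoeff g e c a b) y₀ (X y₀) = 0 :=
  lf.fderiv_connCoeff_eq_zero hy₀ hX.self_of_nhds.1 (lf.commutesAt_of_isKillingNear hR hy₀ hX) c a b

theorem fderiv_frameDeriv_connCoeff_killing (lf : LocalFrame Ω g e)
    (hR : ∀ y ∈ Ω, IsRiemannFrameAt g e y) {y₀ : Coord} (hy₀ : y₀ ∈ Ω) {X : Coord → Coord}
    (hX : IsKillingNear g y₀ X) (d c a b : Fin 4) :
    fderiv ℝ (frameDeriv e d (connCoeff g e c a b)) y₀ (X y₀) = 0 := by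
  have hc := lf.commutesAt_of_isKillingNear hR hy₀ hX
  refine lf.fderiv_frameDeriv_eq_zero hy₀ (lf.smooth_connCoeff hy₀ c a b) hX.self_of_nhds.1
    hc.self_of_nhds ?_ d
  filter_upwards [hX.eventually_nhds, lf.mem_nhds hy₀] with y hXy hy
  exact lf.fderiv_connCoeff_killing hR hy hXy c a b

end LocalFrame

/-- The value at `y₀` of a germ of a Killing field. -/
def killingValue (g : MetricField) (y₀ : Coord) : killingGerms g y₀ →ₗ[ℝ] Coord where
  toFun ξ := ξ.1.value
  map_add' := by
    rintro ⟨_, X, -, rfl⟩ ⟨_, Y, -, rfl⟩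
    rfl
  map_smul' := by
    rintro c ⟨_, X, -, rfl⟩
    rfl

theorem mem_range_killingValue {g : MetricField} {y₀ v : Coord} :
    v ∈ LinearMap.range (killingValue g y₀) ↔ ∃ X, IsKillingNear g y₀ X ∧ X y₀ = v := by
  constructor
  · rintro ⟨⟨_, X, hX, rfl⟩, rfl⟩
    exact ⟨X, hX, rfl⟩
  · rintro ⟨X, hX, rfl⟩
    exact ⟨⟨_, X, hX, rfl⟩, rfl⟩

namespace LocalFrame

variable {Ω : Set Coord} {g : MetricField} {e : FrameField} {y : Coord}

theorem killingValue_injective (lf : LocalFrame Ω g e)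
    (hR : ∀ y ∈ Ω, IsRiemannFrameAt g e y) {y₀ : Coord} (hy₀ : y₀ ∈ Ω) :
    Function.Injective (killingValue g y₀) := by
  refine (injective_iff_map_eq_zero _).2 ?_
  rintro ⟨_, X, hX, rfl⟩ h0
  refine Subtype.ext ?_
  exact Filter.Germ.coe_eq.2 (lf.isKillingNear_eq_zero hR hy₀ hX h0)

/-- Evaluation is injective, so counting Killing germs amounts to measuring a subspace of $\mathbb
R^4$. -/
theorem rank_killingGerms (lf : LocalFrame Ω g e)
    (hR : ∀ y ∈ Ω, IsRiemannFrameAt g e y) {y₀ : Coord} (hy₀ : y₀ ∈ Ω) :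
    Module.rank ℝ (killingGerms g y₀)
      = (Module.finrank ℝ (LinearMap.range (killingValue g y₀)) : Cardinal) := by
  rw [Module.finrank_eq_rank,
    (LinearEquiv.ofInjective _ (lf.killingValue_injective hR hy₀)).rank_eq]

theorem finrank_ker {φ : Coord →L[ℝ] ℝ} (hφ : φ ≠ 0) :
    Module.finrank ℝ (LinearMap.ker (φ : Coord →ₗ[ℝ] ℝ)) = 3 := by
  have h1 : (φ : Coord →ₗ[ℝ] ℝ) ≠ 0 := fun h => hφ (by ext v; exact DFunLike.congr_fun h v)
  have h2 := LinearMap.finrank_range_add_finrank_ker (φ : Coord →ₗ[ℝ] ℝ)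
  rw [LinearMap.range_eq_top.2 (LinearMap.surjective h1), finrank_top, Module.finrank_self,
    finrank_euclideanSpace_fin] at h2
  omega

/-- Two linear forms that vanish on a common three-dimensional space are linearly dependent. -/
theorem mul_eq_mul_of_vanish {S : Submodule ℝ Coord} (hS : Module.finrank ℝ S = 3)
    {φ ψ : Coord →L[ℝ] ℝ} (hφ : ∀ v ∈ S, φ v = 0) (hψ : ∀ v ∈ S, ψ v = 0) (v w : Coord) :
    φ v * ψ w = φ w * ψ v := by
  by_cases h0 : φ = 0
  · simp [h0]
  have hle : S ≤ LinearMap.ker (φ : Coord →ₗ[ℝ] ℝ) := fun v hv => hφ v hv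
  have heq := Submodule.eq_of_le_of_finrank_eq hle (by rw [hS, finrank_ker h0])
  have hmem : φ v • w - φ w • v ∈ S := by
    rw [heq, LinearMap.mem_ker]
    simp [mul_comm]
  have := hψ _ hmem
  simp only [map_sub, map_smul, smul_eq_mul] at this
  exact sub_eq_zero.1 this

/-- With constant connection coefficients the curvature of `frameConn` vanishes identically and
every vector extends to a Killing field: the space is locally homogeneous. -/
theorem finrank_range_of_const (lf : LocalFrame Ω g e) {y₀ : Coord} (hy₀ : y₀ ∈ Ω)
    (h : ∀ᶠ y in 𝓝 y₀, ∀ c a b, fderiv ℝ (connCoeff g e c a b) y = 0) :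
    Module.finrank ℝ (LinearMap.range (killingValue g y₀)) = 4 := by
  have : LinearMap.range (killingValue g y₀) = ⊤ := by
    refine Submodule.eq_top_iff'.2 fun ξ => mem_range_killingValue.2 ?_
    -- A constant $x$ has $dx=0$, so its kernel is the whole space and imposes no condition on
    -- $\xi$.
    obtain ⟨X, h1, h2⟩ := lf.exists_killing hy₀ (x := fun _ => 0) (μ := fun _ _ => 0) (ξ := ξ)
      (Filter.Eventually.of_forall fun _ => contDiffAt_const) (fun _ => continuousAt_const)
      (Filter.Eventually.of_forall fun y b ξ => by
        have : frameDeriv e b (fun _ => (0 : ℝ)) = fun _ => 0 := by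
          funext z
          simp [frameDeriv, pd]
        simp [this])
      (by
        filter_upwards [h, lf.mem_nhds hy₀] with y hy hyΩ ξ _ c a b
        rw [lf.fderiv_structureFun hyΩ, hy, hy]
        simp)
      (by simp)
    exact ⟨X, h2, h1⟩
  rw [this, finrank_top, finrank_euclideanSpace_fin]

/-- A three-dimensional space of Killing fields makes the connection coefficients and their
derivatives functions of one variable. -/
theorem wedge_of_rank (lf : LocalFrame Ω g e)
    (hR : ∀ y ∈ Ω, IsRiemannFrameAt g e y) {y₀ : Coord} (hy₀ : y₀ ∈ Ω)
    (hreg : (∀ c a b, fderiv ℝ (connCoeff g e c a b) y₀ = 0) →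
      ∀ᶠ y in 𝓝 y₀, ∀ c a b, fderiv ℝ (connCoeff g e c a b) y = 0)
    (hrank : Module.rank ℝ (killingGerms g y₀) = (3 : ℕ)) :
    (∃ c a b, fderiv ℝ (connCoeff g e c a b) y₀ ≠ 0) ∧
    (∀ c a b c' a' b', Wedge (connCoeff g e c a b) (connCoeff g e c' a' b') y₀) ∧
    ∀ c a b d c' a' b',
      Wedge (connCoeff g e c a b) (frameDeriv e d (connCoeff g e c' a' b')) y₀ := by
  rw [lf.rank_killingGerms hR hy₀] at hrank
  have hrank : Module.finrank ℝ (LinearMap.range (killingValue g y₀)) = 3 := by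
    exact_mod_cast hrank
  have h1 : ∀ c a b, ∀ v ∈ LinearMap.range (killingValue g y₀),
      fderiv ℝ (connCoeff g e c a b) y₀ v = 0 := by
    intro c a b v hv
    obtain ⟨X, hX, rfl⟩ := mem_range_killingValue.1 hv
    exact lf.fderiv_connCoeff_killing hR hy₀ hX c a b
  have h2 : ∀ d c a b, ∀ v ∈ LinearMap.range (killingValue g y₀),
      fderiv ℝ (frameDeriv e d (connCoeff g e c a b)) y₀ v = 0 := by
    intro d c a b v hv
    obtain ⟨X, hX, rfl⟩ := mem_range_killingValue.1 hv
    exact lf.fderiv_frameDeriv_connCoeff_killing hR hy₀ hX d c a b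
  refine ⟨?_, fun c a b c' a' b' => mul_eq_mul_of_vanish hrank (h1 _ _ _) (h1 _ _ _),
    fun c a b d c' a' b' => mul_eq_mul_of_vanish hrank (h1 _ _ _) (h2 _ _ _ _)⟩
  -- If all $d\gamma$ vanished at the point, regularity would make them vanish around it, and the
  -- dimension would be four instead of three.
  by_contra! hcon
  have := lf.finrank_range_of_const hy₀ (hreg hcon)
  omega

/-- If the connection coefficients and their derivatives are functions of one variable, then the
space of Killing fields is three-dimensional. -/
theorem rank_of_wedge (lf : LocalFrame Ω g e)
    (hR : ∀ y ∈ Ω, IsRiemannFrameAt g e y) {y₀ : Coord} (hy₀ : y₀ ∈ Ω)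
    (hne : ∃ c a b, fderiv ℝ (connCoeff g e c a b) y₀ ≠ 0)
    (h0 : ∀ y ∈ Ω, ∀ c a b c' a' b', Wedge (connCoeff g e c a b) (connCoeff g e c' a' b') y)
    (h1 : ∀ y ∈ Ω, ∀ c a b d c' a' b',
      Wedge (connCoeff g e c a b) (frameDeriv e d (connCoeff g e c' a' b')) y) :
    Module.rank ℝ (killingGerms g y₀) = (3 : ℕ) := by
  obtain ⟨c₀, a₀, b₀, hne⟩ := hne
  set x := connCoeff g e c₀ a₀ b₀ with hx
  have hxs : ∀ y ∈ Ω, ContDiffAt ℝ ∞ x y := fun y hy => lf.smooth_connCoeff hy c₀ a₀ b₀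
  obtain ⟨v, hv⟩ : ∃ v, fderiv ℝ x y₀ v ≠ 0 := by
    by_contra! h
    exact hne (by ext v; exact h v)
  have hcx : ∀ h : Coord → ℝ, ContDiffAt ℝ ∞ h y₀ → ContinuousAt (fun y => fderiv ℝ h y v) y₀ :=
    fun h hh => (differentiableAt_fderiv hh).continuousAt.clm_apply continuousAt_const
  have hvev : ∀ᶠ y in 𝓝 y₀, fderiv ℝ x y v ≠ 0 := (hcx x (hxs y₀ hy₀)).eventually_ne hv
  have hΩ := lf.mem_nhds hy₀
  -- One inclusion is the invariance of $x$ under Killing fields; the other is the existence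
  -- theorem.
  have hsub : LinearMap.range (killingValue g y₀)
      = LinearMap.ker (fderiv ℝ x y₀ : Coord →ₗ[ℝ] ℝ) := by
    ext ξ
    rw [mem_range_killingValue, LinearMap.mem_ker]
    constructor
    · rintro ⟨X, hX, rfl⟩
      exact lf.fderiv_connCoeff_killing hR hy₀ hX c₀ a₀ b₀
    · intro hξ
      obtain ⟨X, e1, e2⟩ := lf.exists_killing hy₀ (x := x)
        -- The proportionality factor between $d(e_bx)$ and $dx$, read off on a vector $v$ with
        -- $dx(v)\neq0$; it is continuous at $y_0$ because the denominator does not vanish there.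
        (μ := fun b y => fderiv ℝ (frameDeriv e b x) y v / fderiv ℝ x y v) (ξ := ξ)
        (by filter_upwards [hΩ] with y hy using hxs y hy)
        (fun b => by
          have hsm : ContDiffAt ℝ ∞ (frameDeriv e b x) y₀ :=
            ContDiffAt.sum fun ν _ => (lf.smooth_e y₀ hy₀ b ν).mul (contDiffAt_pd (hxs y₀ hy₀) ν)
          exact (hcx _ hsm).div (hcx x (hxs y₀ hy₀)) hv)
        (by
          filter_upwards [hΩ, hvev] with y hy hvy b ξ
          have := h1 y hy c₀ a₀ b₀ b c₀ a₀ b₀ v ξ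
          rw [div_mul_eq_mul_div, eq_div_iff hvy]
          linarith)
        (by
          filter_upwards [hΩ, hvev] with y hy hvy ξ hξ c a b
          have : ∀ c a b, fderiv ℝ (connCoeff g e c a b) y ξ = 0 := by
            intro c a b
            have := h0 y hy c₀ a₀ b₀ c a b v ξ
            rw [← hx, hξ, zero_mul] at this
            exact (mul_eq_zero.1 this).resolve_left hvy
          rw [lf.fderiv_structureFun hy, this, this, sub_zero])
        hξ
      exact ⟨X, e2, e1⟩
  rw [lf.rank_killingGerms hR hy₀, hsub, finrank_ker hne]

end LocalFrame

/-! ### Functions of a single function -/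

/-- After a local change of coordinates $x$ is affine with linear part $l$, and the wedge condition
says that $F$ has zero derivative along $\ker l$. On a ball, whose slices by level sets of $l$ are
convex, $F$ then depends on $x$ alone. -/
theorem exists_eq_comp_of_wedge {y₀ : Coord} {x F : Coord → ℝ}
    (hx : ∀ᶠ y in 𝓝 y₀, ContDiffAt ℝ ∞ x y) (hF : ∀ᶠ y in 𝓝 y₀, ContDiffAt ℝ ∞ F y)
    (hne : fderiv ℝ x y₀ ≠ 0) (hw : ∀ᶠ y in 𝓝 y₀, Wedge x F y) :
    ∃ f : ℝ → ℝ, (∀ᶠ s in 𝓝 (x y₀), ContDiffAt ℝ ∞ f s) ∧ ∀ᶠ y in 𝓝 y₀, F y = f (x y) := by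
  set l := fderiv ℝ x y₀ with hl
  obtain ⟨v, hv⟩ : ∃ v, l v = 1 := by
    obtain ⟨v, hv⟩ : ∃ v, l v ≠ 0 := by
      by_contra! h
      exact hne (by ext v; exact h v)
    exact ⟨(l v)⁻¹ • v, by simp [hv]⟩
  -- a change of coordinates that makes `x` affine
  set Ψ : Coord → Coord := fun y => y + (x y - x y₀ - l (y - y₀)) • v with hΨ
  have hΨ0 : Ψ y₀ = y₀ := by simp [hΨ]
  have hΨs : ∀ y, ContDiffAt ℝ ∞ x y → ContDiffAt ℝ ∞ Ψ y := fun y hy =>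
    contDiffAt_id.add (((hy.sub contDiffAt_const).sub
      (l.contDiff.contDiffAt.comp y (contDiffAt_id.sub contDiffAt_const))).smul contDiffAt_const)
  have hΨl : ∀ y, l (Ψ y - y₀) = x y - x y₀ := by
    intro y
    have : Ψ y - y₀ = (y - y₀) + (x y - x y₀ - l (y - y₀)) • v := by
      simp only [hΨ]
      abel
    rw [this, map_add, map_smul, hv]
    simp
  -- The correction added to the identity is the first-order remainder of $x$ at $y_0$, so it has
  -- zero derivative there.
  have hd : HasFDerivAt Ψ (ContinuousLinearEquiv.refl ℝ Coord : Coord →L[ℝ] Coord) y₀ := by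
    have h1 : HasFDerivAt x l y₀ := (hx.self_of_nhds.differentiableAt (by simp)).hasFDerivAt
    have h2 := (hasFDerivAt_id y₀).add (((h1.sub_const (x y₀)).sub
      (l.hasFDerivAt.comp y₀ ((hasFDerivAt_id y₀).sub_const y₀))).smul_const v)
    refine h2.congr_fderiv ?_
    ext w
    simp
  have hΨ0s := hΨs y₀ hx.self_of_nhds
  set P := hΨ0s.toOpenPartialHomeomorph Ψ hd (by simp) with hP
  have hPc : ∀ y, P y = Ψ y := fun y => rfl
  have hsrc : y₀ ∈ P.source := hΨ0s.mem_toOpenPartialHomeomorph_source hd (by simp)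
  have htgt : y₀ ∈ P.target := by
    have := P.map_source hsrc
    rwa [hPc, hΨ0] at this
  have hΦ0 : P.symm y₀ = y₀ := by
    have := P.left_inv hsrc
    rwa [hPc, hΨ0] at this
  have hΦc : Filter.Tendsto P.symm (𝓝 y₀) (𝓝 y₀) := by
    have := (P.continuousAt_symm htgt).tendsto
    rwa [hΦ0] at this
  -- Smoothness of the inverse is needed at all points near $y_0$, hence invertibility of the
  -- differential at nearby points; invertible operators form an open set.
  have hequiv : ∀ᶠ y in 𝓝 y₀, ∃ L : Coord ≃L[ℝ] Coord, HasFDerivAt Ψ (L : Coord →L[ℝ] Coord) y := by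
    have h1 : ContinuousAt (fderiv ℝ Ψ) y₀ := (differentiableAt_fderiv hΨ0s).continuousAt
    have h2 : Set.range ((↑) : (Coord ≃L[ℝ] Coord) → Coord →L[ℝ] Coord) ∈ 𝓝 (fderiv ℝ Ψ y₀) := by
      rw [hd.fderiv]
      exact ContinuousLinearEquiv.nhds _
    filter_upwards [h1.eventually_mem h2, hx] with y ⟨L, hL⟩ hxy
    exact ⟨L, hL ▸ ((hΨs y hxy).differentiableAt (by simp)).hasFDerivAt⟩
  have hgood : ∀ᶠ u in 𝓝 y₀, ContDiffAt ℝ ∞ P.symm u ∧ Ψ (P.symm u) = u ∧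
      ContDiffAt ℝ ∞ x (P.symm u) ∧ ContDiffAt ℝ ∞ F (P.symm u) ∧ Wedge x F (P.symm u) := by
    filter_upwards [P.open_target.mem_nhds htgt, hΦc.eventually hequiv, hΦc.eventually hx,
      hΦc.eventually hF, hΦc.eventually hw] with u hu ⟨L, hL⟩ h1 h2 h3
    exact ⟨P.contDiffAt_symm hu hL (hΨs _ h1), P.right_inv hu, h1, h2, h3⟩
  obtain ⟨r, hr, hB⟩ := Metric.eventually_nhds_iff_ball.1 hgood
  set H : Coord → ℝ := fun u => F (P.symm u) with hH
  have hHs : ∀ u ∈ Metric.ball y₀ r, ContDiffAt ℝ ∞ H u := fun u hu =>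
    (hB u hu).2.2.2.1.comp u (hB u hu).1
  have hxΦ : ∀ u ∈ Metric.ball y₀ r, x (P.symm u) = x y₀ + l (u - y₀) := by
    intro u hu
    have := hΨl (P.symm u)
    rw [(hB u hu).2.1] at this
    linarith
  have hker : ∀ u ∈ Metric.ball y₀ r, ∀ w, l w = 0 → fderiv ℝ H u w = 0 := by
    intro u hu w hlw
    obtain ⟨h1, -, h3, h4, h5⟩ := hB u hu
    have d1 : DifferentiableAt ℝ P.symm u := h1.differentiableAt (by simp)
    have e1 : ∀ w, fderiv ℝ x (P.symm u) (fderiv ℝ P.symm u w) = l w := by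
      intro w
      have c1 : (fun u => x (P.symm u)) =ᶠ[𝓝 u] fun u => x y₀ + l (u - y₀) := by
        filter_upwards [Metric.isOpen_ball.mem_nhds hu] with z hz using hxΦ z hz
      have c2 : HasFDerivAt (fun u => x y₀ + l (u - y₀)) l u := by
        have := (l.hasFDerivAt.comp u ((hasFDerivAt_id u).sub_const y₀)).const_add (x y₀)
        refine this.congr_fderiv ?_
        ext w
        simp
      have c3 := c1.fderiv_eq (𝕜 := ℝ)
      rw [c2.fderiv] at c3
      rw [← c3]
      have := fderiv_comp u (h3.differentiableAt (by simp)) d1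
      exact (DFunLike.congr_fun this w).symm
    have e2 : fderiv ℝ H u w = fderiv ℝ F (P.symm u) (fderiv ℝ P.symm u w) :=
      DFunLike.congr_fun (fderiv_comp u (h4.differentiableAt (by simp)) d1) w
    have e3 := h5 (fderiv ℝ P.symm u v) (fderiv ℝ P.symm u w)
    rw [e1, e1, hv, hlw, one_mul, zero_mul] at e3
    rw [e2, e3]
  have hline : Continuous fun s : ℝ => y₀ + (s - x y₀) • v := by fun_prop
  have hline0 : y₀ + (x y₀ - x y₀) • v = y₀ := by simp
  have hlineB : ∀ᶠ s in 𝓝 (x y₀), y₀ + (s - x y₀) • v ∈ Metric.ball y₀ r := by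
    refine hline.continuousAt.eventually_mem ?_
    rw [hline0]
    exact Metric.ball_mem_nhds y₀ hr
  -- The function $f$ is $F$, in the new coordinates, restricted to the line through $y_0$ in the
  -- direction $v$. Since $l(v)=1$, this line meets each nearby level of $x$ once, at parameter $s$.
  refine ⟨fun s => H (y₀ + (s - x y₀) • v), ?_, ?_⟩
  · filter_upwards [hlineB] with s hs
    refine ContDiffAt.comp s (g := H) (f := fun s : ℝ => y₀ + (s - x y₀) • v) (hHs _ hs)
      (contDiffAt_const.add ?_)
    exact (contDiffAt_id.sub contDiffAt_const).smul contDiffAt_const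
  · have hΨB : ∀ᶠ y in 𝓝 y₀, Ψ y ∈ Metric.ball y₀ r :=
      hΨ0s.continuousAt.eventually_mem (by rw [hΨ0]; exact Metric.ball_mem_nhds y₀ hr)
    filter_upwards [hΨB, P.open_source.mem_nhds hsrc,
      hx.self_of_nhds.continuousAt.eventually hlineB] with y h1 h2 h3
    -- The point of that line on the level of $y$. Its difference from $\Psi(y)$ lies in $\ker l$
    -- and the segment between them stays in the ball, so $H$ takes the same value at both.
    set u' := y₀ + (x y - x y₀) • v with hu'
    have hFy : F y = H (Ψ y) := by
      simp only [hH, ← hPc]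
      rw [P.left_inv h2]
    have hlu : l (Ψ y - u') = 0 := by
      have : Ψ y - u' = (Ψ y - y₀) - (x y - x y₀) • v := by
        rw [hu']
        abel
      rw [this, map_sub, hΨl, map_smul, hv]
      simp
    have hseg : ∀ t ∈ Set.Icc (0 : ℝ) 1, u' + t • (Ψ y - u') ∈ Metric.ball y₀ r := fun t ht =>
      (convex_ball y₀ r).add_smul_sub_mem h3 h1 ht
    have hderiv : ∀ t ∈ Set.Icc (0 : ℝ) 1,
        HasDerivAt (fun t : ℝ => H (u' + t • (Ψ y - u'))) 0 t := by
      intro t ht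
      have c1 : HasDerivAt (fun t : ℝ => u' + t • (Ψ y - u')) (Ψ y - u') t := by
        simpa using ((hasDerivAt_id t).smul_const (Ψ y - u')).const_add u'
      have c2 := ((hHs _ (hseg t ht)).differentiableAt (by simp)).hasFDerivAt.comp_hasDerivAt t c1
      rwa [hker _ (hseg t ht) _ hlu] at c2
    have := constant_of_has_deriv_right_zero
      (fun t ht => (hderiv t ht).continuousAt.continuousWithinAt)
      (fun t ht => (hderiv t (Set.Ico_subset_Icc_self ht)).hasDerivWithinAt) 1 (by simp)
    simp only [one_smul, zero_smul, add_zero, add_sub_cancel] at this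
    rw [hFy, this]

theorem wedge_of_eq_comp {y₀ : Coord} {x F G : Coord → ℝ} {f h : ℝ → ℝ}
    (hx : DifferentiableAt ℝ x y₀) (hf : DifferentiableAt ℝ f (x y₀))
    (hh : DifferentiableAt ℝ h (x y₀)) (hF : ∀ᶠ y in 𝓝 y₀, F y = f (x y))
    (hG : ∀ᶠ y in 𝓝 y₀, G y = h (x y)) : Wedge F G y₀ := by
  have key : ∀ {F : Coord → ℝ} {f : ℝ → ℝ}, DifferentiableAt ℝ f (x y₀) →
      (∀ᶠ y in 𝓝 y₀, F y = f (x y)) → ∀ v, fderiv ℝ F y₀ v = deriv f (x y₀) * fderiv ℝ x y₀ v := by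
    intro F f hf hF v
    have h1 : F =ᶠ[𝓝 y₀] f ∘ x := hF
    rw [h1.fderiv_eq, (hf.hasDerivAt.comp_hasFDerivAt y₀ hx.hasFDerivAt).fderiv]
    rfl
  intro v w
  rw [key hf hF, key hf hF, key hh hG, key hh hG]
  ring

/-! ### Contraction with the volume element -/

/-- The expansion of the determinant by multilinearity, each row being written in the standard
basis. -/
theorem frameSum_leviCivita_id (N : Matrix (Fin 4) (Fin 4) ℝ) :
    frameSum leviCivita N id = N.det := by
  have h1 : N = fun i => ∑ j, N i j • fun k => if j = k then (1 : ℝ) else 0 := by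
    ext i k
    simp [Finset.sum_apply]
  conv_rhs => rw [h1]
  have h2 := (Matrix.detRowAlternating (n := Fin 4) (R := ℝ)).toMultilinearMap.map_sum
    (fun i j => N i j • fun k => if j = k then (1 : ℝ) else 0)
  refine Eq.trans ?_ h2.symm
  unfold frameSum
  refine Finset.sum_congr rfl fun J _ => ?_
  have h3 := (Matrix.detRowAlternating (n := Fin 4) (R := ℝ)).toMultilinearMap.map_smul_univ
    (fun i => N i (J i)) (fun i k => if J i = k then (1 : ℝ) else 0)
  refine Eq.trans ?_ h3.symm
  rw [mul_comm]
  rfl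

theorem frameSum_leviCivita (M : Matrix (Fin 4) (Fin 4) ℝ) (I : Fin 4 → Fin 4) :
    frameSum leviCivita M I = leviCivita I * M.det := by
  have h1 : frameSum leviCivita M I = frameSum leviCivita (Matrix.of fun i => M (I i)) id := rfl
  rw [h1, frameSum_leviCivita_id, leviCivita, ← Matrix.det_mul]
  congr 1
  ext i k
  simp [Matrix.mul_apply]

/-- Fixing the last two slots at $c,d$ amounts to filling the last two rows with basis vectors. -/
theorem sum_leviCivita_eq_det (s t : Fin 4 → ℝ) (c d : Fin 4) :
    ∑ a, ∑ b, leviCivita ![a, b, c, d] * s a * t b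
      = (Matrix.of ![s, t, Pi.single c 1, Pi.single d 1]).det := by
  rw [← frameSum_leviCivita_id]
  have h1 : (id : Fin 4 → Fin 4)
      = Fin.cons 0 (Fin.cons 1 (Fin.cons 2 (Fin.cons 3 default))) := by
    ext i
    fin_cases i <;> rfl
  rw [h1]
  simp only [frameSum_cons, frameSum_zero_rank]
  refine Finset.sum_congr rfl fun a _ => ?_
  simp only [Matrix.of_apply, Matrix.cons_val_zero, Matrix.cons_val_one, Matrix.cons_val,
    Pi.single_apply, ite_mul, one_mul, zero_mul, Finset.sum_ite_eq', Finset.mem_univ, if_true,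
    Finset.mul_sum]
  refine Finset.sum_congr rfl fun b _ => ?_
  have h2 : (![a, b, c, d] : Fin 4 → Fin 4)
      = Fin.cons a (Fin.cons b (Fin.cons c (Fin.cons d default))) := by
    ext i
    fin_cases i <;> rfl
  rw [h2]
  ring

/-- Duality on bivectors is injective: taking $\{c,d\}$ complementary to $\{a,b\}$ isolates, up to
sign, one $2\times2$ minor of $s,t$. -/
theorem sum_leviCivita_eq_zero_iff (s t : Fin 4 → ℝ) :
    (∀ c d, ∑ a, ∑ b, leviCivita ![a, b, c, d] * s a * t b = 0) ↔
      ∀ a b, s a * t b = s b * t a := by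
  simp only [sum_leviCivita_eq_det]
  constructor
  · intro h
    have h01 := h 2 3
    have h02 := h 1 3
    have h03 := h 1 2
    have h12 := h 0 3
    have h13 := h 0 2
    have h23 := h 0 1
    simp [Matrix.det_succ_row_zero, Fin.sum_univ_succ, Fin.succAbove] at h01 h02 h03 h12 h13 h23
    intro a b
    fin_cases a <;> fin_cases b <;> simp <;> linarith
  · intro h c d
    have h01 := h 0 1
    have h02 := h 0 2
    have h03 := h 0 3
    have h12 := h 1 2
    have h13 := h 1 3
    have h23 := h 2 3
    generalize (Pi.single c 1 : Fin 4 → ℝ) = p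
    generalize (Pi.single d 1 : Fin 4 → ℝ) = q
    simp [Matrix.det_succ_row_zero, Fin.sum_univ_succ, Fin.succAbove]
    -- Laplace expansion along the first two rows; the coefficients are the complementary minors of
    -- the last two.
    linear_combination (p 2 * q 3 - p 3 * q 2) * h01 - (p 1 * q 3 - p 3 * q 1) * h02
      + (p 1 * q 2 - p 2 * q 1) * h03 + (p 0 * q 3 - p 3 * q 0) * h12
      - (p 0 * q 2 - p 2 * q 0) * h13 + (p 0 * q 1 - p 1 * q 0) * h23

/-- The symmetry of a product in two leading slots is a tensorial condition, so it survives a change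
of frame. Applied to both $e$ and $e^{-1}$ it gives an equivalence. -/
theorem frameSum_mul_comm {k m : ℕ} {S : (Fin (k + 1) → Fin 4) → ℝ}
    {T : (Fin (m + 1) → Fin 4) → ℝ}
    (h : ∀ I J a b, S (Fin.cons a I) * T (Fin.cons b J) = S (Fin.cons b I) * T (Fin.cons a J))
    (f : Matrix (Fin 4) (Fin 4) ℝ) (I : Fin k → Fin 4) (J : Fin m → Fin 4) (a b : Fin 4) :
    frameSum S f (Fin.cons a I) * frameSum T f (Fin.cons b J)
      = frameSum S f (Fin.cons b I) * frameSum T f (Fin.cons a J) := by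
  have h1 : ∀ α β, frameSum (fun I => S (Fin.cons α I)) f I * frameSum (fun J => T (Fin.cons β J)) f J
      = frameSum (fun I => S (Fin.cons β I)) f I * frameSum (fun J => T (Fin.cons α J)) f J := by
    intro α β
    unfold frameSum
    rw [Finset.sum_mul_sum, Finset.sum_mul_sum]
    refine Finset.sum_congr rfl fun I' _ => Finset.sum_congr rfl fun J' _ => ?_
    rw [mul_mul_mul_comm, h, mul_mul_mul_comm]
  simp only [frameSum_cons]
  rw [Finset.sum_mul_sum, Finset.sum_mul_sum, Finset.sum_comm]
  refine Finset.sum_congr rfl fun β _ => Finset.sum_congr rfl fun α _ => ?_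
  linear_combination (f a α * f b β) * h1 α β

namespace LocalFrame

variable {Ω : Set Coord} {g : MetricField} {e : FrameField} {y : Coord}

/-- Raising all indices of a totally antisymmetric symbol multiplies it by a determinant. Only the
nonvanishing of the factor matters for the equations $\eta(S,T)=0$. -/
theorem volUp_eq (lf : LocalFrame Ω g e) (hy : y ∈ Ω) :
    ∃ k ≠ 0, ∀ I, volUp g e y I = k * leviCivita I := by
  refine ⟨Real.sign (e y).det * Real.sqrt |(g y).det| * (g y)⁻¹.det, ?_, fun I => ?_⟩
  · have h1 : (g y)⁻¹.det ≠ 0 := by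
      intro h
      have := congrArg Matrix.det (lf.metric_mul_inv hy)
      rw [Matrix.det_mul, h, mul_zero, Matrix.det_one] at this
      exact zero_ne_one this
    have h2 : Real.sqrt |(g y).det| ≠ 0 :=
      (Real.sqrt_pos.2 (abs_pos.2 (lf.det_metric_ne_zero hy))).ne'
    have h3 : Real.sign (e y).det ≠ 0 := fun h =>
      lf.det_frame_ne_zero hy (Real.sign_eq_zero_iff.1 h)
    exact mul_ne_zero (mul_ne_zero h3 h2) h1
  · have h1 : volUp g e y I
        = Real.sign (e y).det * Real.sqrt |(g y).det| * frameSum leviCivita (g y)⁻¹ I := by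
      simp only [volUp, volDown, frameSum, Finset.mul_sum]
      exact Finset.sum_congr rfl fun J _ => by ring
    rw [h1, frameSum_leviCivita]
    ring

theorem volContract_eq_zero_iff (lf : LocalFrame Ω g e) (hy : y ∈ Ω) {k m : ℕ}
    (S : TensorField (k + 1)) (T : TensorField (m + 1)) :
    (∀ c d I J, volContract g e S T y c d I J = 0) ↔
      ∀ I J a b, frameSum (S y) (e y) (Fin.cons a I) * frameSum (T y) (e y) (Fin.cons b J)
        = frameSum (S y) (e y) (Fin.cons b I) * frameSum (T y) (e y) (Fin.cons a J) := by
  obtain ⟨κ, hκ, hvol⟩ := lf.volUp_eq hy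
  have h1 : ∀ c d I J, volContract g e S T y c d I J
      = κ * ∑ a, ∑ b, leviCivita ![a, b, c, d] * S y (Fin.cons a I) * T y (Fin.cons b J) := by
    intro c d I J
    simp only [volContract, hvol, Finset.mul_sum]
    exact Finset.sum_congr rfl fun a _ => Finset.sum_congr rfl fun b _ => by ring
  have h2 : (∀ c d I J, volContract g e S T y c d I J = 0) ↔
      ∀ I J a b, S y (Fin.cons a I) * T y (Fin.cons b J)
        = S y (Fin.cons b I) * T y (Fin.cons a J) := by
    simp only [h1, mul_eq_zero, hκ, false_or]
    constructor
    · intro h I J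
      exact (sum_leviCivita_eq_zero_iff (fun a => S y (Fin.cons a I))
        fun b => T y (Fin.cons b J)).1 fun c d => h c d I J
    · intro h c d I J
      exact (sum_leviCivita_eq_zero_iff (fun a => S y (Fin.cons a I))
        fun b => T y (Fin.cons b J)).2 (h I J) c d
  rw [h2]
  constructor
  · exact fun h => frameSum_mul_comm h (e y)
  · intro h
    have h3 : ∀ {n : ℕ} (T : (Fin n → Fin 4) → ℝ), frameSum (frameSum T (e y)) (e y)⁻¹ = T := by
      intro n T
      funext a
      rw [frameSum_frameSum, lf.inv_mul_frame hy, frameSum_one]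
    have h4 := frameSum_mul_comm h (e y)⁻¹
    simpa only [h3] using h4

theorem mul_eq_mul_of_frameVec (lf : LocalFrame Ω g e) (hy : y ∈ Ω) {φ ψ : Coord →L[ℝ] ℝ}
    (h : ∀ a b, φ (frameVec e a y) * ψ (frameVec e b y)
      = φ (frameVec e b y) * ψ (frameVec e a y)) (v w : Coord) : φ v * ψ w = φ w * ψ v := by
  rw [← lf.sum_coframe_smul hy v, ← lf.sum_coframe_smul hy w]
  simp only [map_sum, map_smul, smul_eq_mul]
  rw [Finset.sum_mul_sum, Finset.sum_mul_sum, Finset.sum_comm]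
  refine Finset.sum_congr rfl fun b _ => Finset.sum_congr rfl fun a _ => ?_
  rw [mul_mul_mul_comm, h, mul_comm (coframe e a y v), mul_mul_mul_comm]

/-- The frame components of the concomitants. -/
def _root_.Spacetime.concomitantComp (g : MetricField) (e : FrameField) (q : ℕ)
    (I : Fin (3 + q) → Fin 4) (y : Coord) : ℝ :=
  frameSum (concomitant g e q y) (e y) I

theorem concomitantComp_succ (lf : LocalFrame Ω g e) (hy : y ∈ Ω) (q : ℕ) (d : Fin 4)
    (I : Fin (3 + q) → Fin 4) :
    frameSum (concomitant g e (q + 1) y) (e y) (Fin.cons d I : Fin (3 + q + 1) → Fin 4)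
      = fderiv ℝ (concomitantComp g e q I) y (frameVec e d y) := by
  rw [← frameDeriv_eq]
  exact lf.frameSum_corrD hy (lf.smooth_concomitant hy q) d I

/-- In the frame the leading slot of $C^{[q+1]}$ carries the differential of a component of
$C^{[q]}$, so the alternation in the leading slots is the wedge product of two differentials. -/
theorem volContract_concomitant_iff (lf : LocalFrame Ω g e) (hy : y ∈ Ω) (p q : ℕ) :
    (∀ c d I J, volContract g e (k := 3 + p) (m := 3 + q) (concomitant g e (p + 1))
        (concomitant g e (q + 1)) y c d I J = 0) ↔
      ∀ I J, Wedge (concomitantComp g e p I) (concomitantComp g e q J) y := by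
  refine (lf.volContract_eq_zero_iff hy (k := 3 + p) (m := 3 + q) _ _).trans ?_
  simp only [lf.concomitantComp_succ hy]
  exact ⟨fun h I J => lf.mul_eq_mul_of_frameVec hy (h I J), fun h I J a b => h I J _ _⟩

theorem concomitantComp_zero (lf : LocalFrame Ω g e) (hy : y ∈ Ω) (I : Fin 3 → Fin 4) :
    concomitantComp g e 0 I =ᶠ[𝓝 y] fun z =>
      connCoeff g e (I 2) (I 1) (I 0) z * minkowski (I 2) (I 2) := by
  filter_upwards [lf.mem_nhds hy] with z hz using lf.frameSum_connTensor hz I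

theorem _root_.Spacetime.minkowski_self_ne_zero (a : Fin 4) : minkowski a a ≠ 0 := by
  rw [minkowski, if_pos rfl]
  split_ifs <;> simp

theorem fderiv_concomitantComp_zero (lf : LocalFrame Ω g e) (hy : y ∈ Ω) (I : Fin 3 → Fin 4)
    (v : Coord) : fderiv ℝ (concomitantComp g e 0 I) y v
      = minkowski (I 2) (I 2) * fderiv ℝ (connCoeff g e (I 2) (I 1) (I 0)) y v := by
  rw [(lf.concomitantComp_zero hy I).fderiv_eq,
    fderiv_mul_const ((lf.smooth_connCoeff hy _ _ _).differentiableAt (by simp))]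
  rfl

theorem smooth_frameDeriv (lf : LocalFrame Ω g e) (hy : y ∈ Ω) {f : Coord → ℝ}
    (hf : ContDiffAt ℝ ∞ f y) (d : Fin 4) : ContDiffAt ℝ ∞ (frameDeriv e d f) y :=
  ContDiffAt.sum fun ν _ => (lf.smooth_e y hy d ν).mul (contDiffAt_pd hf ν)

theorem fderiv_concomitantComp_one (lf : LocalFrame Ω g e) (hy : y ∈ Ω) (d : Fin 4)
    (I : Fin 3 → Fin 4) (v : Coord) :
    fderiv ℝ (concomitantComp g e 1 (Fin.cons d I : Fin (3 + 1) → Fin 4)) y v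
      = minkowski (I 2) (I 2)
        * fderiv ℝ (frameDeriv e d (connCoeff g e (I 2) (I 1) (I 0))) y v := by
  have h1 : concomitantComp g e 1 (Fin.cons d I : Fin (3 + 1) → Fin 4) =ᶠ[𝓝 y] fun z =>
      frameDeriv e d (connCoeff g e (I 2) (I 1) (I 0)) z * minkowski (I 2) (I 2) := by
    filter_upwards [lf.mem_nhds hy] with z hz
    refine (lf.concomitantComp_succ hz 0 d I).trans ?_
    rw [lf.fderiv_concomitantComp_zero hz, frameDeriv_eq, mul_comm]
  rw [h1.fderiv_eq, fderiv_mul_const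
    ((lf.smooth_frameDeriv hy (lf.smooth_connCoeff hy _ _ _) d).differentiableAt (by simp))]
  rfl

theorem wedge_concomitant_zero_zero (lf : LocalFrame Ω g e) (hy : y ∈ Ω) :
    (∀ I J, Wedge (concomitantComp g e 0 I) (concomitantComp g e 0 J) y) ↔
      ∀ c a b c' a' b', Wedge (connCoeff g e c a b) (connCoeff g e c' a' b') y := by
  constructor
  · intro h c a b c' a' b' v w
    have h1 := h ![b, a, c] ![b', a', c'] v w
    simp only [lf.fderiv_concomitantComp_zero hy] at h1
    have h2 : ∀ v w, minkowski c c * fderiv ℝ (connCoeff g e c a b) y v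
        * (minkowski c' c' * fderiv ℝ (connCoeff g e c' a' b') y w)
        = minkowski c c * minkowski c' c' * (fderiv ℝ (connCoeff g e c a b) y v
          * fderiv ℝ (connCoeff g e c' a' b') y w) := fun v w => by ring
    exact mul_left_cancel₀
      (mul_ne_zero (minkowski_self_ne_zero c) (minkowski_self_ne_zero c'))
      ((h2 v w).symm.trans (Eq.trans h1 (h2 w v)))
  · intro h I J v w
    simp only [lf.fderiv_concomitantComp_zero hy]
    rw [mul_mul_mul_comm, h, mul_mul_mul_comm]

theorem wedge_concomitant_zero_one (lf : LocalFrame Ω g e) (hy : y ∈ Ω) :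
    (∀ I J, Wedge (concomitantComp g e 0 I) (concomitantComp g e 1 J) y) ↔
      ∀ c a b d c' a' b',
        Wedge (connCoeff g e c a b) (frameDeriv e d (connCoeff g e c' a' b')) y := by
  constructor
  · intro h c a b d c' a' b' v w
    have h1 := h ![b, a, c] (Fin.cons d ![b', a', c'] : Fin (3 + 1) → Fin 4) v w
    simp only [lf.fderiv_concomitantComp_zero hy, lf.fderiv_concomitantComp_one hy] at h1
    have h2 : ∀ v w, minkowski c c * fderiv ℝ (connCoeff g e c a b) y v
        * (minkowski c' c' * fderiv ℝ (frameDeriv e d (connCoeff g e c' a' b')) y w)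
        = minkowski c c * minkowski c' c' * (fderiv ℝ (connCoeff g e c a b) y v
          * fderiv ℝ (frameDeriv e d (connCoeff g e c' a' b')) y w) := fun v w => by ring
    exact mul_left_cancel₀
      (mul_ne_zero (minkowski_self_ne_zero c) (minkowski_self_ne_zero c'))
      ((h2 v w).symm.trans (Eq.trans h1 (h2 w v)))
  · intro h I J v w
    have hJ : J = (Fin.cons (J 0) (Fin.tail (n := 3) J) : Fin (3 + 1) → Fin 4) :=
      (Fin.cons_self_tail (n := 3) J).symm
    rw [hJ]
    simp only [lf.fderiv_concomitantComp_zero hy, lf.fderiv_concomitantComp_one hy]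
    rw [mul_mul_mul_comm, h, mul_mul_mul_comm]

/-- A tensor vanishes exactly when its frame components do, and here these are the derivatives
$e_d(\gamma^c_{ab})$ up to sign. -/
theorem concomitant_one_eq_zero_iff (lf : LocalFrame Ω g e) (hy : y ∈ Ω) :
    concomitant g e 1 y = 0 ↔ ∀ c a b, fderiv ℝ (connCoeff g e c a b) y = 0 := by
  constructor
  · intro h c a b
    refine lf.ext_frameVec hy fun d => ?_
    have h1 := lf.concomitantComp_succ hy 0 d ![b, a, c]
    rw [h, frameSum_zero, lf.fderiv_concomitantComp_zero hy] at h1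
    exact (mul_eq_zero.1 h1.symm).resolve_left (minkowski_self_ne_zero c)
  · intro h
    have h1 : frameSum (concomitant g e 1 y) (e y) = 0 := by
      funext I
      have hI : I = (Fin.cons (I 0) (Fin.tail (n := 3) I) : Fin (3 + 1) → Fin 4) :=
        (Fin.cons_self_tail (n := 3) I).symm
      rw [hI]
      refine (lf.concomitantComp_succ hy 0 (I 0) (Fin.tail (n := 3) I)).trans ?_
      rw [lf.fderiv_concomitantComp_zero hy, h]
      simp
    funext I
    rw [← frameSum_one (concomitant g e 1 y) I, ← lf.inv_mul_frame hy, ← frameSum_frameSum, h1,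
      frameSum_zero]
    rfl

end LocalFrame

/-! ### Charts -/

section Charts

variable {M : Type*} [TopologicalSpace M] [ChartedSpace Coord M]

theorem mfderiv_symm_mfderiv [IsManifold (𝓡 4) ∞ M] {φ : OpenPartialHomeomorph M Coord}
    (hφ : φ ∈ charts M) {y : Coord} (hy : y ∈ φ.target) (v : TangentSpace (𝓡 4) (φ.symm y)) :
    (show TangentSpace (𝓡 4) (φ.symm y) from mfderiv (𝓡 4) (𝓡 4) φ.symm y
      (show Coord from mfderiv (𝓡 4) (𝓡 4) φ (φ.symm y) v)) = v := by
  have hd : φ.MDifferentiable (𝓡 4) (𝓡 4) :=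
    ⟨(contMDiffOn_of_mem_maximalAtlas hφ).mdifferentiableOn (by simp),
      (contMDiffOn_symm_of_mem_maximalAtlas hφ).mdifferentiableOn (by simp)⟩
  have h1 := hd.symm_comp_deriv (φ.map_target hy)
  have h2 := DFunLike.congr_fun h1 v
  rw [φ.right_inv hy] at h2
  exact h2

/-- Bilinearity only; with $L$ the differential of the inverse chart it carries orthonormality from
the tangent spaces to chart components. -/
theorem sum_form_coordVec {E : Type*} [AddCommGroup E] [Module ℝ E] [TopologicalSpace E]
    [IsTopologicalAddGroup E] [ContinuousSMul ℝ E]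
    (B : E →L[ℝ] E →L[ℝ] ℝ) (L : Coord →L[ℝ] E) (u w : Coord) :
    ∑ μ, ∑ ν, B (L (coordVec μ)) (L (coordVec ν)) * u μ * w ν = B (L u) (L w) := by
  conv_rhs => rw [← sum_smul_coordVec u, ← sum_smul_coordVec w]
  simp only [map_sum, map_smul, _root_.sum_apply, _root_.smul_apply, smul_eq_mul, Finset.mul_sum]
  rw [Finset.sum_comm]
  exact Finset.sum_congr rfl fun μ _ => Finset.sum_congr rfl fun ν _ => by ring

theorem localFrame_inChart [IsManifold (𝓡 4) ∞ M] {g : LorentzMetric M} (e : OrthonormalFrame g)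
    {φ : OpenPartialHomeomorph M Coord} (hφ : φ ∈ charts M) :
    LocalFrame φ.target (g.inChart φ) (e.inChart φ) where
  isOpen := φ.open_target
  smooth_g y hy i j := by
    have h1 := (g.smooth φ hφ).contDiffAt (φ.open_target.mem_nhds hy)
    exact contDiffAt_pi.1 (contDiffAt_pi.1 h1 i) j
  symm y _ μ ν := g.symm _ _ _
  smooth_e y hy i j := by
    have h1 := (e.smooth φ hφ).contDiffAt (φ.open_target.mem_nhds hy)
    exact contDiffAt_pi.1 (contDiffAt_pi.1 h1 i) j
  orthonormal y hy a b := by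
    have h := sum_form_coordVec (g.form (φ.symm y)) (mfderiv (𝓡 4) (𝓡 4) φ.symm y)
      (mfderiv (𝓡 4) (𝓡 4) φ (φ.symm y) (e.vec a (φ.symm y)))
      (mfderiv (𝓡 4) (𝓡 4) φ (φ.symm y) (e.vec b (φ.symm y)))
    refine Eq.trans h ?_
    rw [← e.orthonormal (φ.symm y) a b]
    exact congrArg₂ (fun v w => g.form (φ.symm y) v w)
      (mfderiv_symm_mfderiv hφ hy (e.vec a (φ.symm y)))
      (mfderiv_symm_mfderiv hφ hy (e.vec b (φ.symm y)))

/-- The conditions on the concomitants, in a chart, in terms of the connection coefficients. -/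
theorem concomitant_conditions_iff [IsManifold (𝓡 4) ∞ M] {g : LorentzMetric M}
    (e : OrthonormalFrame g) :
    (e.C1NeZero ∧ e.EtaZero 0 0 ∧ e.EtaZero 0 1) ↔ ∀ φ ∈ charts M, ∀ y ∈ φ.target,
      (∃ c a b, fderiv ℝ (connCoeff (g.inChart φ) (e.inChart φ) c a b) y ≠ 0) ∧
      (∀ c a b c' a' b', Wedge (connCoeff (g.inChart φ) (e.inChart φ) c a b)
        (connCoeff (g.inChart φ) (e.inChart φ) c' a' b') y) ∧
      ∀ c a b d c' a' b', Wedge (connCoeff (g.inChart φ) (e.inChart φ) c a b)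
        (frameDeriv (e.inChart φ) d (connCoeff (g.inChart φ) (e.inChart φ) c' a' b')) y := by
  have hne : ∀ φ ∈ charts M, ∀ y ∈ φ.target, e.C 1 φ y ≠ 0 ↔
      ∃ c a b, fderiv ℝ (connCoeff (g.inChart φ) (e.inChart φ) c a b) y ≠ 0 := fun φ hφ y hy =>
    ((localFrame_inChart e hφ).concomitant_one_eq_zero_iff hy).not.trans (by push Not; rfl)
  have h0 := fun φ (hφ : φ ∈ charts M) y (hy : y ∈ φ.target) =>
    ((localFrame_inChart e hφ).volContract_concomitant_iff hy 0 0).trans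
      ((localFrame_inChart e hφ).wedge_concomitant_zero_zero hy)
  have h1 := fun φ (hφ : φ ∈ charts M) y (hy : y ∈ φ.target) =>
    ((localFrame_inChart e hφ).volContract_concomitant_iff hy 0 1).trans
      ((localFrame_inChart e hφ).wedge_concomitant_zero_one hy)
  constructor
  · rintro ⟨hC, hE, hF⟩ φ hφ y hy
    exact ⟨(hne φ hφ y hy).1 (hC φ hφ y hy), (h0 φ hφ y hy).1 (hE φ hφ y hy),
      (h1 φ hφ y hy).1 (hF φ hφ y hy)⟩
  · intro h
    exact ⟨fun φ hφ y hy => (hne φ hφ y hy).2 (h φ hφ y hy).1,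
      fun φ hφ y hy => (h0 φ hφ y hy).2 (h φ hφ y hy).2.1,
      fun φ hφ y hy => (h1 φ hφ y hy).2 (h φ hφ y hy).2.2⟩

end Charts

end Spacetime

end

/-! ### The two equivalences -/

open Spacetime in
theorem theorem2 {M : Type*} [TopologicalSpace M] [ChartedSpace (EuclideanSpace ℝ (Fin 4)) M]
    [IsManifold (𝓡 4) ∞ M] (g : LorentzMetric M) (e : OrthonormalFrame g)
    (hR : e.IsRiemannFrame) (hreg : e.C1Regular) :
    (g.AdmitsG 3 ↔ e.C1NeZero ∧ e.EtaZero 0 0 ∧ e.EtaZero 0 1) ∧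
      (e.C1NeZero ∧ e.EtaZero 0 0 ∧ e.EtaZero 0 1 ↔ e.SingleFunction) := by
  rw [concomitant_conditions_iff e]
  refine ⟨⟨fun h φ hφ y hy => ?_, fun h φ hφ y hy => ?_⟩,
    ⟨fun h φ hφ y₀ hy₀ => ?_, fun h φ hφ y hy => ?_⟩⟩
  · have lf := localFrame_inChart e hφ
    -- The regularity assumption on $C^{[1]}$ is translated into a statement about the differentials
    -- of the connection coefficients.
    refine lf.wedge_of_rank (hR φ hφ) hy (fun h0 => ?_) (h φ hφ y hy)
    filter_upwards [hreg φ hφ y hy ((lf.concomitant_one_eq_zero_iff hy).2 h0),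
      lf.isOpen.mem_nhds hy] with z hz hzt
    exact (lf.concomitant_one_eq_zero_iff hzt).1 hz
  · exact (localFrame_inChart e hφ).rank_of_wedge (hR φ hφ) hy (h φ hφ y hy).1
      (fun z hz => (h φ hφ z hz).2.1) fun z hz => (h φ hφ z hz).2.2
  · have lf := localFrame_inChart e hφ
    have hΩ := lf.isOpen.mem_nhds hy₀
    -- The single function is itself a connection coefficient, one whose differential does not
    -- vanish at the point.
    obtain ⟨c, a, b, hne⟩ := (h φ hφ y₀ hy₀).1
    have hx : ∀ᶠ z in 𝓝 y₀, ContDiffAt ℝ ∞ (connCoeff (g.inChart φ) (e.inChart φ) c a b) z := by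
      filter_upwards [hΩ] with z hz using lf.smooth_connCoeff hz c a b
    refine ⟨⟨c, a, b, hne⟩, connCoeff (g.inChart φ) (e.inChart φ) c a b, hx, fun i => ?_,
      fun i => ?_⟩
    · refine exists_eq_comp_of_wedge hx ?_ hne ?_
      · filter_upwards [hΩ] with z hz using lf.smooth_connCoeff hz _ _ _
      · filter_upwards [hΩ] with z hz using (h φ hφ z hz).2.1 _ _ _ _ _ _
    · refine exists_eq_comp_of_wedge hx ?_ hne ?_
      · filter_upwards [hΩ] with z hz using
          lf.smooth_frameDeriv hz (lf.smooth_connCoeff hz _ _ _) _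
      · filter_upwards [hΩ] with z hz using (h φ hφ z hz).2.2 _ _ _ _ _ _ _
  -- By the chain rule every differential involved is a multiple of $dx$, so any two are dependent;
  -- $dx\neq0$ need not be known here.
  · obtain ⟨hne, x, hx, h0, h1⟩ := h φ hφ y hy
    have hxd : DifferentiableAt ℝ x y := hx.self_of_nhds.differentiableAt (by simp)
    refine ⟨hne, fun c a b c' a' b' => ?_, fun c a b d c' a' b' => ?_⟩
    · obtain ⟨f, hf, hF⟩ := h0 (c, a, b)
      obtain ⟨k, hk, hK⟩ := h0 (c', a', b')
      exact wedge_of_eq_comp hxd (hf.self_of_nhds.differentiableAt (by simp))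
        (hk.self_of_nhds.differentiableAt (by simp)) hF hK
    · obtain ⟨f, hf, hF⟩ := h0 (c, a, b)
      obtain ⟨k, hk, hK⟩ := h1 (d, c', a', b')
      exact wedge_of_eq_comp hxd (hf.self_of_nhds.differentiableAt (by simp))
        (hk.self_of_nhds.differentiableAt (by simp)) hF hK
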